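/- Let $G(z)=e^{e^{z}}$, and put $a(r)=rG'(r)/G(r)$, $b(r)=ra'(r)$ for $r\ge 0$. An entire function $G$, real and positive at all sufficiently large $r>0$, is called admissible if $b(r)\to\infty$ as $r\to\infty$ and there is a function $\delta:[0,\infty)\to(0,\pi)$ such that, as $r\to\infty$, $$G(re^{i\theta})=G(r)\exp\left(i\theta a(r)-\tfrac12\theta^2b(r)\right)(1+o(1))\quad\text{uniformly for }|\theta|\le\delta(r),$$ $$|G(re^{i\theta})|=\frac{o(G(r))}{\sqrt{b(r)}}\quad\text{uniformly for }\delta(r)\le|\theta|\le\pi .$$ A random point process $\mathcal Z$ in $\mathbb C$ (a random locally finite set of points) is called fully rigid if for every bounded open set $D\subset\mathbb C$ and every integer $k\ge 0$ there is a measurable map $S_k$ from the locally finite point configurations in $\mathbb C\setminus D$ to $\mathbb C$ such that $\sum_{z\in D\cap\mathcal Z}z^k=S_k(\mathcal Z\cap(\mathbb C\setminus D))$ almost surely. Then: (i) $G$ is an admissible entire function of infinite order of growth, with $a(r)=re^{r}$ and $b(r)=r(r+1)e^{r}$ for $r\ge0$; in particular $\log b(r)/\log r\to\infty$ as $r\to\infty$.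 (ii) There is exactly one sequence $(a_n)_{n\ge0}$ of non-negative real numbers with $G(z)=\sum_{n\ge0}a_n^2z^n$ for all $z\in\mathbb C$. If $(\xi_n)_{n\ge0}$ are independent standard complex Gaussian random variables on a probability space, then almost surely the series $f(z)=\sum_{n\ge0}\xi_na_nz^n$ converges for all $z\in\mathbb C$ and $f$ is entire; its covariance kernel is $\mathbb E[f(z)\overline{f(w)}]=G(z\overline w)$ for all $z,w\in\mathbb C$; and its zero set $\mathcal Z_f=f^{-1}\{0\}$ is a fully rigid random point process. -/

import Mathlib

open MeasureTheory ProbabilityTheory Filter Topology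

/-! ### Admissible functions -/

/-- `a(r) = r G'(r) / G(r)`. (The value is real when `G` is real on the real axis.) -/
noncomputable def haymanA (G : ℂ → ℂ) (r : ℝ) : ℝ :=
  ((r : ℂ) * deriv G (r : ℂ) / G (r : ℂ)).re

/-- `b(r) = r a'(r)`. -/
noncomputable def haymanB (G : ℂ → ℂ) (r : ℝ) : ℝ :=
  r * deriv (haymanA G) r

/-- Admissibility of an entire function in the sense of Hayman. The function is required to be
real and positive far out on the positive half-line, so that `a` and `b` are meaningful. -/
structure IsAdmissible (G : ℂ → ℂ) : Prop where
  entire : Differentiable ℂ G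
  eventually_pos : ∀ᶠ r : ℝ in atTop, (G (r : ℂ)).im = 0 ∧ 0 < (G (r : ℂ)).re
  tendsto_b : Tendsto (haymanB G) atTop atTop
  exists_delta : ∃ δ : ℝ → ℝ, (∀ r, 0 ≤ r → 0 < δ r ∧ δ r < Real.pi) ∧
    (∀ ε : ℝ, 0 < ε → ∀ᶠ r : ℝ in atTop, ∀ θ : ℝ, |θ| ≤ δ r →
      ∃ η : ℂ, ‖η‖ ≤ ε ∧
        G ((r : ℂ) * Complex.exp (Complex.I * (θ : ℂ))) =
          G (r : ℂ) * Complex.exp (Complex.I * (θ : ℂ) * (haymanA G r : ℂ)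
            - (1 / 2 : ℂ) * (θ : ℂ) ^ 2 * (haymanB G r : ℂ)) * (1 + η)) ∧
    (∀ ε : ℝ, 0 < ε → ∀ᶠ r : ℝ in atTop, ∀ θ : ℝ, δ r ≤ |θ| → |θ| ≤ Real.pi →
      ‖G ((r : ℂ) * Complex.exp (Complex.I * (θ : ℂ)))‖ ≤
        ε * ‖G (r : ℂ)‖ / Real.sqrt (haymanB G r))

/-- `G` is of infinite order of growth: for no real `ρ` is `G(z) = O(exp(|z|^ρ))` at infinity. -/
def HasInfiniteOrder (G : ℂ → ℂ) : Prop :=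
  ∀ ρ : ℝ, ¬ Asymptotics.IsBigO (Bornology.cobounded ℂ) G (fun z => Real.exp (‖z‖ ^ ρ))

/-! ### Gaussian entire functions -/

/-- The standard complex Gaussian law: independent centred real and imaginary parts of
variance `1/2` each, so that `E|ξ|² = 1`. -/
noncomputable def standardComplexGaussian : Measure ℂ :=
  ((gaussianReal 0 (1 / 2)).prod (gaussianReal 0 (1 / 2))).map
    (fun p : ℝ × ℝ => (p.1 : ℂ) + (p.2 : ℂ) * Complex.I)

/-- `a` is the sequence of non-negative numbers with `G(z) = ∑ a_n² z^n` on all of `ℂ`. -/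
def IsKernelSequence (a : ℕ → ℝ) (G : ℂ → ℂ) : Prop :=
  (∀ n, 0 ≤ a n) ∧ ∀ z : ℂ, HasSum (fun n => ((a n : ℂ)) ^ 2 * z ^ n) (G z)

/-- The random Taylor series `f(z) = ∑ ξ_n a_n z^n`. -/
noncomputable def gaussianTaylorSeries {Ω : Type*} (a : ℕ → ℝ) (ξ : ℕ → Ω → ℂ)
    (ω : Ω) (z : ℂ) : ℂ :=
  ∑' n, ξ n ω * (a n : ℂ) * z ^ n

/-- The zero set `f⁻¹{0}` of a random function. -/
def zeroSet {Ω : Type*} (f : Ω → ℂ → ℂ) (ω : Ω) : Set ℂ := {z | f ω z = 0}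

/-! ### Point processes and rigidity -/

/-- Only finitely many points in each compact set. -/
def IsLocallyFiniteSet (Z : Set ℂ) : Prop :=
  ∀ K : Set ℂ, IsCompact K → (Z ∩ K).Finite

/-- Locally finite point configurations in `A ⊆ ℂ`. -/
def PointConfig (A : Set ℂ) : Type := {Z : Set ℂ // Z ⊆ A ∧ IsLocallyFiniteSet Z}

/-- The number of points of a configuration in `B`. -/
noncomputable def PointConfig.count {A : Set ℂ} (B : Set ℂ) (Z : PointConfig A) : ℕ∞ :=
  (Z.1 ∩ B).encard

/-- The usual σ-algebra: generated by the counts of points in bounded Borel sets. -/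
noncomputable instance PointConfig.instMeasurableSpace (A : Set ℂ) : MeasurableSpace (PointConfig A) :=
  ⨆ B : {B : Set ℂ // MeasurableSet B ∧ Bornology.IsBounded B},
    MeasurableSpace.comap (PointConfig.count B.1) ⊤

/-- `Z` is a random point process in `ℂ`: almost surely equal to a random element of the space of
locally finite configurations. -/
def IsPointProcess {Ω : Type*} [MeasurableSpace Ω] (P : Measure Ω) (Z : Ω → Set ℂ) : Prop :=
  ∃ X : Ω → PointConfig Set.univ, Measurable X ∧ ∀ᵐ ω ∂P, (X ω).1 = Z ω

/-- Rigidity of level `n ∈ ℕ⁺ ∪ {∞}`: for `0 ≤ k < n`, the `k`-th moment of the points in a bounded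
open set `D` is almost surely a (measurable) function of the configuration outside `D`.
(The sum is over a set that is almost surely finite.) -/
def IsRigid {Ω : Type*} [MeasurableSpace Ω] (P : Measure Ω) (Z : Ω → Set ℂ) (n : ℕ∞) : Prop :=
  IsPointProcess P Z ∧
  ∀ D : Set ℂ, IsOpen D → Bornology.IsBounded D → ∀ k : ℕ, (k : ℕ∞) < n →
    ∃ S : PointConfig Dᶜ → ℂ, Measurable S ∧
      ∀ᵐ ω ∂P, ∃ h : Z ω ∩ Dᶜ ⊆ Dᶜ ∧ IsLocallyFiniteSet (Z ω ∩ Dᶜ),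
        (D ∩ Z ω).Finite ∧ ∑ᶠ z ∈ D ∩ Z ω, z ^ k = S ⟨Z ω ∩ Dᶜ, h⟩

/-- Full rigidity: rigidity of level `∞`. -/
def IsFullyRigid {Ω : Type*} [MeasurableSpace Ω] (P : Measure Ω) (Z : Ω → Set ℂ) : Prop :=
  IsRigid P Z ⊤

/-- The double exponent `G(z) = exp(exp z)`. -/
noncomputable def doubleExp (z : ℂ) : ℂ := Complex.exp (Complex.exp z)

/-! ### The double exponential -/

/-! Analytic part. Since |exp(exp z)| = exp(Re exp z), everything on the circle |z| = r is read off
from exp(r e^{iθ}). A second-order expansion in θ, with error O(r³ e^r |θ|³), gives the Gaussian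
approximation for small θ. The bound |G(r e^{iθ})| ≤ G(r) exp(-e^r θ²/20) (`norm_doubleExp_le`)
handles the other angles. Expanding exp(exp z) as a double series gives the coefficients a_n².

Rigidity rests on a Jensen formula weighted by z^k. The circle average of z^k log|z - a| is r^{2k}
a^k L_k(max(r, |a|)), where L_0 = log and L_k(t) = -t^{-2k}/(2k)
(`circleAverage_pow_mul_log_norm_sub`). A zero-free factor contributes r^{2k} times a constant, so
comparing two radii removes it. The averages of z^k log|f| over the circles of radii r and 2r
therefore determine the sum over the zeros of a compactly supported function which equals z^k on the
disc of radius r (`sum_pow_mul_radialLog_sub`, `finsum_momentCutoff_sub_momentMean`).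

Those averages are almost deterministic. On |z| = r the variable f(z), divided by its standard
deviation, is a standard complex Gaussian. The logarithms of two such variables with correlation ρ
have covariance O(|ρ|) (`exists_abs_integral_centredLog_mul_le`). At angular distance t the
correlation is at most exp(-e^{r²} t²/20) in modulus, so the variance of the average is O(r^{2k}
e^{-r²/2}). For every k this is summable over integer radii, and the fluctuations tend to 0 almost
surely (`IsDoubleExpSeries.ae_tendsto_circleFluctuation`).

Hence, once the disc of radius n contains D, the k-th moment of the zeros in D equals a
deterministic number, minus the smoothed sum over the zeros outside D, up to o(1). The limit over n
is the required measurable functional. Zeros are collected in a set, without multiplicity, whereas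
Jensen's formula counts multiplicity; almost sure simplicity of the zeros (`ae_simple_zeros`)
reconciles the two. -/

lemma doubleExp_ofReal (r : ℝ) : doubleExp r = (Real.exp (Real.exp r) : ℂ) := by
  simp [doubleExp]

lemma norm_doubleExp_ofReal (r : ℝ) : ‖doubleExp r‖ = Real.exp (Real.exp r) := by
  rw [doubleExp_ofReal, Complex.norm_real, Real.norm_of_nonneg (Real.exp_pos _).le]

lemma hasDerivAt_doubleExp (z : ℂ) : HasDerivAt doubleExp (doubleExp z * Complex.exp z) z :=
  (Complex.hasDerivAt_exp z).cexp

lemma haymanA_doubleExp (r : ℝ) : haymanA doubleExp r = r * Real.exp r := by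
  have h : doubleExp (r : ℂ) ≠ 0 := Complex.exp_ne_zero _
  rw [haymanA, (hasDerivAt_doubleExp _).deriv]
  have : (r : ℂ) * (doubleExp r * Complex.exp r) / doubleExp r = ((r * Real.exp r : ℝ) : ℂ) := by
    push_cast
    field_simp
  rw [this, Complex.ofReal_re]

lemma haymanB_doubleExp (r : ℝ) : haymanB doubleExp r = r * (r + 1) * Real.exp r := by
  have h1 : haymanA doubleExp = fun r => r * Real.exp r := funext haymanA_doubleExp
  have h2 : HasDerivAt (fun r : ℝ => r * Real.exp r) (1 * Real.exp r + r * Real.exp r) r :=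
    (hasDerivAt_id r).mul (Real.hasDerivAt_exp r)
  rw [haymanB, h1, h2.deriv]
  ring

/-- Used twice: with R = r for the tail estimate in admissibility, and with R = r² for the
correlation between two points of the circle of radius r. It follows from |exp(exp w)| ≤ exp(e^{Re
w}) and a quadratic upper bound for the cosine on [-π, π]. -/
lemma norm_doubleExp_le {R t : ℝ} (hR : 1 ≤ R) (ht : |t| ≤ Real.pi) :
    ‖doubleExp ((R : ℂ) * Complex.exp (Complex.I * t))‖ ≤
      Real.exp (Real.exp R) * Real.exp (-(Real.exp R * t ^ 2 / 20)) := by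
  have hre : ((R : ℂ) * Complex.exp (Complex.I * t)).re = R * Real.cos t := by
    rw [Complex.re_ofReal_mul, mul_comm Complex.I, Complex.exp_ofReal_mul_I_re]
  have h1 : ‖doubleExp ((R : ℂ) * Complex.exp (Complex.I * t))‖ ≤
      Real.exp (Real.exp (R * Real.cos t)) := by
    rw [doubleExp, Complex.norm_exp]
    refine Real.exp_le_exp.2 ((Complex.re_le_norm _).trans ?_)
    rw [Complex.norm_exp, hre]
  refine h1.trans ?_
  rw [← Real.exp_add]
  refine Real.exp_le_exp.2 ?_
  have hcos := Real.cos_le_one_sub_mul_cos_sq ht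
  have hpi : Real.pi ^ 2 ≤ 10 := by nlinarith [Real.pi_lt_d2, Real.pi_pos]
  have ht2 : t ^ 2 ≤ 10 := (sq_le_sq' (by linarith [abs_le.1 ht]) (abs_le.1 ht).2).trans hpi
  have hc : Real.cos t ≤ 1 - t ^ 2 / 5 := by
    have : 1 / 5 ≤ 2 / Real.pi ^ 2 := by
      rw [div_le_div_iff₀ (by norm_num) (by positivity)]; linarith
    nlinarith [sq_nonneg t]
  have hx : R * Real.cos t ≤ R - t ^ 2 / 5 := by nlinarith [sq_nonneg t]
  -- From e^x ≥ 1 + x it suffices that (1 + t²/5)(1 - t²/20) ≥ 1, that is t² ≤ 15; here t² ≤ π² ≤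
  -- 10.
  have h2 : Real.exp (-(t ^ 2 / 5)) ≤ 1 - t ^ 2 / 20 := by
    rw [Real.exp_neg, inv_le_comm₀ (Real.exp_pos _) (by linarith)]
    refine le_trans ?_ (Real.add_one_le_exp _)
    rw [inv_le_iff_one_le_mul₀ (by linarith)]
    nlinarith [sq_nonneg t]
  calc Real.exp (R * Real.cos t) ≤ Real.exp (R - t ^ 2 / 5) := Real.exp_le_exp.2 hx
    _ = Real.exp R * Real.exp (-(t ^ 2 / 5)) := by rw [← Real.exp_add]; ring_nf
    _ ≤ Real.exp R * (1 - t ^ 2 / 20) := by gcongr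
    _ = _ := by ring

/-- With v = iθ and w = e^v - 1, one has exp(r e^v) = e^r exp(rw). The cubic remainders come from
expanding exp(rw) at rw, expanding e^v at v, and replacing w² by v². The condition r|θ| ≤ 1 keeps
both arguments in the unit disc. -/
lemma norm_exp_mul_exp_I_sub_le {r θ : ℝ} (hr : 1 ≤ r) (hθ : r * |θ| ≤ 1) :
    ‖Complex.exp ((r : ℂ) * Complex.exp (Complex.I * θ)) - (Real.exp r : ℂ) *
      (1 + Complex.I * θ * r - (θ : ℂ) ^ 2 / 2 * (r * (r + 1)))‖ ≤
        Real.exp r * (4 * r ^ 3 * |θ| ^ 3) := by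
  have hθ1 : |θ| ≤ 1 := by nlinarith [abs_nonneg θ]
  set v : ℂ := Complex.I * θ with hv
  have hvn : ‖v‖ = |θ| := by simp [hv]
  have hvsq : v ^ 2 = -(θ : ℂ) ^ 2 := by rw [hv, mul_pow, Complex.I_sq]; ring
  have hb (x : ℂ) (hx : ‖x‖ ≤ 1) : ‖Complex.exp x - 1 - x - x ^ 2 / 2‖ ≤ ‖x‖ ^ 3 := by
    have := Complex.exp_bound hx (n := 3) (by norm_num)
    simp only [Finset.sum_range_succ, Finset.sum_range_zero, Nat.factorial] at this
    norm_num at this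
    calc _ = ‖Complex.exp x - (1 + x + x ^ 2 / 2)‖ := by congr 1; ring
      _ ≤ ‖x‖ ^ 3 * (2 / 9) := this
      _ ≤ _ := by nlinarith [pow_nonneg (norm_nonneg x) 3]
  set E := Complex.exp v - 1 - v - v ^ 2 / 2 with hE
  have hEn : ‖E‖ ≤ |θ| ^ 3 := by rw [← hvn]; exact hb v (by rw [hvn]; exact hθ1)
  set w := Complex.exp v - 1 with hw
  have hF : ‖w - v‖ ≤ |θ| ^ 2 := by
    rw [← hvn]; exact Complex.norm_exp_sub_one_sub_id_le (by rw [hvn]; exact hθ1)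
  have hwn : ‖w‖ ≤ |θ| := by
    rw [hw, hv]; simpa using Real.norm_exp_I_mul_ofReal_sub_one_le (x := θ)
  have hu : ‖(r : ℂ) * w‖ ≤ r * |θ| := by
    rw [norm_mul, Complex.norm_real, Real.norm_of_nonneg (by linarith)]; gcongr
  have h3 := hb (r * w) (hu.trans hθ)
  have h3' : ‖(r : ℂ) * w‖ ^ 3 ≤ (r * |θ|) ^ 3 := by gcongr
  have h4 : ‖w ^ 2 - v ^ 2‖ ≤ 2 * |θ| ^ 3 := by
    have : w ^ 2 - v ^ 2 = (w - v) * (w + v) := by ring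
    rw [this, norm_mul]
    calc _ ≤ |θ| ^ 2 * (|θ| + |θ|) := by
          gcongr; exact (norm_add_le _ _).trans (by rw [hvn]; gcongr)
      _ = _ := by ring
  have hdec : Complex.exp ((r : ℂ) * Complex.exp v) - (Real.exp r : ℂ) *
      (1 + v * r - (θ : ℂ) ^ 2 / 2 * (r * (r + 1))) = (Real.exp r : ℂ) *
      ((Complex.exp (r * w) - 1 - r * w - (r * w) ^ 2 / 2) + r * E +
        r ^ 2 / 2 * (w ^ 2 - v ^ 2)) := by
    have : Complex.exp ((r : ℂ) * Complex.exp v) = Real.exp r * Complex.exp (r * w) := by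
      rw [Complex.ofReal_exp, ← Complex.exp_add, hw]; ring_nf
    have hθ2 : (θ : ℂ) ^ 2 = -v ^ 2 := by rw [hvsq]; ring
    rw [this, hE, hθ2, hw]
    ring
  rw [hdec, norm_mul, Complex.norm_real, Real.norm_of_nonneg (Real.exp_pos _).le]
  gcongr
  have hr0 : 0 ≤ r := by linarith
  have hrn : ‖(r : ℂ)‖ = r := by rw [Complex.norm_real, Real.norm_of_nonneg hr0]
  calc _ ≤ (r * |θ|) ^ 3 + r * |θ| ^ 3 + r ^ 2 / 2 * (2 * |θ| ^ 3) := by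
        refine (norm_add₃_le).trans ?_
        rw [norm_mul, norm_mul, norm_div, norm_pow, hrn]
        simp only [Complex.norm_ofNat]
        gcongr
        exact h3.trans h3'
    _ = (r ^ 3 + r + r ^ 2) * |θ| ^ 3 := by ring
    _ ≤ _ := by
        gcongr
        nlinarith [mul_nonneg hr0 hr0, mul_nonneg (mul_nonneg hr0 hr0) (sub_nonneg.2 hr),
          mul_nonneg hr0 (sub_nonneg.2 hr)]

lemma tendsto_pow_mul_exp_neg_div (n : ℕ) {c : ℝ} (hc : 0 < c) :
    Tendsto (fun s : ℝ => s ^ n * Real.exp (-(s / c))) atTop (𝓝 0) := by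
  have h := ((Real.tendsto_pow_mul_exp_neg_atTop_nhds_zero n).comp
    (tendsto_id.atTop_div_const hc)).const_mul (c ^ n)
  rw [mul_zero] at h
  refine h.congr fun s => ?_
  simp only [Function.comp, id]
  rw [div_pow]
  field_simp

theorem isAdmissible_doubleExp : IsAdmissible doubleExp where
  entire := fun z => (hasDerivAt_doubleExp z).differentiableAt
  eventually_pos := Eventually.of_forall fun r => by
    rw [doubleExp_ofReal]
    exact ⟨Complex.ofReal_im _, by rw [Complex.ofReal_re]; exact Real.exp_pos _⟩
  tendsto_b := by
    refine tendsto_atTop_mono' _ ?_ Real.tendsto_exp_atTop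
    filter_upwards [eventually_ge_atTop 1] with r hr
    rw [haymanB_doubleExp]
    have := Real.exp_pos r
    nlinarith [mul_pos this (by linarith : 0 < r)]
  exists_delta := by
    -- The exponent 2/5 lies strictly between 1/3 and 1/2: r³ e^r δ³ = r³ e^{-r/5} tends to 0, so
    -- the cubic error vanishes, while e^r δ² = e^{r/5} tends to infinity, so the tail is
    -- negligible.
    refine ⟨fun r => Real.exp (-(2 * r / 5)), fun r hr => ⟨Real.exp_pos _, ?_⟩, ?_, ?_⟩
    · calc Real.exp (-(2 * r / 5)) ≤ 1 := Real.exp_le_one_iff.2 (by linarith)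
        _ < Real.pi := by linarith [Real.pi_gt_three]
    · intro ε hε
      have hlim := (tendsto_pow_mul_exp_neg_div 3 (c := 5) (by norm_num)).const_mul 8
      rw [mul_zero] at hlim
      have hlim1 := tendsto_pow_mul_exp_neg_div 1 (c := 5 / 2) (by norm_num)
      filter_upwards [eventually_ge_atTop 1, hlim.eventually_le_const (lt_min hε one_pos),
        hlim1.eventually_le_const one_pos] with r hr h1 h2 θ hθ
      have hr0 : 0 ≤ r := by linarith
      have hrθ : r * |θ| ≤ 1 := by
        refine (mul_le_mul_of_nonneg_left hθ hr0).trans ?_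
        rw [pow_one] at h2
        convert h2 using 4
        ring
      set D := Complex.exp ((r : ℂ) * Complex.exp (Complex.I * θ)) - (Real.exp r : ℂ) *
        (1 + Complex.I * θ * r - (θ : ℂ) ^ 2 / 2 * (r * (r + 1))) with hD
      have hDn : 2 * ‖D‖ ≤ min ε 1 := by
        refine le_trans ?_ h1
        calc 2 * ‖D‖ ≤ 2 * (Real.exp r * (4 * r ^ 3 * |θ| ^ 3)) := by
              gcongr; exact norm_exp_mul_exp_I_sub_le hr hrθ
          _ ≤ 2 * (Real.exp r * (4 * r ^ 3 * Real.exp (-(2 * r / 5)) ^ 3)) := by gcongr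
          _ = 8 * (r ^ 3 * (Real.exp r * Real.exp (-(2 * r / 5)) ^ 3)) := by ring
          _ = _ := by
              rw [← Real.exp_nat_mul, ← Real.exp_add]
              ring_nf
      refine ⟨Complex.exp D - 1, ?_, ?_⟩
      · refine (Complex.norm_exp_sub_one_le ?_).trans (hDn.trans (min_le_left _ _))
        linarith [min_le_right ε 1, norm_nonneg D]
      · rw [haymanA_doubleExp, haymanB_doubleExp, doubleExp_ofReal]
        rw [add_sub_cancel, Complex.ofReal_exp, ← Complex.exp_add, ← Complex.exp_add, doubleExp]
        congr 1
        rw [hD]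
        push_cast
        ring
    · intro ε hε
      have hs : Tendsto (fun r : ℝ => Real.exp (r / 5)) atTop atTop :=
        Real.tendsto_exp_atTop.comp (tendsto_id.atTop_div_const (by norm_num))
      -- In the variable s = e^{r/5}, the tail factor is at most exp(-s/20) and √b(r) ≤ e^{2r} =
      -- s^{10}.
      have hlim := (tendsto_pow_mul_exp_neg_div 10 (c := 20) (by norm_num)).comp hs
      filter_upwards [eventually_ge_atTop 1, hlim.eventually_le_const hε] with r hr h1 θ hθ1 hθ2
      simp only [Function.comp] at h1
      have hr0 : 0 ≤ r := by linarith
      rw [norm_doubleExp_ofReal, haymanB_doubleExp]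
      have hb : 0 < r * (r + 1) * Real.exp r := by positivity
      rw [le_div_iff₀ (Real.sqrt_pos.2 hb)]
      have hsq : √(r * (r + 1) * Real.exp r) ≤ Real.exp (r / 5) ^ 10 := by
        rw [Real.sqrt_le_left (by positivity), ← pow_mul, ← Real.exp_nat_mul]
        have h2 : r + 1 ≤ Real.exp r := Real.add_one_le_exp r
        have h3 : 1 ≤ Real.exp r := by linarith
        calc r * (r + 1) * Real.exp r ≤ Real.exp r * Real.exp r * Real.exp r := by
              gcongr; linarith
          _ ≤ Real.exp r * Real.exp r * Real.exp r * Real.exp r :=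
              le_mul_of_one_le_right (by positivity) h3
          _ = _ := by rw [← Real.exp_add, ← Real.exp_add, ← Real.exp_add]; push_cast; ring_nf
      have hexp : Real.exp (-(Real.exp r * θ ^ 2 / 20)) ≤ Real.exp (-(Real.exp (r / 5) / 20)) := by
        refine Real.exp_le_exp.2 (neg_le_neg ?_)
        gcongr
        calc Real.exp (r / 5) = Real.exp r * Real.exp (-(2 * r / 5)) ^ 2 := by
              rw [← Real.exp_nat_mul, ← Real.exp_add]; push_cast; ring_nf
          _ ≤ Real.exp r * |θ| ^ 2 := by gcongr
          _ = _ := by rw [sq_abs]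
      calc _ ≤ Real.exp (Real.exp r) * Real.exp (-(Real.exp r * θ ^ 2 / 20)) *
            Real.exp (r / 5) ^ 10 := by
            gcongr
            exact norm_doubleExp_le hr hθ2
        _ ≤ Real.exp (Real.exp r) * Real.exp (-(Real.exp (r / 5) / 20)) *
            Real.exp (r / 5) ^ 10 := by gcongr
        _ = Real.exp (r / 5) ^ 10 * Real.exp (-(Real.exp (r / 5) / 20)) *
            Real.exp (Real.exp r) := by ring
        _ ≤ _ := by gcongr

theorem hasInfiniteOrder_doubleExp : HasInfiniteOrder doubleExp := by
  intro ρ h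
  have htop : Tendsto (fun r : ℝ => (r : ℂ)) atTop (Bornology.cobounded ℂ) := by
    rw [← tendsto_norm_atTop_iff_cobounded]
    exact tendsto_norm_atTop_atTop.congr fun r => (Complex.norm_real r).symm
  obtain ⟨C, hC⟩ := (h.comp_tendsto htop).bound
  have hlog : Tendsto (fun r : ℝ => Real.exp r - r ^ ρ) atTop atTop := by
    have h1 := tendsto_exp_div_rpow_atTop ρ
    have h2 : Tendsto (fun r : ℝ => (Real.exp r) / 2) atTop atTop :=
      Real.tendsto_exp_atTop.atTop_div_const (by norm_num)
    refine tendsto_atTop_mono' _ ?_ h2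
    filter_upwards [h1.eventually_ge_atTop 2, eventually_gt_atTop 0] with r hr hr0
    rw [le_div_iff₀ (Real.rpow_pos_of_pos hr0 _)] at hr
    linarith
  have hexp := Real.tendsto_exp_atTop.comp hlog
  obtain ⟨r, h1, h2, h3⟩ := (hC.and ((hexp.eventually_gt_atTop C).and
    (eventually_ge_atTop 0))).exists
  simp only [Function.comp] at h1 h2
  rw [norm_doubleExp_ofReal, Complex.norm_real, Real.norm_of_nonneg h3,
    Real.norm_of_nonneg (Real.exp_pos _).le] at h1
  rw [Real.exp_sub, lt_div_iff₀ (Real.exp_pos _)] at h2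
  linarith

theorem tendsto_log_haymanB_doubleExp_div_log :
    Tendsto (fun r : ℝ => Real.log (haymanB doubleExp r) / Real.log r) atTop atTop := by
  -- Since log b(r) ≥ r for r > 1, the quotient dominates r / log r, written as e^u / u with u = log
  -- r.
  have h1 : Tendsto (fun r : ℝ => Real.exp (Real.log r) / Real.log r ^ 1) atTop atTop :=
    (Real.tendsto_exp_div_pow_atTop 1).comp Real.tendsto_log_atTop
  refine tendsto_atTop_mono' _ ?_ h1
  filter_upwards [eventually_gt_atTop 1] with r hr
  have hl : 0 < Real.log r := Real.log_pos hr
  rw [haymanB_doubleExp, Real.exp_log (by linarith), pow_one]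
  gcongr
  rw [Real.log_mul (by nlinarith) (Real.exp_pos _).ne', Real.log_exp]
  linarith [Real.log_nonneg (by nlinarith : 1 ≤ r * (r + 1))]

/-! ### The kernel sequence -/

lemma eq_zero_of_forall_hasSum_pow {c : ℕ → ℂ} (h : ∀ z : ℂ, HasSum (fun n => c n * z ^ n) 0) :
    c = 0 := by
  have hs : HasFPowerSeriesOnBall (fun _ : ℂ => (0 : ℂ)) (FormalMultilinearSeries.ofScalars ℂ c)
      0 1 := by
    refine ⟨?_, one_pos, fun {y} _ => ?_⟩
    · have := FormalMultilinearSeries.le_radius_of_summable_norm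
        (FormalMultilinearSeries.ofScalars ℂ c) (r := 1) ?_
      · simpa using this
      · refine (h 1).summable.norm.congr fun n => ?_
        simp
    · simpa [FormalMultilinearSeries.ofScalars_apply_eq, mul_comm] using h y
  have h0 := hs.hasFPowerSeriesAt.eq_zero
  funext n
  have := congrArg (fun p : FormalMultilinearSeries ℂ ℂ ℂ => p.coeff n) h0
  rw [FormalMultilinearSeries.coeff_ofScalars] at this
  exact this

lemma IsKernelSequence.unique {a a' : ℕ → ℝ} {G : ℂ → ℂ} (h : IsKernelSequence a G)
    (h' : IsKernelSequence a' G) : a = a' := by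
  have h0 := eq_zero_of_forall_hasSum_pow (c := fun n => (a n : ℂ) ^ 2 - (a' n : ℂ) ^ 2) fun z => by
    simpa [sub_mul] using (h.2 z).sub (h'.2 z)
  funext n
  have := congrFun h0 n
  simp only [Pi.zero_apply, sub_eq_zero] at this
  norm_cast at this
  exact (sq_eq_sq₀ (h.1 n) (h'.1 n)).1 this

lemma hasSum_cexp (w : ℂ) : HasSum (fun n : ℕ => w ^ n / (n.factorial : ℂ)) (Complex.exp w) := by
  rw [Complex.exp_eq_exp_ℂ]
  exact NormedSpace.expSeries_div_hasSum_exp w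

/-- Expanding exp(exp z) = Σ_m e^{mz}/m! and then each e^{mz} gives an absolutely convergent double
series. Summing over m first produces a_n² = (1/n!) Σ_m m^n/m!, which is non-negative. -/
lemma exists_isKernelSequence_doubleExp : ∃ a : ℕ → ℝ, IsKernelSequence a doubleExp := by
  let F : ℂ → ℕ × ℕ → ℂ := fun z p =>
    ((p.1.factorial : ℂ))⁻¹ * (((p.1 : ℂ) * z) ^ p.2 / (p.2.factorial : ℂ))
  have hfib (z : ℂ) (m : ℕ) : HasSum (fun n => F z (m, n))
      ((m.factorial : ℂ)⁻¹ * Complex.exp (m * z)) :=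
    (hasSum_cexp ((m : ℂ) * z)).mul_left ((m.factorial : ℂ)⁻¹)
  have hfib2 (z : ℂ) : HasSum (fun m : ℕ => (m.factorial : ℂ)⁻¹ * Complex.exp (m * z))
      (doubleExp z) := by
    have h := hasSum_cexp (Complex.exp z)
    simp_rw [← Complex.exp_nat_mul, div_eq_inv_mul] at h
    exact h
  have hnorm (z : ℂ) (p : ℕ × ℕ) : ‖F z p‖ =
      ((p.1.factorial : ℝ))⁻¹ * (((p.1 : ℝ) * ‖z‖) ^ p.2 / (p.2.factorial : ℝ)) := by
    simp [F]
  have hreal (x : ℝ) : HasSum (fun n : ℕ => x ^ n / (n.factorial : ℝ)) (Real.exp x) := by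
    rw [Real.exp_eq_exp_ℝ]
    exact NormedSpace.expSeries_div_hasSum_exp x
  have hsum (z : ℂ) : Summable (F z) := by
    refine Summable.of_norm ((summable_prod_of_nonneg fun _ => norm_nonneg _).2 ⟨fun m => ?_, ?_⟩)
    · exact (hfib z m).summable.norm
    · refine (hreal (Real.exp ‖z‖)).summable.congr fun m => ?_
      simp_rw [hnorm]
      rw [tsum_mul_left, (hreal _).tsum_eq, Real.exp_nat_mul, inv_mul_eq_div]
  have hG (z : ℂ) : HasSum (F z) (doubleExp z) := by
    have h1 := (hsum z).hasSum
    rwa [(h1.prod_fiberwise (hfib z)).unique (hfib2 z)] at h1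
  let c : ℕ → ℝ := fun n => ∑' m : ℕ, (m.factorial : ℝ)⁻¹ * ((m : ℝ) ^ n / (n.factorial : ℝ))
  have hc0 (n : ℕ) : 0 ≤ c n := tsum_nonneg fun m => by positivity
  have hc (z : ℂ) (n : ℕ) : HasSum (fun m => F z (m, n)) ((c n : ℂ) * z ^ n) := by
    have hs : Summable fun m : ℕ => (m.factorial : ℝ)⁻¹ * ((m : ℝ) ^ n / (n.factorial : ℝ)) := by
      refine ((hsum 1).norm.comp_injective (i := fun m : ℕ => (m, n))
        (fun a b h => (Prod.ext_iff.1 h).1)).congr fun m => ?_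
      simp [hnorm]
    have h := (Complex.hasSum_ofReal.2 hs.hasSum).mul_right (z ^ n)
    refine (congrArg (fun f => HasSum f _) (funext fun m => ?_)).mp h
    simp only [F]
    push_cast
    ring
  refine ⟨fun n => √(c n), fun n => Real.sqrt_nonneg _, fun z => ?_⟩
  have h := ((Equiv.prodComm ℕ ℕ).hasSum_iff.2 (hG z)).prod_fiberwise (hc z)
  convert h using 3 with n
  rw [← Complex.ofReal_pow, Real.sq_sqrt (hc0 n)]

theorem existsUnique_isKernelSequence_doubleExp : ∃! a : ℕ → ℝ, IsKernelSequence a doubleExp :=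
  let ⟨a, ha⟩ := exists_isKernelSequence_doubleExp
  ⟨a, ha, fun _ h => h.unique ha⟩

/-- The kernel controls a_n², whereas the random series needs a_n. Writing a_n r^n = (a_n (2r)^n)
2^{-n} and using xy ≤ x² + y² leaves the kernel series at (2r)² and a geometric series. -/
lemma IsKernelSequence.summable {a : ℕ → ℝ} {G : ℂ → ℂ} (h : IsKernelSequence a G) {r : ℝ}
    (hr : 0 ≤ r) : Summable fun n => a n * r ^ n := by
  have h1 : Summable fun n => (a n) ^ 2 * ((2 * r) ^ 2) ^ n := by
    refine (h.2 (((2 * r) ^ 2 : ℝ) : ℂ)).summable.norm.congr fun n => ?_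
    simp [abs_of_nonneg hr]
  have h2 : Summable fun n : ℕ => ((1 / 4 : ℝ)) ^ n :=
    summable_geometric_of_lt_one (by norm_num) (by norm_num)
  refine Summable.of_nonneg_of_le (fun n => mul_nonneg (h.1 n) (pow_nonneg hr n)) (fun n => ?_)
    (h1.add h2)
  have h3 : a n * r ^ n = (a n * (2 * r) ^ n) * (1 / 2) ^ n := by
    rw [mul_assoc, ← mul_pow]; ring_nf
  have h4 : (a n) ^ 2 * ((2 * r) ^ 2) ^ n = (a n * (2 * r) ^ n) ^ 2 := by
    rw [mul_pow (a n), ← pow_mul, ← pow_mul, mul_comm 2 n]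
  have h5 : (1 / 4 : ℝ) ^ n = ((1 / 2) ^ n) ^ 2 := by
    rw [← pow_mul, mul_comm, pow_mul]; norm_num
  rw [h3, h4, h5]
  nlinarith [sq_nonneg (a n * (2 * r) ^ n - (1 / 2) ^ n), sq_nonneg (a n * (2 * r) ^ n),
    sq_nonneg ((1 / 2 : ℝ) ^ n)]

lemma IsKernelSequence.hasSum_real {a : ℕ → ℝ} (h : IsKernelSequence a doubleExp) (x : ℝ) :
    HasSum (fun n => (a n) ^ 2 * x ^ n) (Real.exp (Real.exp x)) := by
  have := h.2 x
  rw [doubleExp_ofReal] at this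
  exact_mod_cast this

lemma IsKernelSequence.zero_pos {a : ℕ → ℝ} (h : IsKernelSequence a doubleExp) : 0 < a 0 := by
  have h1 : (a 0) ^ 2 = Real.exp (Real.exp 0) := by
    refine HasSum.unique ?_ (h.hasSum_real 0)
    convert hasSum_single (f := fun n => (a n) ^ 2 * (0 : ℝ) ^ n) 0 ?_ using 1
    · simp
    · intro n hn; simp [hn]
  have h2 := Real.exp_pos (Real.exp 0)
  exact lt_of_le_of_ne (h.1 0) fun h0 => by rw [← h0] at h1; norm_num at h1; exact (Real.exp_pos 1).ne h1

/-! ### A weighted Jensen formula -/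

lemma integral_exp_int_mul (m : ℤ) :
    ∫ θ in (0 : ℝ)..2 * Real.pi, Complex.exp (m * (θ * Complex.I)) =
      if m = 0 then 2 * Real.pi else 0 := by
  split_ifs with hm
  · subst hm; simp
  · have hc : (m : ℂ) * Complex.I ≠ 0 := mul_ne_zero (Int.cast_ne_zero.2 hm) Complex.I_ne_zero
    have := integral_exp_mul_complex (a := 0) (b := 2 * Real.pi) hc
    have h2 : Complex.exp ((m : ℂ) * Complex.I * ((2 * Real.pi : ℝ) : ℂ)) = 1 := by
      rw [← Complex.exp_int_mul_two_pi_mul_I m]; push_cast; ring_nf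
    rw [h2] at this
    simpa [mul_assoc, mul_comm Complex.I] using this

lemma circleAverage_pow_mul_conj_pow (r : ℝ) (k n : ℕ) :
    Real.circleAverage (fun z : ℂ => z ^ k * (starRingEnd ℂ z) ^ n) 0 r =
      if k = n then (r : ℂ) ^ (2 * k) else 0 := by
  have h (θ : ℝ) : (circleMap 0 r θ) ^ k * (starRingEnd ℂ (circleMap 0 r θ)) ^ n =
      (r : ℂ) ^ (k + n) * Complex.exp (((k : ℤ) - (n : ℤ) : ℤ) * (θ * Complex.I)) := by
    simp only [circleMap, zero_add, map_mul, Complex.conj_ofReal, ← Complex.exp_conj,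
      Complex.conj_I, mul_pow, ← Complex.exp_nat_mul]
    rw [mul_mul_mul_comm, ← pow_add, ← Complex.exp_add]
    congr 2
    push_cast
    ring
  rw [Real.circleAverage_def]
  simp_rw [h]
  rw [intervalIntegral.integral_const_mul, integral_exp_int_mul]
  by_cases hkn : k = n
  · subst hkn
    rw [if_pos (sub_self _), if_pos rfl, Complex.real_smul]
    have := Real.pi_ne_zero
    push_cast
    field_simp
    ring
  · rw [if_neg (by omega), if_neg hkn]; simp

lemma circleAverage_pow (r : ℝ) (k : ℕ) :
    Real.circleAverage (fun z : ℂ => z ^ k) 0 r = if k = 0 then 1 else 0 := by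
  have := circleAverage_pow_mul_conj_pow r k 0
  simp only [pow_zero, mul_one] at this
  rw [this]
  split_ifs with h <;> simp [h]

lemma circleIntegrable_of_continuous {f : ℂ → ℂ} (hf : Continuous f) (r : ℝ) :
    CircleIntegrable f 0 r := hf.continuousOn.circleIntegrable'

lemma hasSum_circleAverage {F : ℕ → ℂ → ℂ} {G : ℂ → ℂ} {r : ℝ} {b : ℕ → ℝ} (hr : 0 ≤ r)
    (hF : ∀ n, Continuous (F n)) (hb : Summable b) (hFb : ∀ n z, ‖z‖ = r → ‖F n z‖ ≤ b n)
    (hG : ∀ z, ‖z‖ = r → HasSum (fun n => F n z) (G z)) :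
    HasSum (fun n => Real.circleAverage (F n) 0 r) (Real.circleAverage G 0 r) := by
  simp only [Real.circleAverage_def]
  refine HasSum.const_smul _ ?_
  have hn (θ : ℝ) : ‖circleMap 0 r θ‖ = r := by simp [abs_of_nonneg hr]
  refine intervalIntegral.hasSum_integral_of_dominated_convergence (fun n _ => b n)
    (fun n => ?_) (fun n => ?_) ?_ ?_ ?_
  · exact ((hF n).comp (continuous_circleMap 0 r)).aestronglyMeasurable
  · exact Eventually.of_forall fun θ _ => hFb n _ (hn θ)
  · exact Eventually.of_forall fun θ _ => hb
  · exact intervalIntegrable_const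
  · exact Eventually.of_forall fun θ _ => hG _ (hn θ)

/-- Writing Re as half the sum with the conjugate, z^k is paired with z^n and with the conjugate of
z^n. Only the latter with n = k survives, except that for k = 0 both halves of the constant term do.
-/
lemma circleAverage_pow_mul_re {c : ℕ → ℂ} {u : ℂ → ℝ} {r : ℝ} (hr : 0 ≤ r)
    (hc : Summable fun n => ‖c n‖ * r ^ n)
    (hu : ∀ z, ‖z‖ = r → HasSum (fun n => (c n * z ^ n).re) (u z)) (k : ℕ) :
    Real.circleAverage (fun z => z ^ k * (u z : ℂ)) 0 r =
      if k = 0 then ((c 0).re : ℂ) else (r : ℂ) ^ (2 * k) * (starRingEnd ℂ (c k)) / 2 := by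
  have hF (n : ℕ) (z : ℂ) : z ^ k * ((c n * z ^ n).re : ℂ) = (c n / 2) • z ^ (k + n) +
      (starRingEnd ℂ (c n) / 2) • (z ^ k * (starRingEnd ℂ z) ^ n) := by
    rw [Complex.re_eq_add_conj]
    simp only [map_mul, map_pow, smul_eq_mul, pow_add]
    ring
  have havg (n : ℕ) : Real.circleAverage (fun z => z ^ k * ((c n * z ^ n).re : ℂ)) 0 r =
      (if k + n = 0 then c n / 2 else 0) +
        if k = n then (starRingEnd ℂ (c n) / 2) * (r : ℂ) ^ (2 * k) else 0 := by
    simp_rw [hF]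
    rw [Real.circleAverage_fun_add, Real.circleAverage_fun_smul, Real.circleAverage_fun_smul,
      circleAverage_pow, circleAverage_pow_mul_conj_pow]
    · simp
    · exact circleIntegrable_of_continuous (by fun_prop) r
    · exact circleIntegrable_of_continuous (by fun_prop) r
  have hsum := hasSum_circleAverage (F := fun n z => z ^ k * ((c n * z ^ n).re : ℂ))
    (G := fun z => z ^ k * (u z : ℂ)) hr (fun n => by fun_prop) (hc.mul_left (r ^ k))
    (fun n z hz => by
      rw [norm_mul, norm_pow, hz, Complex.norm_real]
      gcongr
      refine (Complex.abs_re_le_norm _).trans ?_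
      rw [norm_mul, norm_pow, hz])
    (fun z hz => (Complex.hasSum_ofReal.2 (hu z hz)).mul_left _)
  simp_rw [havg] at hsum
  refine hsum.unique ?_
  have h := hasSum_ite_eq k ((if k = 0 then (c k) / 2 else 0) +
    (starRingEnd ℂ (c k) / 2) * (r : ℂ) ^ (2 * k))
  convert h using 1
  · funext n
    by_cases hn : n = k
    · subst hn; simp
    · have : ¬ (k + n = 0) := by omega
      rw [if_neg this, if_neg (Ne.symm hn), if_neg hn, add_zero]
  · by_cases hk : k = 0
    · subst hk
      simp only [if_true, mul_zero, pow_zero, mul_one]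
      rw [Complex.re_eq_add_conj]; ring
    · simp only [hk, if_false]; ring

lemma circleAverage_pow_mul_log_one_sub {b : ℂ} {r C : ℝ} (hr : 0 < r) (hb : ‖b‖ * r < 1)
    (k : ℕ) :
    Real.circleAverage (fun z => z ^ k * ((C + Real.log ‖1 - b * z‖ : ℝ) : ℂ)) 0 r =
      if k = 0 then (C : ℂ) else -((r : ℂ) ^ (2 * k) * (starRingEnd ℂ b) ^ k / (2 * k)) := by
  have hx : 0 ≤ ‖b‖ * r := by positivity
  rw [circleAverage_pow_mul_re (c := fun n => (if n = 0 then (C : ℂ) else 0) - b ^ n / n) hr.le]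
  · by_cases hk : k = 0
    · subst hk; simp
    · simp [hk]; ring
  · refine Summable.of_nonneg_of_le (fun n => by positivity) (fun n => ?_)
      ((hasSum_ite_eq 0 |C|).summable.add (summable_geometric_of_lt_one hx hb))
    rw [mul_pow]
    refine (mul_le_mul_of_nonneg_right (norm_sub_le _ _) (by positivity)).trans ?_
    rw [add_mul]
    refine add_le_add ?_ ?_
    · split_ifs with h
      · subst h; simp
      · simp
    · gcongr
      rw [norm_div, norm_pow]
      rcases Nat.eq_zero_or_pos n with rfl | hn
      · simp
      · refine div_le_self (by positivity) ?_
        rw [Complex.norm_natCast]; exact_mod_cast hn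
  · intro z hz
    have hbz : ‖b * z‖ < 1 := by rw [norm_mul, hz]; exact hb
    have h := ((Complex.hasSum_taylorSeries_neg_log hbz).neg.add (hasSum_ite_eq 0 (C : ℂ)))
    have h2 := Complex.hasSum_re h
    simp only [neg_neg, Complex.add_re, Complex.log_re, Complex.ofReal_re] at h2
    rw [add_comm C]
    convert h2 using 2 with n
    rw [← Complex.add_re]
    congr 1
    by_cases hn : n = 0
    · subst hn; simp
    · simp [hn, mul_pow]; ring

/-- The radial profile of the Fourier coefficients of `log ‖z - a‖`. -/
noncomputable def radialLog (k : ℕ) (t : ℝ) : ℝ :=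
  if k = 0 then Real.log t else -((t ^ (2 * k))⁻¹ / (2 * k))

/-- Off the circle, log|z - a| is a constant plus log|1 - bz| with |b| r < 1, whose Taylor series is
explicit: b = 1/a when a lies outside the circle, and b = ā/r² when it lies inside. -/
lemma circleAverage_pow_mul_log_norm_sub_of_ne {r : ℝ} (hr : 0 < r) (k : ℕ) {a : ℂ}
    (ha : ‖a‖ ≠ r) :
    Real.circleAverage (fun z => z ^ k * (Real.log ‖z - a‖ : ℂ)) 0 r =
      (r : ℂ) ^ (2 * k) * (a ^ k * radialLog k (max r ‖a‖)) := by
  have hr' : (r : ℂ) ≠ 0 := by exact_mod_cast hr.ne'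
  rcases lt_or_gt_of_ne ha with h | h
  · have hb : ‖(starRingEnd ℂ a / r ^ 2)‖ * r < 1 := by
      rw [norm_div, norm_pow, RCLike.norm_conj, Complex.norm_real, Real.norm_of_nonneg hr.le]
      field_simp; exact h
    have e : ∀ z : ℂ, ‖z‖ = r → Real.log ‖z - a‖ =
        Real.log r + Real.log ‖1 - (starRingEnd ℂ a / r ^ 2) * z‖ := by
      -- Reflection in the circle: z z̄ = r² turns z - a into z times the conjugate of 1 - ā z/r².
      intro z hz
      have hz2 : starRingEnd ℂ z * z = (r : ℂ) ^ 2 := by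
        rw [mul_comm, Complex.mul_conj, Complex.normSq_eq_norm_sq, hz]; push_cast; rfl
      have h1 : ‖z - a‖ = r * ‖1 - (starRingEnd ℂ a / r ^ 2) * z‖ := by
        have : starRingEnd ℂ (1 - (starRingEnd ℂ a / r ^ 2) * z) * z = z - a := by
          simp only [map_sub, map_one, map_mul, map_div₀, Complex.conj_conj, map_pow,
            Complex.conj_ofReal, sub_mul, one_mul, mul_assoc, hz2]
          field_simp
        rw [← this, norm_mul, RCLike.norm_conj, hz, mul_comm]
      rw [h1, Real.log_mul hr.ne']
      intro h0
      rw [h0, mul_zero, norm_eq_zero, sub_eq_zero] at h1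
      rw [← h1, hz] at h
      exact lt_irrefl _ h
    rw [Real.circleAverage_congr_sphere (f₂ := fun z => z ^ k *
      ((Real.log r + Real.log ‖1 - (starRingEnd ℂ a / r ^ 2) * z‖ : ℝ) : ℂ)),
      circleAverage_pow_mul_log_one_sub hr hb, max_eq_left h.le, radialLog]
    · split_ifs with hk
      · subst hk; simp
      · simp only [map_div₀, Complex.conj_conj, map_pow, Complex.conj_ofReal]
        push_cast
        rw [div_pow, ← pow_mul]
        field_simp
    · intro z hz
      rw [mem_sphere_zero_iff_norm, abs_of_pos hr] at hz
      simp only [e z hz]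
  · have ha0 : a ≠ 0 := norm_pos_iff.1 (hr.trans h)
    have hb : ‖a⁻¹‖ * r < 1 := by
      rw [norm_inv, inv_mul_lt_one₀ (hr.trans h)]; exact h
    have e : ∀ z : ℂ, ‖z‖ = r → Real.log ‖z - a‖ =
        Real.log ‖a‖ + Real.log ‖1 - a⁻¹ * z‖ := by
      intro z hz
      have h1 : ‖z - a‖ = ‖a‖ * ‖1 - a⁻¹ * z‖ := by
        rw [← norm_mul, mul_sub, mul_inv_cancel_left₀ ha0, mul_one, norm_sub_rev]
      rw [h1, Real.log_mul (norm_ne_zero_iff.2 ha0)]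
      intro h0
      rw [h0, mul_zero, norm_eq_zero, sub_eq_zero] at h1
      rw [← h1, hz] at h
      exact lt_irrefl _ h
    rw [Real.circleAverage_congr_sphere (f₂ := fun z => z ^ k *
      ((Real.log ‖a‖ + Real.log ‖1 - a⁻¹ * z‖ : ℝ) : ℂ)),
      circleAverage_pow_mul_log_one_sub hr hb, max_eq_right h.le, radialLog]
    · split_ifs with hk
      · subst hk; simp
      · have hc : starRingEnd ℂ a ≠ 0 := (map_ne_zero _).2 ha0
        have h2 : ((‖a‖ : ℝ) : ℂ) ^ (2 * k) = a ^ k * (starRingEnd ℂ a) ^ k := by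
          rw [← mul_pow, Complex.mul_conj, Complex.normSq_eq_norm_sq, pow_mul]; push_cast; rfl
        push_cast
        rw [h2, map_inv₀, inv_pow]
        field_simp
    · intro z hz
      rw [mem_sphere_zero_iff_norm, abs_of_pos hr] at hz
      simp only [e z hz]

lemma circleIntegrable_pow_mul_log_norm {f : ℂ → ℂ} (hf : Differentiable ℂ f) (k : ℕ) (r : ℝ) :
    CircleIntegrable (fun z => z ^ k * (Real.log ‖f z‖ : ℂ)) 0 r := by
  have h1 : CircleIntegrable (fun z => Real.log ‖f z‖) 0 r :=
    MeromorphicOn.circleIntegrable_log_norm fun z _ => (hf.analyticAt z).meromorphicAt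
  have h2 : IntervalIntegrable (fun θ => ((Real.log ‖f (circleMap 0 r θ)‖ : ℝ) : ℂ)) volume 0
    (2 * Real.pi) := ⟨h1.1.ofReal, h1.2.ofReal⟩
  exact h2.continuousOn_mul (by fun_prop)

/-- The case |a| = r is the limit of the inner case along s_n a with s_n increasing to 1, by
dominated convergence. -/
lemma circleAverage_pow_mul_log_norm_sub {r : ℝ} (hr : 0 < r) (k : ℕ) (a : ℂ) :
    Real.circleAverage (fun z => z ^ k * (Real.log ‖z - a‖ : ℂ)) 0 r =
      (r : ℂ) ^ (2 * k) * (a ^ k * radialLog k (max r ‖a‖)) := by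
  by_cases ha : ‖a‖ = r
  swap
  · exact circleAverage_pow_mul_log_norm_sub_of_ne hr k ha
  let s : ℕ → ℝ := fun n => 1 - 1 / ((n : ℝ) + 2)
  have hs0 (n : ℕ) : 0 ≤ s n := by
    simp only [s, sub_nonneg]; rw [div_le_one (by positivity)]; linarith [n.cast_nonneg (α := ℝ)]
  have hs1 (n : ℕ) : s n < 1 := by simp only [s, sub_lt_self_iff]; positivity
  have hs : Tendsto s atTop (𝓝 1) := by
    have h := (tendsto_one_div_add_atTop_nhds_zero_nat (𝕜 := ℝ)).comp (tendsto_add_atTop_nat 1)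
    have h2 := h.const_sub 1
    rw [sub_zero] at h2
    refine h2.congr fun n => ?_
    simp only [s, Function.comp]; push_cast; ring_nf
  have hsn (n : ℕ) : ‖(s n : ℂ) * a‖ < r := by
    rw [norm_mul, Complex.norm_real, Real.norm_of_nonneg (hs0 n), ha]
    nlinarith [hs1 n]
  have hev (n : ℕ) : Real.circleAverage (fun z => z ^ k * (Real.log ‖z - s n * a‖ : ℂ)) 0 r =
      (r : ℂ) ^ (2 * k) * ((s n * a) ^ k * radialLog k r) := by
    rw [circleAverage_pow_mul_log_norm_sub_of_ne hr k (hsn n).ne, max_eq_left (hsn n).le]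
  rw [ha, max_self]
  have hsC : Tendsto (fun n => (s n : ℂ)) atTop (𝓝 1) := by
    exact_mod_cast (Complex.continuous_ofReal.tendsto 1).comp hs
  have hlim1 : Tendsto (fun n => Real.circleAverage (fun z => z ^ k *
      (Real.log ‖z - s n * a‖ : ℂ)) 0 r) atTop
      (𝓝 ((r : ℂ) ^ (2 * k) * (a ^ k * radialLog k r))) := by
    simp_rw [hev]
    have := (((hsC.mul_const a).pow k).mul_const (radialLog k r : ℂ)).const_mul ((r : ℂ) ^ (2 * k))
    rwa [one_mul] at this
  refine tendsto_nhds_unique ?_ hlim1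
  simp only [Real.circleAverage_def]
  refine Tendsto.const_smul ?_ _
  have hlogint : CircleIntegrable (fun z => Real.log ‖z - a‖) 0 r :=
    MeromorphicOn.circleIntegrable_log_norm fun z _ => by fun_prop
  have hne : ∀ᵐ θ : ℝ, θ ∈ Set.uIoc 0 (2 * Real.pi) → circleMap 0 r θ ≠ a := by
    have : (circleMap 0 r ⁻¹' {a}ᶜ) ∈ codiscrete ℝ :=
      circleMap_preimage_codiscrete hr.ne' (compl_finite_mem_codiscreteWithin (Set.finite_singleton a))
    have h3 : ∀ᵐ θ : ℝ, θ ∈ (circleMap 0 r ⁻¹' {a}ᶜ) := by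
      have := ae_restrict_le_codiscreteWithin (μ := volume) (U := (Set.univ : Set ℝ)) MeasurableSet.univ this
      rw [Measure.restrict_univ] at this
      exact this
    filter_upwards [h3] with θ hθ _ using hθ
  refine intervalIntegral.tendsto_integral_filter_of_dominated_convergence
    (fun θ => r ^ k * (|Real.log ‖circleMap 0 r θ - a‖| + (|Real.log 2| + |Real.log (2 * r)|)))
    (Eventually.of_forall fun n => ?_) (Eventually.of_forall fun n => ?_) ?_ ?_
  · refine Measurable.aestronglyMeasurable ?_
    fun_prop
  · filter_upwards [hne] with θ hθ hmem
    have hza := hθ hmem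
    set z := circleMap 0 r θ with hz
    have hzr : ‖z‖ = r := by simp [hz, abs_of_pos hr]
    rw [norm_mul, norm_pow, hzr, Complex.norm_real]
    gcongr
    have hpos : 0 < ‖z - a‖ := norm_pos_iff.2 (sub_ne_zero.2 hza)
    have hsa : ‖(s n : ℂ) * a‖ = s n * r := by
      rw [norm_mul, Complex.norm_real, Real.norm_of_nonneg (hs0 n), ha]
    -- The integrable majorant: (1 - s_n) r = |z| - |s_n a| ≤ |z - s_n a|, so moving a to s_n a at
    -- most halves the distance to z.
    have hlow : ‖z - a‖ / 2 ≤ ‖z - s n * a‖ := by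
      have h1 : ‖z - a‖ ≤ ‖z - s n * a‖ + (1 - s n) * r := by
        have : z - a = (z - s n * a) - ((1 - s n : ℝ) : ℂ) * a := by push_cast; ring
        rw [this]
        refine (norm_sub_le _ _).trans ?_
        rw [norm_mul, Complex.norm_real, Real.norm_of_nonneg (by linarith [hs1 n]), ha]
      have h2 := norm_sub_norm_le z (s n * a)
      rw [hzr, hsa] at h2
      linarith
    have hup : ‖z - s n * a‖ ≤ 2 * r := by
      refine (norm_sub_le _ _).trans ?_
      rw [hzr]; linarith [hsn n]
    have hl1 := Real.log_le_log (by positivity) hlow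
    have hl2 := Real.log_le_log (lt_of_lt_of_le (by positivity) hlow) hup
    rw [Real.log_div hpos.ne' two_ne_zero] at hl1
    rw [Real.norm_eq_abs, abs_le]
    constructor
    · linarith [neg_abs_le (Real.log ‖z - a‖), le_abs_self (Real.log 2), abs_nonneg (Real.log (2 * r))]
    · linarith [abs_nonneg (Real.log ‖z - a‖), abs_nonneg (Real.log 2), le_abs_self (Real.log (2 * r))]
  · have h1 : IntervalIntegrable (fun θ => Real.log ‖circleMap 0 r θ - a‖) volume 0
      (2 * Real.pi) := hlogint
    exact (h1.abs.add intervalIntegrable_const).const_mul _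
  · filter_upwards [hne] with θ hθ hmem
    have hza := hθ hmem
    refine Tendsto.const_mul _ ?_
    refine (Complex.continuous_ofReal.tendsto _).comp ?_
    refine ((Real.continuousAt_log ?_).tendsto).comp ?_
    · exact norm_ne_zero_iff.2 (sub_ne_zero.2 hza)
    · have := (hsC.mul_const a).const_sub (circleMap 0 r θ)
      rw [one_mul] at this
      exact this.norm

/-! ### Zero-free factors and division by simple zeros. -/

lemma exists_hasDerivAt_exp_eq {g : ℂ → ℂ} (hg : Differentiable ℂ g) {R : ℝ} (hR : 0 < R)
    (h0 : ∀ z ∈ Metric.ball (0 : ℂ) R, g z ≠ 0) :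
    ∃ H : ℂ → ℂ, DifferentiableOn ℂ H (Metric.ball 0 R) ∧
      ∀ z ∈ Metric.ball (0 : ℂ) R, Complex.exp (H z) = g z := by
  have hmem : (0 : ℂ) ∈ Metric.ball (0 : ℂ) R := Metric.mem_ball_self hR
  have hd : DifferentiableOn ℂ (fun z => deriv g z / g z) (Metric.ball 0 R) :=
    (hg.contDiff.differentiable_deriv_two).differentiableOn.div hg.differentiableOn h0
  -- H is the primitive of g'/g on the disc with H(0) = log g(0); then g e^{-H} has zero derivative
  -- and equals 1 at 0.
  obtain ⟨H, hH0, hH⟩ := hd.isExactOn_ball.with_val_at 0 (Complex.log (g 0))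
  refine ⟨H, fun z hz => (hH z hz).differentiableAt.differentiableWithinAt, fun z hz => ?_⟩
  have hconst : ∀ w ∈ Metric.ball (0 : ℂ) R,
      HasDerivAt (fun z => g z * Complex.exp (-H z)) 0 w := by
    intro w hw
    have h1 : HasDerivAt (fun z => g z * Complex.exp (-H z)) _ w :=
      (hg w).hasDerivAt.mul (HasDerivAt.cexp (HasDerivAt.fun_neg (hH w hw)))
    refine h1.congr_deriv ?_
    have := h0 w hw
    field_simp
    ring
  have heq : g z * Complex.exp (-H z) = g 0 * Complex.exp (-H 0) := by
    refine (convex_ball (0 : ℂ) R).is_const_of_fderivWithin_eq_zero (𝕜 := ℂ)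
      (f := fun z => g z * Complex.exp (-H z))
      (fun w hw => (hconst w hw).differentiableAt.differentiableWithinAt) (fun w hw => ?_) hz hmem
    rw [fderivWithin_of_isOpen Metric.isOpen_ball hw]
    ext
    simp [(hconst w hw).deriv]
  rw [hH0, Complex.exp_neg, Complex.exp_neg, Complex.exp_log (h0 0 hmem),
    mul_inv_cancel₀ (h0 0 hmem)] at heq
  exact (eq_of_mul_inv_eq_one heq).symm

/-- If g = e^H then log|g| = Re H, so the average is r^{2k} times a number built from the k-th
Taylor coefficient of H. What matters is that κ does not depend on r. -/
lemma exists_circleAverage_pow_mul_log_norm {g : ℂ → ℂ} (hg : Differentiable ℂ g) {R : ℝ}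
    (hR : 0 < R) (h0 : ∀ z ∈ Metric.ball (0 : ℂ) R, g z ≠ 0) (k : ℕ) :
    ∃ κ : ℂ, ∀ r : ℝ, 0 < r → r < R →
      Real.circleAverage (fun z => z ^ k * (Real.log ‖g z‖ : ℂ)) 0 r = (r : ℂ) ^ (2 * k) * κ := by
  obtain ⟨H, hHd, hH⟩ := exists_hasDerivAt_exp_eq hg hR h0
  let c : ℕ → ℂ := fun n => (n.factorial : ℂ)⁻¹ * iteratedDeriv n H 0
  have hT (z : ℂ) (hz : z ∈ Metric.ball (0 : ℂ) R) : HasSum (fun n => c n * z ^ n) (H z) := by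
    have := Complex.hasSum_taylorSeries_on_ball hHd hz
    simpa [c, mul_assoc, mul_comm, mul_left_comm] using this
  refine ⟨if k = 0 then ((c 0).re : ℂ) else (starRingEnd ℂ (c k)) / 2, fun r hr hrR => ?_⟩
  rw [circleAverage_pow_mul_re (c := c) hr.le]
  · split_ifs with hk
    · subst hk; simp
    · ring
  · have := (hT r (by simpa [abs_of_pos hr] using hrR)).summable.norm
    simpa [abs_of_pos hr] using this
  · intro z hz
    have hzR : z ∈ Metric.ball (0 : ℂ) R := by simpa [hz] using hrR
    have := Complex.hasSum_re (hT z hzR)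
    rwa [← hH z hzR, Complex.norm_exp, Real.log_exp]

/-- Zeros are divided out one at a time by `dslope`. The remaining points stay simple zeros of the
quotient, so the induction continues, and simplicity leaves a cofactor that does not vanish on s. -/
lemma exists_eq_prod_sub_mul (s : Finset ℂ) : ∀ {f : ℂ → ℂ}, Differentiable ℂ f →
    (∀ a ∈ s, f a = 0 ∧ deriv f a ≠ 0) →
    ∃ g : ℂ → ℂ, Differentiable ℂ g ∧ (∀ z, f z = (∏ a ∈ s, (z - a)) * g z) ∧
      ∀ a ∈ s, g a ≠ 0 := by
  classical
  induction s using Finset.induction_on with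
  | empty => exact fun {f} hf _ => ⟨f, hf, by simp, by simp⟩
  | insert a s ha ih =>
    intro f hf hs
    have hfac (z : ℂ) : f z = (z - a) * dslope f a z := by
      have := sub_smul_dslope f a z
      rw [(hs a (Finset.mem_insert_self _ _)).1, sub_zero, smul_eq_mul] at this
      exact this.symm
    have hd : Differentiable ℂ (dslope f a) := by
      rw [← differentiableOn_univ, Complex.differentiableOn_dslope univ_mem]
      exact hf.differentiableOn
    obtain ⟨g, hg, hfg, hg0⟩ := ih hd fun b hb => by
      have hb' := hs b (Finset.mem_insert_of_mem hb)
      have hba : b - a ≠ 0 := sub_ne_zero.2 fun h => ha (h ▸ hb)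
      have h1 : dslope f a b = 0 := by
        have := hfac b
        rw [hb'.1] at this
        exact (mul_eq_zero.1 this.symm).resolve_left hba
      refine ⟨h1, fun h2 => hb'.2 ?_⟩
      have h3 : HasDerivAt f (1 * dslope f a b + (b - a) * deriv (dslope f a) b) b := by
        refine HasDerivAt.congr_of_eventuallyEq ?_ (Eventually.of_forall hfac)
        exact ((hasDerivAt_id b).sub_const a).mul (hd b).hasDerivAt
      rw [h3.deriv, h1, h2]
      simp
    refine ⟨g, hg, fun z => ?_, fun b hb => ?_⟩
    · rw [Finset.prod_insert ha, hfac, hfg, mul_assoc]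
    · rcases Finset.mem_insert.1 hb with rfl | hb
      · intro h
        have h1 := hfg b
        rw [h, mul_zero, dslope_same] at h1
        exact (hs b (Finset.mem_insert_self _ _)).2 h1
      · exact hg0 b hb

/-- The Fourier coefficients of `log ‖f‖` on two circles determine radially cut-off power sums
over the zeros of `f`. -/
theorem sum_pow_mul_radialLog_sub {f : ℂ → ℂ} (hf : Differentiable ℂ f)
    (hsimple : ∀ z, f z = 0 → deriv f z ≠ 0) {r r' R : ℝ} (hr : 0 < r) (hr' : 0 < r')
    (hrR : r < R) (hrR' : r' < R) {s : Finset ℂ} (hs : ∀ z, z ∈ s ↔ f z = 0 ∧ ‖z‖ < R) (k : ℕ) :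
    ∑ a ∈ s, a ^ k * ((radialLog k (max r' ‖a‖) : ℂ) - radialLog k (max r ‖a‖)) =
      ((r' : ℂ) ^ (2 * k))⁻¹ *
        Real.circleAverage (fun z => z ^ k * (Real.log ‖f z‖ : ℂ)) 0 r' -
      ((r : ℂ) ^ (2 * k))⁻¹ *
        Real.circleAverage (fun z => z ^ k * (Real.log ‖f z‖ : ℂ)) 0 r := by
  obtain ⟨g, hg, hfg, hg0⟩ := exists_eq_prod_sub_mul s hf fun a ha =>
    ⟨((hs a).1 ha).1, hsimple a ((hs a).1 ha).1⟩
  have hgR : ∀ z ∈ Metric.ball (0 : ℂ) R, g z ≠ 0 := by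
    intro z hz h
    have : z ∈ s := (hs z).2 ⟨by rw [hfg, h, mul_zero], by simpa using hz⟩
    exact hg0 z this h
  obtain ⟨κ, hκ⟩ := exists_circleAverage_pow_mul_log_norm hg (hr.trans hrR) hgR k
  have key (ρ : ℝ) (hρ : 0 < ρ) (hρR : ρ < R) : ((ρ : ℂ) ^ (2 * k))⁻¹ *
      Real.circleAverage (fun z => z ^ k * (Real.log ‖f z‖ : ℂ)) 0 ρ =
        ∑ a ∈ s, a ^ k * (radialLog k (max ρ ‖a‖) : ℂ) + κ := by
    have hρ' : (ρ : ℂ) ^ (2 * k) ≠ 0 := pow_ne_zero _ (by exact_mod_cast hρ.ne')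
    have hcongr : Real.circleAverage (fun z => z ^ k * (Real.log ‖f z‖ : ℂ)) 0 ρ =
        Real.circleAverage (fun z => (∑ a ∈ s, z ^ k * (Real.log ‖z - a‖ : ℂ)) +
          z ^ k * (Real.log ‖g z‖ : ℂ)) 0 ρ := by
      -- The logarithm of the product splits only away from the zeros; those on the circle are
      -- finitely many and do not affect the average.
      refine Real.circleAverage_congr_codiscreteWithin ?_ hρ.ne'
      have hfin : ((s : Set ℂ))ᶜ ∈ codiscreteWithin (Metric.sphere (0 : ℂ) |ρ|) :=
        compl_finite_mem_codiscreteWithin s.finite_toSet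
      have hself : Metric.sphere (0 : ℂ) |ρ| ∈ codiscreteWithin (Metric.sphere (0 : ℂ) |ρ|) :=
        self_mem_codiscreteWithin _
      filter_upwards [hfin, hself] with z hz hzρ
      rw [mem_sphere_zero_iff_norm, abs_of_pos hρ] at hzρ
      rw [← Finset.mul_sum, ← mul_add, hfg, norm_mul, Real.log_mul, norm_prod, Real.log_prod]
      · push_cast; rfl
      · intro a ha h
        rw [norm_eq_zero, sub_eq_zero] at h
        exact hz (h ▸ ha)
      · rw [norm_ne_zero_iff, Finset.prod_ne_zero_iff]
        intro a ha h
        rw [sub_eq_zero] at h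
        exact hz (h ▸ ha)
      · exact norm_ne_zero_iff.2 (hgR z (by simpa [hzρ] using hρR))
    rw [hcongr, Real.circleAverage_fun_add, Real.circleAverage_fun_sum, hκ ρ hρ hρR]
    · simp_rw [circleAverage_pow_mul_log_norm_sub hρ k]
      rw [← Finset.mul_sum, ← mul_add, inv_mul_cancel_left₀ hρ']
    · exact fun a _ => circleIntegrable_pow_mul_log_norm (by fun_prop) k ρ
    · exact CircleIntegrable.fun_sum _ fun a _ =>
        circleIntegrable_pow_mul_log_norm (by fun_prop) k ρ
    · exact circleIntegrable_pow_mul_log_norm hg k ρ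
  -- The unknown κ of the zero-free factor cancels between the two radii.
  rw [key r hr hrR, key r' hr' hrR', add_sub_add_right_eq_sub, ← Finset.sum_sub_distrib]
  exact Finset.sum_congr rfl fun a _ => mul_sub _ _ _

/-! ### Zero sets and measurability -/

lemma isLocallyFiniteSet_zeros {f : ℂ → ℂ} (hf : Differentiable ℂ f) {x : ℂ} (hx : f x ≠ 0) :
    IsLocallyFiniteSet {z | f z = 0} := by
  intro K hK
  have han : AnalyticOnNhd ℂ f Set.univ := fun z _ => hf.analyticAt z
  have h := han.preimage_zero_mem_codiscrete hx
  have h2 : f ⁻¹' {0}ᶜ ∈ codiscreteWithin K := codiscreteWithin_mono (Set.subset_univ K) h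
  refine (hK.finite_sdiff_of_mem_codiscreteWithin h2).subset ?_
  rintro z ⟨hz, hzK⟩
  exact ⟨hzK, fun h => h hz⟩

lemma countable_of_isLocallyFiniteSet {Z : Set ℂ} (hZ : IsLocallyFiniteSet Z) : Z.Countable := by
  have : Z = ⋃ n : ℕ, Z ∩ Metric.closedBall 0 n := by
    rw [← Set.inter_iUnion, Metric.iUnion_closedBall_nat, Set.inter_univ]
  rw [this]
  exact Set.countable_iUnion fun n => (hZ _ (isCompact_closedBall 0 _)).countable

/-! ### Measurability of the zero counts. -/

section

variable {α : Type*} [MeasurableSpace α]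

/-- On a compact set a continuous non-negative function attains its minimum. It vanishes somewhere
exactly when its values on a countable dense subset come below every 1/(n + 1). -/
lemma measurableSet_exists_mem_eq_zero {φ : α → ℂ → ℝ} (hc : ∀ p, Continuous (φ p))
    (hm : ∀ z, Measurable fun p => φ p z) (h0 : ∀ p z, 0 ≤ φ p z) {K : Set ℂ} (hK : IsCompact K) :
    MeasurableSet {p | ∃ z ∈ K, φ p z = 0} := by
  obtain ⟨t, htK, htc, hKt⟩ := hK.isSeparable.exists_countable_dense_subset
  have : {p | ∃ z ∈ K, φ p z = 0} = ⋂ n : ℕ, ⋃ q ∈ t, {p | φ p q < 1 / ((n : ℝ) + 1)} := by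
    ext p
    simp only [Set.mem_ofPred_eq, Set.mem_iInter, Set.mem_iUnion, exists_prop]
    constructor
    · rintro ⟨z, hz, hz0⟩ n
      have hopen : IsOpen {w | φ p w < 1 / ((n : ℝ) + 1)} := isOpen_lt (hc p) continuous_const
      have hzmem : z ∈ {w | φ p w < 1 / ((n : ℝ) + 1)} := by
        rw [Set.mem_ofPred_eq, hz0]; positivity
      obtain ⟨q, hq1, hq2⟩ := mem_closure_iff.1 (hKt hz) _ hopen hzmem
      exact ⟨q, hq2, hq1⟩
    · intro h
      obtain ⟨q, hq, _⟩ := h 0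
      obtain ⟨z, hz, hmin⟩ := hK.exists_isMinOn ⟨q, htK hq⟩ (hc p).continuousOn
      refine ⟨z, hz, le_antisymm ?_ (h0 p z)⟩
      refine ge_of_tendsto' (tendsto_one_div_add_atTop_nhds_zero_nat (𝕜 := ℝ)) fun n => ?_
      obtain ⟨q, hq, hqn⟩ := h n
      exact (hmin (htK hq)).trans hqn.le
  rw [this]
  exact MeasurableSet.iInter fun n => MeasurableSet.biUnion htc fun q _ =>
    measurableSet_lt (hm q) measurable_const

variable {f : α → ℂ → ℂ}

lemma measurableSet_exists_mem_isOpen_eq_zero (hc : ∀ p, Continuous (f p))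
    (hm : ∀ z, Measurable fun p => f p z) {O : Set ℂ} (hO : IsOpen O) :
    MeasurableSet {p | ∃ z ∈ O, f p z = 0} := by
  obtain ⟨F, hF, -, hFO, -⟩ := hO.exists_iUnion_isClosed
  have : {p | ∃ z ∈ O, f p z = 0} =
      ⋃ n : ℕ, ⋃ m : ℕ, {p | ∃ z ∈ F n ∩ Metric.closedBall 0 m, ‖f p z‖ = 0} := by
    ext p
    simp only [Set.mem_ofPred_eq, Set.mem_iUnion, norm_eq_zero]
    constructor
    · rintro ⟨z, hz, h0⟩
      rw [← hFO] at hz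
      obtain ⟨n, hn⟩ := Set.mem_iUnion.1 hz
      obtain ⟨m, hm⟩ := exists_nat_ge ‖z‖
      exact ⟨n, m, z, ⟨hn, by simpa using hm⟩, h0⟩
    · rintro ⟨n, m, z, ⟨hz, -⟩, h0⟩
      exact ⟨z, hFO ▸ Set.mem_iUnion.2 ⟨n, hz⟩, h0⟩
  rw [this]
  exact MeasurableSet.iUnion fun n => MeasurableSet.iUnion fun m =>
    measurableSet_exists_mem_eq_zero (fun p => (hc p).norm) (fun z => (hm z).norm)
      (fun p z => norm_nonneg _) ((isCompact_closedBall (0 : ℂ) m).inter_left (hF n))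

/-- Having at least m points means that m pairwise disjoint sets of a countable basis each contain
one. Counting thus reduces to countably many hitting events. -/
lemma le_encard_inter_iff (Z O : Set ℂ) (m : ℕ) :
    (m : ℕ∞) ≤ (Z ∩ O).encard ↔ ∃ v : Fin m → TopologicalSpace.countableBasis ℂ,
      (∀ i j, i ≠ j → Disjoint (v i : Set ℂ) (v j)) ∧ ∀ i, ∃ z ∈ (v i : Set ℂ) ∩ O, z ∈ Z := by
  constructor
  · intro h
    obtain ⟨u, hu, hum⟩ := Set.exists_subset_encard_eq h
    have hfin : u.Finite := Set.finite_of_encard_eq_coe hum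
    obtain ⟨U, hU, hdisj⟩ := hfin.t2_separation
    have hcard : hfin.toFinset.card = m := by
      have := hfin.encard_eq_coe_toFinset_card
      rw [hum] at this
      exact_mod_cast this.symm
    have hbasis (x : ℂ) : ∃ V : TopologicalSpace.countableBasis ℂ, x ∈ (V : Set ℂ) ∧
        (V : Set ℂ) ⊆ U x := by
      obtain ⟨V, hV, hx, hVU⟩ :=
        (TopologicalSpace.isBasis_countableBasis ℂ).exists_subset_of_mem_open (hU x).1 (hU x).2
      exact ⟨⟨V, hV⟩, hx, hVU⟩
    choose V hxV hVU using hbasis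
    let e : Fin m ≃ hfin.toFinset := (hfin.toFinset.equivFinOfCardEq hcard).symm
    have hmem (i : Fin m) : (e i : ℂ) ∈ u := hfin.mem_toFinset.1 (e i).2
    refine ⟨fun i => V (e i), fun i j hij => ?_, fun i => ⟨e i, ⟨hxV _, (hu (hmem i)).2⟩,
      (hu (hmem i)).1⟩⟩
    refine Set.disjoint_of_subset (hVU _) (hVU _) (hdisj (hmem i) (hmem j) fun h => hij ?_)
    exact e.injective (Subtype.ext h)
  · rintro ⟨v, hv, hz⟩
    choose z hz hzZ using hz
    have hinj : Function.Injective z := by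
      intro i j hij
      by_contra hne
      exact Set.disjoint_left.1 (hv i j hne) (hz i).1 (hij ▸ (hz j).1)
    have h1 := hinj.encard_range
    rw [ENat.card_eq_coe_fintype_card, Fintype.card_fin] at h1
    refine h1.trans (Set.encard_le_encard ?_)
    rintro _ ⟨i, rfl⟩
    exact ⟨hzZ i, (hz i).2⟩

lemma measurableSet_le_encard_inter (hc : ∀ p, Continuous (f p))
    (hm : ∀ z, Measurable fun p => f p z) {O : Set ℂ} (hO : IsOpen O) (m : ℕ) :
    MeasurableSet {p | (m : ℕ∞) ≤ ({z | f p z = 0} ∩ O).encard} := by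
  have : {p | (m : ℕ∞) ≤ ({z | f p z = 0} ∩ O).encard} =
      ⋃ v : Fin m → TopologicalSpace.countableBasis ℂ,
        ⋃ _ : ∀ i j, i ≠ j → Disjoint (v i : Set ℂ) (v j),
          ⋂ i, {p | ∃ z ∈ (v i : Set ℂ) ∩ O, f p z = 0} := by
    ext p
    simp only [Set.mem_ofPred_eq, le_encard_inter_iff, Set.mem_iUnion, Set.mem_iInter,
      exists_prop]
  rw [this]
  have : Countable (TopologicalSpace.countableBasis ℂ) :=
    (TopologicalSpace.countable_countableBasis ℂ).to_subtype
  exact MeasurableSet.iUnion fun v => MeasurableSet.iUnion fun _ => MeasurableSet.iInter fun i =>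
    measurableSet_exists_mem_isOpen_eq_zero hc hm
      ((TopologicalSpace.isOpen_of_mem_countableBasis (v i).2).inter hO)

lemma measurable_toENNReal_of_le {N : α → ℕ∞} (h : ∀ m : ℕ, MeasurableSet {p | (m : ℕ∞) ≤ N p}) :
    Measurable fun p => (N p : ENNReal) := by
  have : (fun p => (N p : ENNReal)) =
      fun p => ⨆ m : ℕ, Set.indicator {p | (m : ℕ∞) ≤ N p} (fun _ => (m : ENNReal)) p := by
    funext p
    apply le_antisymm
    · cases hN : N p using ENat.recTopCoe with
      | top =>
        rw [ENat.toENNReal_top, ← ENNReal.iSup_natCast]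
        refine iSup_mono fun m => ?_
        rw [Set.indicator_of_mem]
        simp [hN]
      | coe n =>
        refine le_iSup_of_le n ?_
        rw [Set.indicator_of_mem (by simp [hN])]
        simp
    · refine iSup_le fun m => ?_
      by_cases hm : (m : ℕ∞) ≤ N p
      · rw [Set.indicator_of_mem (by exact hm)]
        exact_mod_cast ENat.toENNReal_le.2 hm
      · rw [Set.indicator_of_notMem (by exact hm)]
        exact zero_le
  rw [this]
  exact Measurable.iSup fun m => measurable_const.indicator (h m)

/-- The counting measure on the part of `Z` in a disc. -/
noncomputable def discCount (Z : Set ℂ) (R : ℝ) : Measure ℂ :=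
  Measure.count.restrict (Z ∩ Metric.ball 0 R)

lemma IsLocallyFiniteSet.mono {Z Z' : Set ℂ} (hZ : IsLocallyFiniteSet Z) (h : Z' ⊆ Z) :
    IsLocallyFiniteSet Z' := fun K hK => (hZ K hK).subset (Set.inter_subset_inter_left K h)

lemma IsLocallyFiniteSet.finite_inter_of_isBounded {Z : Set ℂ} (hZ : IsLocallyFiniteSet Z)
    {B : Set ℂ} (hB : Bornology.IsBounded B) : (Z ∩ B).Finite :=
  (hZ _ hB.isCompact_closure).subset (Set.inter_subset_inter_right Z subset_closure)

lemma discCount_apply {Z B : Set ℂ} (hZ : IsLocallyFiniteSet Z) (R : ℝ) (hB : MeasurableSet B) :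
    discCount Z R B = ((Z ∩ (B ∩ Metric.ball 0 R)).encard : ENNReal) := by
  have hfin : (Z ∩ (B ∩ Metric.ball 0 R)).Finite :=
    hZ.finite_inter_of_isBounded (Metric.isBounded_ball.subset Set.inter_subset_right)
  rw [discCount, Measure.restrict_apply hB, Set.inter_left_comm,
    Measure.count_apply hfin.measurableSet]

lemma isFiniteMeasure_discCount {Z : Set ℂ} (hZ : IsLocallyFiniteSet Z) (R : ℝ) :
    IsFiniteMeasure (discCount Z R) := by
  refine ⟨?_⟩
  rw [discCount_apply hZ R MeasurableSet.univ, Set.univ_inter,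
    (hZ.finite_inter_of_isBounded Metric.isBounded_ball).encard_eq_coe_toFinset_card]
  exact ENNReal.natCast_lt_top _

/-- Open sets form a π-system generating the Borel sets. Restricting to a disc makes the counting
measures finite, as the extension from a π-system requires. -/
lemma measurable_discCount_zeros (hc : ∀ p, Continuous (f p))
    (hm : ∀ z, Measurable fun p => f p z) (hZ : ∀ p, IsLocallyFiniteSet {z | f p z = 0}) (R : ℝ) :
    Measurable fun p => discCount {z | f p z = 0} R := by
  have (p : α) : IsFiniteMeasure (discCount {z | f p z = 0} R) := isFiniteMeasure_discCount (hZ p) R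
  have key (O : Set ℂ) (hO : IsOpen O) : Measurable fun p => discCount {z | f p z = 0} R O := by
    simp_rw [fun p => discCount_apply (hZ p) R hO.measurableSet]
    exact measurable_toENNReal_of_le
      (measurableSet_le_encard_inter hc hm (hO.inter Metric.isOpen_ball))
  exact Measurable.measure_of_isPiSystem (S := {s | IsOpen s}) (BorelSpace.measurable_eq)
    isPiSystem_isOpen key (key _ isOpen_univ)

/-- Counts take values in the countable set ℕ∞, where every subset is allowed. Since ℕ∞ embeds in
`ENNReal` with countable image, nothing is lost by measuring counts there. -/
lemma measurable_pointConfig_iff {A : Set ℂ} {X : α → PointConfig A} :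
    Measurable X ↔ ∀ B : Set ℂ, MeasurableSet B → Bornology.IsBounded B →
      Measurable fun p => (((X p).1 ∩ B).encard : ENNReal) := by
  have hcast : Measurable[⊤] fun n : ℕ∞ => (n : ENNReal) := fun s _ => trivial
  constructor
  · intro h B hB hBb
    have h1 : Measurable[_, ⊤] (PointConfig.count (A := A) B) := by
      rw [measurable_iff_comap_le]
      exact le_iSup (fun B : {B : Set ℂ // MeasurableSet B ∧ Bornology.IsBounded B} =>
        MeasurableSpace.comap (PointConfig.count B.1) ⊤) ⟨B, hB, hBb⟩
    exact (hcast.comp h1).comp h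
  · intro h
    rw [measurable_iff_comap_le, PointConfig.instMeasurableSpace, MeasurableSpace.comap_iSup]
    refine iSup_le fun B => ?_
    rw [MeasurableSpace.comap_comp]
    have hB := h B.1 B.2.1 B.2.2
    rintro _ ⟨s, -, rfl⟩
    have : (PointConfig.count B.1 ∘ X) ⁻¹' s =
        (fun p => (((X p).1 ∩ B.1).encard : ENNReal)) ⁻¹' ((fun n : ℕ∞ => (n : ENNReal)) '' s) := by
      ext p
      simp only [Set.mem_preimage, Set.mem_image, Function.comp, PointConfig.count]
      constructor
      · exact fun hp => ⟨_, hp, rfl⟩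
      · rintro ⟨n, hn, hn'⟩
        rwa [← ENat.toENNReal_inj.1 hn']
    rw [this]
    exact hB ((Set.to_countable s).image _).measurableSet

/-- A locally finite set as a point configuration in the plane. -/
def PointConfig.ofSet (Z : Set ℂ) (hZ : IsLocallyFiniteSet Z) : PointConfig Set.univ :=
  ⟨Z, Set.subset_univ _, hZ⟩

/-- The zero sets of a measurable family of functions form a measurable family of point
configurations. -/
theorem measurable_zeros_pointConfig (hc : ∀ p, Continuous (f p))
    (hm : ∀ z, Measurable fun p => f p z) (hZ : ∀ p, IsLocallyFiniteSet {z | f p z = 0}) :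
    Measurable fun p => PointConfig.ofSet {z | f p z = 0} (hZ p) := by
  rw [measurable_pointConfig_iff]
  intro B hB hBb
  obtain ⟨R, hR⟩ := hBb.subset_ball 0
  have h := (Measure.measurable_coe hB).comp (measurable_discCount_zeros hc hm hZ R)
  refine (congrArg Measurable (funext fun p => ?_)).mp h
  simp only [Function.comp, PointConfig.ofSet]
  rw [discCount_apply (hZ p) R hB, Set.inter_eq_left.2 hR]

end

/-! ### Linear statistics of point configurations -/

lemma measurable_discCount_pointConfig (A : Set ℂ) (R : ℝ) :
    Measurable fun W : PointConfig A => discCount W.1 R := by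
  refine Measure.measurable_of_measurable_coe _ fun B hB => ?_
  simp_rw [fun W : PointConfig A => discCount_apply W.2.2 R hB]
  exact measurable_pointConfig_iff.1 measurable_id _ (hB.inter measurableSet_ball)
    (Metric.isBounded_ball.subset Set.inter_subset_right)

lemma lintegral_discCount {Z : Set ℂ} (hZ : IsLocallyFiniteSet Z) (R : ℝ) (g : ℂ → ENNReal) :
    ∫⁻ z, g z ∂discCount Z R =
      ∑ z ∈ (hZ.finite_inter_of_isBounded (Metric.isBounded_ball (x := 0) (r := R))).toFinset,
        g z := by
  have hfin := hZ.finite_inter_of_isBounded (Metric.isBounded_ball (x := 0) (r := R))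
  have := lintegral_finset (μ := Measure.count) hfin.toFinset g
  rw [hfin.coe_toFinset] at this
  rw [discCount, this]
  simp

lemma finsum_mem_eq_sum_ball {Z : Set ℂ} (hZ : IsLocallyFiniteSet Z) {R : ℝ} {h : ℂ → ℂ}
    (hR : ∀ z, R ≤ ‖z‖ → h z = 0) : ∑ᶠ z ∈ Z, h z =
      ∑ z ∈ (hZ.finite_inter_of_isBounded (Metric.isBounded_ball (x := 0) (r := R))).toFinset,
        h z := by
  have : Z ∩ Function.support h = Z ∩ Metric.ball 0 R ∩ Function.support h := by
    ext z
    simp only [Set.mem_inter_iff, Function.mem_support, Metric.mem_ball, dist_zero_right, ne_eq]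
    exact ⟨fun hz => ⟨⟨hz.1, not_le.1 fun h => hz.2 (hR z h)⟩, hz.2⟩,
      fun hz => ⟨hz.1.1, hz.2⟩⟩
  rw [← finsum_mem_eq_finite_toFinset_sum, ← finsum_mem_inter_support, this,
    finsum_mem_inter_support]

/-- The sum is an integral against the counting measure on a disc. Splitting h into positive and
negative parts of its real and imaginary parts reduces it to four lower integrals, each measurable
in the configuration. -/
lemma measurable_finsum_pointConfig (A : Set ℂ) {R : ℝ} {h : ℂ → ℂ} (hm : Measurable h)
    (hR : ∀ z, R ≤ ‖z‖ → h z = 0) :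
    Measurable fun W : PointConfig A => ∑ᶠ z ∈ W.1, h z := by
  have hN {g : ℂ → ℝ} (hg : Measurable g) : Measurable fun W : PointConfig A =>
      (∫⁻ z, ENNReal.ofReal (g z) ∂discCount W.1 R).toReal :=
    ((Measure.measurable_lintegral hg.ennreal_ofReal).comp
      (measurable_discCount_pointConfig A R)).ennreal_toReal
  have hsum {Z : Set ℂ} (hZ : IsLocallyFiniteSet Z) (g : ℂ → ℝ) :
      (∫⁻ z, ENNReal.ofReal (g z) ∂discCount Z R).toReal -
        (∫⁻ z, ENNReal.ofReal (-g z) ∂discCount Z R).toReal =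
      ∑ z ∈ (hZ.finite_inter_of_isBounded (Metric.isBounded_ball (x := 0) (r := R))).toFinset,
        g z := by
    rw [lintegral_discCount hZ, lintegral_discCount hZ, ENNReal.toReal_sum (by simp),
      ENNReal.toReal_sum (by simp), ← Finset.sum_sub_distrib]
    refine Finset.sum_congr rfl fun z _ => ?_
    rw [ENNReal.toReal_ofReal', ENNReal.toReal_ofReal', max_zero_sub_max_neg_zero_eq_self]
  have hre : Measurable fun z => (h z).re := Complex.measurable_re.comp hm
  have him : Measurable fun z => (h z).im := Complex.measurable_im.comp hm
  have hmeas := (Complex.measurable_ofReal.comp ((hN hre).sub (hN hre.neg))).add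
    ((Complex.measurable_ofReal.comp ((hN him).sub (hN him.neg))).mul_const Complex.I)
  refine (congrArg Measurable (funext fun W => ?_)).mp hmeas
  simp only [Pi.add_apply, Function.comp, Pi.sub_apply, Pi.neg_apply]
  rw [hsum W.2.2, hsum W.2.2, finsum_mem_eq_sum_ball W.2.2 hR]
  push_cast
  rw [Finset.sum_mul, ← Finset.sum_add_distrib]
  exact Finset.sum_congr rfl fun z _ => Complex.re_add_im _

/-! ### The standard complex Gaussian law -/

lemma measurable_add_mul_I : Measurable fun p : ℝ × ℝ => (p.1 : ℂ) + (p.2 : ℂ) * Complex.I := by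
  fun_prop

instance : IsProbabilityMeasure standardComplexGaussian :=
  Measure.isProbabilityMeasure_map measurable_add_mul_I.aemeasurable

instance : NullSingletonClass standardComplexGaussian where
  measure_singleton c := by
    have : NullSingletonClass (gaussianReal 0 (1 / 2)) :=
      nullSingletonClass_gaussianReal (by norm_num)
    rw [standardComplexGaussian, Measure.map_apply measurable_add_mul_I (measurableSet_singleton c)]
    refine measure_mono_null (t := {(c.re, c.im)}) ?_ (measure_singleton _)
    rintro ⟨x, y⟩ h
    simp only [Set.mem_preimage, Set.mem_singleton_iff] at h
    simp [← h]

lemma charFun_standardComplexGaussian (t : ℂ) :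
    charFun standardComplexGaussian t = Complex.exp (-((‖t‖ ^ 2 / 4 : ℝ) : ℂ)) := by
  have h1 (p : ℝ × ℝ) : Complex.exp ((inner ℝ ((p.1 : ℂ) + (p.2 : ℂ) * Complex.I) t : ℝ) *
      Complex.I) = Complex.exp ((inner ℝ p.1 t.re : ℝ) * Complex.I) *
        Complex.exp ((inner ℝ p.2 t.im : ℝ) * Complex.I) := by
    rw [← Complex.exp_add, ← add_mul, ← Complex.ofReal_add]
    congr 3
    rw [Complex.inner]
    simp [mul_comm]
  rw [charFun_apply, standardComplexGaussian,
    integral_map measurable_add_mul_I.aemeasurable (by fun_prop)]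
  simp_rw [h1]
  rw [integral_prod_mul (fun x : ℝ => Complex.exp ((inner ℝ x t.re : ℝ) * Complex.I))
    (fun x : ℝ => Complex.exp ((inner ℝ x t.im : ℝ) * Complex.I)), ← charFun_apply,
    ← charFun_apply, charFun_gaussianReal, charFun_gaussianReal, ← Complex.exp_add]
  congr 1
  rw [← Complex.normSq_eq_norm_sq, Complex.normSq_apply]
  push_cast
  ring

lemma integral_exp_inner_standardComplexGaussian (t : ℂ) :
    ∫ x, Complex.exp ((inner ℝ x t : ℝ) * Complex.I) ∂standardComplexGaussian =
      Complex.exp (-((‖t‖ ^ 2 / 4 : ℝ) : ℂ)) := charFun_standardComplexGaussian t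

lemma map_mul_standardComplexGaussian {u : ℂ} (hu : ‖u‖ = 1) :
    standardComplexGaussian.map (fun x => u * x) = standardComplexGaussian := by
  have : IsProbabilityMeasure (standardComplexGaussian.map (fun x => u * x)) :=
    Measure.isProbabilityMeasure_map (by fun_prop)
  refine Measure.ext_of_charFun (funext fun t => ?_)
  rw [charFun_apply, integral_map (by fun_prop) (by fun_prop), charFun_standardComplexGaussian]
  have h (x : ℂ) : (inner ℝ (u * x) t : ℝ) = inner ℝ x (starRingEnd ℂ u * t) := by
    simp only [Complex.inner, map_mul]
    congr 1
    ring
  simp_rw [h]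
  rw [integral_exp_inner_standardComplexGaussian, norm_mul, RCLike.norm_conj, hu, one_mul]

lemma integral_comp_standardComplexGaussian {E : Type*} [NormedAddCommGroup E] [NormedSpace ℝ E]
    {g : ℂ → E} (hg : StronglyMeasurable g) :
    ∫ x, g x ∂standardComplexGaussian = ∫ p : ℝ × ℝ, g ((p.1 : ℂ) + (p.2 : ℂ) * Complex.I)
      ∂((gaussianReal 0 (1 / 2)).prod (gaussianReal 0 (1 / 2))) :=
  integral_map measurable_add_mul_I.aemeasurable hg.aestronglyMeasurable

lemma integrable_standardComplexGaussian_iff {E : Type*} [NormedAddCommGroup E]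
    {g : ℂ → E} (hg : StronglyMeasurable g) : Integrable g standardComplexGaussian ↔
      Integrable (fun p : ℝ × ℝ => g ((p.1 : ℂ) + (p.2 : ℂ) * Complex.I))
        ((gaussianReal 0 (1 / 2)).prod (gaussianReal 0 (1 / 2))) :=
  integrable_map_measure hg.aestronglyMeasurable measurable_add_mul_I.aemeasurable

lemma integrable_norm_sq_standardComplexGaussian :
    Integrable (fun x : ℂ => ‖x‖ ^ 2) standardComplexGaussian := by
  rw [integrable_standardComplexGaussian_iff (by fun_prop)]
  have h : Integrable (fun x : ℝ => x ^ 2) (gaussianReal 0 (1 / 2)) :=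
    (memLp_id_gaussianReal 2).integrable_sq
  refine ((h.comp_fst _).add (h.comp_snd _)).congr (Eventually.of_forall fun p => ?_)
  simp only [Pi.add_apply]
  rw [← Complex.normSq_eq_norm_sq, Complex.normSq_add_mul_I]

lemma integral_norm_sq_standardComplexGaussian :
    ∫ x : ℂ, ‖x‖ ^ 2 ∂standardComplexGaussian = 1 := by
  rw [integral_comp_standardComplexGaussian (by fun_prop)]
  have h : Integrable (fun x : ℝ => x ^ 2) (gaussianReal 0 (1 / 2)) :=
    (memLp_id_gaussianReal 2).integrable_sq
  have h2 : ∫ x : ℝ, x ^ 2 ∂(gaussianReal 0 (1 / 2)) = 1 / 2 := by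
    have := variance_fun_id_gaussianReal (μ := 0) (v := 1 / 2)
    rw [variance_of_integral_eq_zero aemeasurable_id' integral_id_gaussianReal] at this
    simpa using this
  have h3 (p : ℝ × ℝ) : ‖(p.1 : ℂ) + (p.2 : ℂ) * Complex.I‖ ^ 2 = p.1 ^ 2 + p.2 ^ 2 := by
    rw [← Complex.normSq_eq_norm_sq, Complex.normSq_add_mul_I]
  simp_rw [h3]
  rw [integral_add (h.comp_fst _) (h.comp_snd _), integral_fun_fst (fun x : ℝ => x ^ 2),
    integral_fun_snd (fun x : ℝ => x ^ 2), h2]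
  norm_num

lemma memLp_two_standardComplexGaussian : MemLp (fun x : ℂ => x) 2 standardComplexGaussian := by
  rw [memLp_two_iff_integrable_sq_norm (by fun_prop)]
  exact integrable_norm_sq_standardComplexGaussian

lemma integrable_id_standardComplexGaussian :
    Integrable (fun x : ℂ => x) standardComplexGaussian :=
  memLp_two_standardComplexGaussian.integrable (by norm_num)

lemma integral_id_standardComplexGaussian : ∫ x : ℂ, x ∂standardComplexGaussian = 0 := by
  have h : ∫ x : ℂ, x ∂standardComplexGaussian = -∫ x : ℂ, x ∂standardComplexGaussian := by
    conv_lhs => rw [← map_mul_standardComplexGaussian (u := -1) (by simp)]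
    rw [integral_map (by fun_prop) (by fun_prop)]
    simp_rw [neg_one_mul]
    exact integral_neg _
  exact self_eq_neg.1 h

/-! ### Square integrability of log|ξ|. -/

lemma integrable_inv_sqrt_abs_gaussianReal :
    Integrable (fun x : ℝ => (√|x|)⁻¹) (gaussianReal 0 (1 / 2)) := by
  rw [gaussianReal_of_var_ne_zero _ (by norm_num),
    integrable_withDensity_iff_integrable_smul' (measurable_gaussianPDF _ _)
      (Eventually.of_forall fun _ => ENNReal.ofReal_lt_top)]
  have h1 := (integrableOn_rpow_mul_exp_neg_mul_sq one_pos (s := -(1 / 2)) (by norm_num)).const_mul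
    (√(2 * Real.pi * (1 / 2)))⁻¹
  let F : ℝ → ℝ := fun x => (gaussianPDF 0 (1 / 2) x).toReal • (√|x|)⁻¹
  have hF (x : ℝ) : F x = (√(2 * Real.pi * (1 / 2)))⁻¹ * ((√|x|)⁻¹ * Real.exp (-1 * x ^ 2)) := by
    simp only [F, toReal_gaussianPDF, gaussianPDFReal_def, smul_eq_mul]
    norm_num
    ring
  have hpos : IntegrableOn F (Set.Ioi 0) := by
    refine Integrable.congr h1 ?_
    filter_upwards [ae_restrict_mem measurableSet_Ioi] with x hx
    rw [hF, abs_of_pos hx, Real.rpow_neg (le_of_lt hx), ← Real.sqrt_eq_rpow]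
  have heven : F ∘ Neg.neg = F := by
    funext x
    simp only [Function.comp, hF, abs_neg, neg_sq]
  have hneg : IntegrableOn F (Set.Iio 0) := by
    rw [← (Measure.measurePreserving_neg (volume : Measure ℝ)).integrableOn_comp_preimage
      (Homeomorph.neg ℝ).measurableEmbedding, heven]
    simpa using hpos
  have hall : IntegrableOn F (Set.Iio 0 ∪ Set.Ici 0) :=
    hneg.union (by rw [integrableOn_Ici_iff_integrableOn_Ioi]; exact hpos)
  rwa [Set.Iio_union_Ici, integrableOn_univ] at hall

/-- From x² + y² ≥ |x||y| one gets 1/|x + iy| ≤ |x|^{-1/2} |y|^{-1/2}, a product of integrable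
functions of independent variables. -/
lemma integrable_inv_norm_standardComplexGaussian :
    Integrable (fun x : ℂ => ‖x‖⁻¹) standardComplexGaussian := by
  have hm : Measurable fun x : ℂ => ‖x‖⁻¹ := by fun_prop
  rw [integrable_standardComplexGaussian_iff hm.stronglyMeasurable]
  have h := integrable_inv_sqrt_abs_gaussianReal.mul_prod integrable_inv_sqrt_abs_gaussianReal
  have : NullSingletonClass (gaussianReal 0 (1 / 2)) :=
    nullSingletonClass_gaussianReal (by norm_num)
  have hne : ∀ᵐ x : ℝ ∂(gaussianReal 0 (1 / 2)), x ≠ 0 :=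
    (Set.countable_singleton 0).ae_notMem _
  have h1 := Measure.quasiMeasurePreserving_fst (μ := gaussianReal 0 (1 / 2))
    (ν := gaussianReal 0 (1 / 2)) |>.ae hne
  have h2 := Measure.quasiMeasurePreserving_snd (μ := gaussianReal 0 (1 / 2))
    (ν := gaussianReal 0 (1 / 2)) |>.ae hne
  refine h.mono' (hm.comp measurable_add_mul_I).aestronglyMeasurable ?_
  filter_upwards [h1, h2] with p hp1 hp2
  rw [norm_inv, norm_norm, ← mul_inv, ← Real.sqrt_mul (abs_nonneg _)]
  have hpos : 0 < |p.1| * |p.2| := mul_pos (abs_pos.2 hp1) (abs_pos.2 hp2)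
  refine inv_anti₀ (Real.sqrt_pos.2 hpos) (Real.sqrt_le_iff.2 ⟨norm_nonneg _, ?_⟩)
  rw [← Complex.normSq_eq_norm_sq, Complex.normSq_add_mul_I, ← sq_abs p.1, ← sq_abs p.2]
  nlinarith [sq_nonneg (|p.1| - |p.2|)]

/-- Reduces the second moment of log|ξ| to those of |ξ|² and 1/|ξ|. For t ≤ 1 apply log u ≤ u - 1 to
u = t^{-1/2}. -/
lemma log_sq_le {t : ℝ} (ht : 0 ≤ t) : Real.log t ^ 2 ≤ t ^ 2 + 4 * t⁻¹ := by
  rcases ht.eq_or_lt with rfl | ht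
  · simp
  rcases le_total 1 t with h1 | h1
  · have h2 := Real.log_le_sub_one_of_pos ht
    have h3 := Real.log_nonneg h1
    nlinarith [inv_pos.2 ht]
  · have hs : 0 < √t := Real.sqrt_pos.2 ht
    have h2 := Real.log_le_sub_one_of_pos (inv_pos.2 hs)
    rw [Real.log_inv, Real.log_sqrt ht.le] at h2
    have h3 := Real.log_nonpos ht.le h1
    have h4 : (√t)⁻¹ ^ 2 = t⁻¹ := by rw [inv_pow, Real.sq_sqrt ht.le]
    have h5 : -Real.log t ≤ 2 * (√t)⁻¹ := by linarith
    have h6 : (-Real.log t) ^ 2 ≤ (2 * (√t)⁻¹) ^ 2 := by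
      gcongr
      linarith
    nlinarith

lemma memLp_log_norm_standardComplexGaussian :
    MemLp (fun x : ℂ => Real.log ‖x‖) 2 standardComplexGaussian := by
  have hm : Measurable fun x : ℂ => Real.log ‖x‖ := by fun_prop
  rw [memLp_two_iff_integrable_sq hm.aestronglyMeasurable]
  refine (integrable_norm_sq_standardComplexGaussian.add
    (integrable_inv_norm_standardComplexGaussian.const_mul 4)).mono'
    (hm.pow_const 2).aestronglyMeasurable (Eventually.of_forall fun x => ?_)
  rw [Real.norm_of_nonneg (sq_nonneg _)]
  exact log_sq_le (norm_nonneg x)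

/-- The mean of `log |ξ|` for a standard complex Gaussian `ξ`. -/
noncomputable def gaussianLogMean : ℝ := ∫ x : ℂ, Real.log ‖x‖ ∂standardComplexGaussian

/-- The centred logarithm. -/
noncomputable def centredLog (x : ℂ) : ℝ := Real.log ‖x‖ - gaussianLogMean

@[fun_prop]
lemma measurable_centredLog : Measurable centredLog := by unfold centredLog; fun_prop

lemma memLp_centredLog : MemLp centredLog 2 standardComplexGaussian :=
  memLp_log_norm_standardComplexGaussian.sub (memLp_const _)

lemma integrable_centredLog : Integrable centredLog standardComplexGaussian :=
  memLp_centredLog.integrable (by norm_num)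

lemma integral_centredLog : ∫ x, centredLog x ∂standardComplexGaussian = 0 := by
  unfold centredLog
  rw [integral_sub (memLp_log_norm_standardComplexGaussian.integrable (by norm_num))
    (integrable_const _), integral_const]
  simp [gaussianLogMean]

/-- A rotation-invariant linear combination of independent standard Gaussians is standard. -/
lemma map_add_standardComplexGaussian {ρ : ℂ} {s : ℝ} (h : ‖ρ‖ ^ 2 + s ^ 2 = 1) :
    (standardComplexGaussian.prod standardComplexGaussian).map
      (fun p : ℂ × ℂ => ρ * p.1 + s * p.2) = standardComplexGaussian := by
  have : IsProbabilityMeasure ((standardComplexGaussian.prod standardComplexGaussian).map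
      (fun p : ℂ × ℂ => ρ * p.1 + s * p.2)) := Measure.isProbabilityMeasure_map (by fun_prop)
  refine Measure.ext_of_charFun (funext fun t => ?_)
  rw [charFun_apply, integral_map (by fun_prop) (by fun_prop), charFun_standardComplexGaussian]
  have h1 (p : ℂ × ℂ) : Complex.exp ((inner ℝ (ρ * p.1 + s * p.2) t : ℝ) * Complex.I) =
      Complex.exp ((inner ℝ p.1 (starRingEnd ℂ ρ * t) : ℝ) * Complex.I) *
        Complex.exp ((inner ℝ p.2 (s * t) : ℝ) * Complex.I) := by
    rw [← Complex.exp_add, ← add_mul, ← Complex.ofReal_add]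
    congr 3
    simp only [Complex.inner, map_add, map_mul, Complex.conj_ofReal, ← Complex.add_re]
    congr 1
    ring
  simp_rw [h1]
  rw [integral_prod_mul
    (fun x : ℂ => Complex.exp ((inner ℝ x (starRingEnd ℂ ρ * t) : ℝ) * Complex.I))
    (fun x : ℂ => Complex.exp ((inner ℝ x (s * t) : ℝ) * Complex.I)),
    integral_exp_inner_standardComplexGaussian, integral_exp_inner_standardComplexGaussian,
    ← Complex.exp_add]
  congr 1
  rw [← neg_add, ← Complex.ofReal_add, norm_mul, norm_mul, RCLike.norm_conj, Complex.norm_real,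
    mul_pow, mul_pow, Real.norm_eq_abs, sq_abs]
  congr 2
  linear_combination (‖t‖ ^ 2 / 4) * h

/-! ### Covariance of the logarithms of correlated Gaussians. -/

lemma integral_log_norm_add_of_norm_eq {z w : ℂ} (s : ℝ) (h : ‖z‖ = ‖w‖) (g : ℝ → ℝ) :
    ∫ y : ℂ, g (Real.log ‖z + s * y‖) ∂standardComplexGaussian =
      ∫ y : ℂ, g (Real.log ‖w + s * y‖) ∂standardComplexGaussian := by
  by_cases hw : w = 0
  · rw [hw, norm_zero, norm_eq_zero] at h; rw [h, hw]
  set u : ℂ := z / w with hu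
  have hun : ‖u‖ = 1 := by rw [hu, norm_div, h, div_self (norm_ne_zero_iff.2 hw)]
  have hz : z = u * w := by rw [hu, div_mul_cancel₀ _ hw]
  have hu0 : u ≠ 0 := fun h0 => by simp [h0] at hun
  have he : MeasurableEmbedding fun x : ℂ => u * x :=
    (Homeomorph.mulLeft₀ u hu0).measurableEmbedding
  conv_lhs => rw [← map_mul_standardComplexGaussian hun]
  rw [he.integral_map]
  refine integral_congr_ae (Eventually.of_forall fun y => ?_)
  simp only
  rw [hz, show u * w + s * (u * y) = u * (w + s * y) by ring, norm_mul, hun, one_mul]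

lemma ae_ne_zero_standardComplexGaussian : ∀ᵐ y : ℂ ∂standardComplexGaussian, y ≠ 0 :=
  (Set.countable_singleton 0).ae_notMem _

lemma posLog_le_self {t : ℝ} (ht : 0 ≤ t) : Real.posLog t ≤ t := by
  rw [Real.posLog_def]
  refine max_le ht ?_
  exact (Real.log_le_self ht)

/-- Both sides equal max(log R, log S). -/
lemma log_add_posLog_div {R S : ℝ} (hR : 0 < R) (hS : 0 < S) :
    Real.log R + Real.posLog (R⁻¹ * S) = Real.log S + Real.posLog (R / S) := by
  simp only [Real.posLog]
  rw [Real.log_mul (inv_pos.2 hR).ne' hS.ne', Real.log_inv,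
    Real.log_div hR.ne' hS.ne', ← max_add_add_left, ← max_add_add_left]
  rw [max_comm]
  congr 1 <;> ring

lemma integrable_posLog_div (w : ℂ) {s : ℝ} (hs : 0 < s) :
    Integrable (fun y : ℂ => Real.posLog (‖w‖ / (s * ‖y‖))) standardComplexGaussian := by
  have hm : Measurable fun y : ℂ => Real.posLog (‖w‖ / (s * ‖y‖)) := by
    unfold Real.posLog; fun_prop
  refine (integrable_inv_norm_standardComplexGaussian.const_mul (‖w‖ / s)).mono'
    hm.aestronglyMeasurable (Eventually.of_forall fun y => ?_)
  rw [Real.norm_of_nonneg Real.posLog_nonneg]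
  refine (posLog_le_self (by positivity)).trans_eq ?_
  rw [div_mul_eq_div_div, div_eq_mul_inv (‖w‖ / s)]

lemma integral_log_norm_mul {s : ℝ} (hs : 0 < s) :
    ∫ y : ℂ, (Real.log (s * ‖y‖)) ∂standardComplexGaussian = Real.log s + gaussianLogMean := by
  have h : (fun y : ℂ => Real.log (s * ‖y‖)) =ᵐ[standardComplexGaussian]
      fun y => Real.log s + Real.log ‖y‖ := by
    filter_upwards [ae_ne_zero_standardComplexGaussian] with y hy
    rw [Real.log_mul hs.ne' (norm_ne_zero_iff.2 hy)]
  rw [integral_congr_ae h, integral_add (integrable_const _)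
    (memLp_log_norm_standardComplexGaussian.integrable (by norm_num)), integral_const]
  simp [gaussianLogMean]

lemma integrable_log_norm_mul {s : ℝ} (hs : 0 < s) :
    Integrable (fun y : ℂ => Real.log (s * ‖y‖)) standardComplexGaussian := by
  have h : (fun y : ℂ => Real.log (s * ‖y‖)) =ᵐ[standardComplexGaussian]
      fun y => Real.log s + Real.log ‖y‖ := by
    filter_upwards [ae_ne_zero_standardComplexGaussian] with y hy
    rw [Real.log_mul hs.ne' (norm_ne_zero_iff.2 hy)]
  exact (integrable_congr h).2 ((integrable_const _).add
    (memLp_log_norm_standardComplexGaussian.integrable (by norm_num)))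

lemma circleAverage_log_norm_add {R : ℝ} (hR : R ≠ 0) (a : ℂ) :
    Real.circleAverage (fun z => Real.log ‖z + a‖) 0 R = Real.log R + Real.posLog (R⁻¹ * ‖a‖) := by
  have := circleAverage_log_norm_sub_const_eq_log_radius_add_posLog (a := -a) (c := 0) hR
  simpa using this

lemma integrable_log_norm_add_iff_of_norm_eq {z w : ℂ} (s : ℝ) (h : ‖z‖ = ‖w‖) :
    Integrable (fun y : ℂ => Real.log ‖z + s * y‖) standardComplexGaussian ↔
      Integrable (fun y : ℂ => Real.log ‖w + s * y‖) standardComplexGaussian := by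
  by_cases hw : w = 0
  · rw [hw, norm_zero, norm_eq_zero] at h; rw [h, hw]
  set u : ℂ := z / w with hu
  have hun : ‖u‖ = 1 := by rw [hu, norm_div, h, div_self (norm_ne_zero_iff.2 hw)]
  have hz : z = u * w := by rw [hu, div_mul_cancel₀ _ hw]
  have hu0 : u ≠ 0 := fun h0 => by simp [h0] at hun
  have he : MeasurableEmbedding fun x : ℂ => u * x :=
    (Homeomorph.mulLeft₀ u hu0).measurableEmbedding
  conv_lhs => rw [← map_mul_standardComplexGaussian hun]
  rw [he.integrable_map_iff]
  refine integrable_congr (Eventually.of_forall fun y => ?_)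
  simp only [Function.comp]
  rw [hz, show u * w + s * (u * y) = u * (w + s * y) by ring, norm_mul, hun, one_mul]

/-- By rotation invariance of y the integral depends only on |w|, so w may be averaged over its
circle. Jensen's formula then gives max(log|w|, log(s|y|)) under the integral. -/
lemma integral_log_norm_add (w : ℂ) {s : ℝ} (hs : 0 < s)
    (hint : Integrable (fun y : ℂ => Real.log ‖w + s * y‖) standardComplexGaussian) :
    ∫ y : ℂ, Real.log ‖w + s * y‖ ∂standardComplexGaussian = Real.log s + gaussianLogMean +
      ∫ y : ℂ, Real.posLog (‖w‖ / (s * ‖y‖)) ∂standardComplexGaussian := by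
  rw [← integral_log_norm_mul hs, ← integral_add (integrable_log_norm_mul hs)
    (integrable_posLog_div w hs)]
  by_cases hw : w = 0
  · refine integral_congr_ae (Eventually.of_forall fun y => ?_)
    simp [hw, abs_of_pos hs]
  have hR : 0 < ‖w‖ := norm_pos_iff.2 hw
  have hcirc (θ : ℝ) : ‖circleMap 0 ‖w‖ θ‖ = ‖w‖ := by simp
  have hmeas : Measurable fun p : ℝ × ℂ => Real.log ‖circleMap 0 ‖w‖ p.1 + s * p.2‖ := by fun_prop
  have hintegrable : Integrable (fun p : ℝ × ℂ => Real.log ‖circleMap 0 ‖w‖ p.1 + s * p.2‖)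
      ((volume.restrict (Set.Ioc 0 (2 * Real.pi))).prod standardComplexGaussian) := by
    rw [integrable_prod_iff hmeas.aestronglyMeasurable]
    constructor
    · refine Eventually.of_forall fun θ => ?_
      exact (integrable_log_norm_add_iff_of_norm_eq s (hcirc θ)).2 hint
    · simp_rw [Real.norm_eq_abs, fun θ => integral_log_norm_add_of_norm_eq s (hcirc θ) (fun t => |t|)]
      exact integrable_const _
  calc ∫ y : ℂ, Real.log ‖w + s * y‖ ∂standardComplexGaussian
      = (2 * Real.pi)⁻¹ * ∫ θ in Set.Ioc 0 (2 * Real.pi),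
          ∫ y : ℂ, Real.log ‖circleMap 0 ‖w‖ θ + s * y‖ ∂standardComplexGaussian := by
        simp_rw [fun θ => integral_log_norm_add_of_norm_eq s (hcirc θ) (fun t => t)]
        rw [setIntegral_const]
        have := Real.pi_pos
        simp [Real.volume_real_Ioc, this.le]
        field_simp
    _ = ∫ y : ℂ, Real.circleAverage (fun z => Real.log ‖z + s * y‖) 0 ‖w‖
          ∂standardComplexGaussian := by
        rw [integral_integral_swap hintegrable, ← integral_const_mul]
        refine integral_congr_ae (Eventually.of_forall fun y => ?_)
        simp only [Real.circleAverage_def, smul_eq_mul]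
        rw [intervalIntegral.integral_of_le (by positivity)]
    _ = _ := by
        refine integral_congr_ae ?_
        filter_upwards [ae_ne_zero_standardComplexGaussian] with y hy
        rw [circleAverage_log_norm_add hR.ne', norm_mul, Complex.norm_real,
          Real.norm_of_nonneg hs.le, log_add_posLog_div hR (mul_pos hs (norm_pos_iff.2 hy))]

/-- The centred logarithms of correlated standard complex Gaussians have small covariance. -/
lemma exists_abs_integral_centredLog_mul_le : ∃ C : ℝ, 0 ≤ C ∧ ∀ (ρ : ℂ) (s : ℝ), 1 / 2 ≤ s →
    ‖ρ‖ ^ 2 + s ^ 2 = 1 →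
    |∫ p : ℂ × ℂ, centredLog p.1 * centredLog (ρ * p.1 + s * p.2)
      ∂(standardComplexGaussian.prod standardComplexGaussian)| ≤ C * ‖ρ‖ := by
  set γ := standardComplexGaussian with hγ
  set M := ∫ y : ℂ, ‖y‖⁻¹ ∂γ with hM
  have hM0 : 0 ≤ M := integral_nonneg fun y => by positivity
  have hmulint : Integrable (fun x : ℂ => |centredLog x| * ‖x‖) γ :=
    memLp_centredLog.abs.integrable_mul memLp_two_standardComplexGaussian.norm
  refine ⟨2 * M * ∫ x : ℂ, |centredLog x| * ‖x‖ ∂γ, mul_nonneg (by positivity)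
    (integral_nonneg fun x => by positivity), fun ρ s hs hρs => ?_⟩
  have hs0 : 0 < s := by linarith
  have hL2 : MemLp (fun p : ℂ × ℂ => centredLog (ρ * p.1 + s * p.2)) 2 (γ.prod γ) := by
    have h := memLp_centredLog
    rw [← map_add_standardComplexGaussian hρs] at h
    exact h.comp_of_map (by fun_prop)
  have hL1 : MemLp (fun p : ℂ × ℂ => centredLog p.1) 2 (γ.prod γ) :=
    memLp_centredLog.comp_fst γ
  have hint : Integrable (fun p : ℂ × ℂ => centredLog p.1 * centredLog (ρ * p.1 + s * p.2))
      (γ.prod γ) := hL1.integrable_mul hL2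
  have hint2 := hL2.integrable (by norm_num : (1 : ENNReal) ≤ 2)
  rw [integral_prod _ hint]
  -- Conditioning on the first variable leaves a constant log s plus a non-negative term of size
  -- O(|ρ||x|), the latter from log⁺ t ≤ t and s ≥ 1/2.
  have hinner : ∀ᵐ x ∂γ, ∫ y, centredLog (ρ * x + s * y) ∂γ =
      Real.log s + ∫ y : ℂ, Real.posLog (‖ρ * x‖ / (s * ‖y‖)) ∂γ := by
    filter_upwards [hint2.prod_right_ae] with x hx
    have hx' : Integrable (fun y : ℂ => Real.log ‖ρ * x + s * y‖) γ := by
      have := hx.add (integrable_const gaussianLogMean)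
      refine this.congr (Eventually.of_forall fun y => ?_)
      simp [centredLog]
    simp only [centredLog]
    rw [integral_sub hx' (integrable_const _), integral_log_norm_add _ hs0 hx', integral_const]
    simp
    ring
  have hpos (x : ℂ) : |∫ y : ℂ, Real.posLog (‖ρ * x‖ / (s * ‖y‖)) ∂γ| ≤ 2 * M * ‖ρ‖ * ‖x‖ := by
    rw [abs_of_nonneg (integral_nonneg fun y => Real.posLog_nonneg)]
    calc ∫ y : ℂ, Real.posLog (‖ρ * x‖ / (s * ‖y‖)) ∂γ
        ≤ ∫ y : ℂ, (2 * ‖ρ‖ * ‖x‖) * ‖y‖⁻¹ ∂γ := by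
          refine integral_mono (integrable_posLog_div _ hs0)
            (integrable_inv_norm_standardComplexGaussian.const_mul _) fun y => ?_
          refine (posLog_le_self (by positivity)).trans ?_
          rw [div_mul_eq_div_div, div_eq_mul_inv (_ / s), norm_mul]
          gcongr
          rw [div_le_iff₀ hs0]
          nlinarith [mul_nonneg (norm_nonneg ρ) (norm_nonneg x)]
      _ = _ := by rw [integral_const_mul]; ring
  set J : ℂ → ℝ := fun x => ∫ y, centredLog (ρ * x + s * y) ∂γ with hJ
  have hJint : Integrable (fun x => centredLog x * J x) γ := by
    refine hint.integral_prod_left.congr (Eventually.of_forall fun x => ?_)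
    simp only [hJ, integral_const_mul]
  -- Since `centredLog` has mean zero, the constant log s can be subtracted for free; only the
  -- O(|ρ||x|) term remains.
  have hsub : ∫ x, ∫ y, centredLog x * centredLog (ρ * x + s * y) ∂γ ∂γ =
      ∫ x, (centredLog x * J x - centredLog x * Real.log s) ∂γ := by
    rw [integral_sub hJint (integrable_centredLog.mul_const _), integral_mul_const,
      integral_centredLog, zero_mul, sub_zero]
    simp only [hJ, integral_const_mul]
  rw [hsub, ← Real.norm_eq_abs]
  calc _ ≤ ∫ x, (2 * M * ‖ρ‖) * (|centredLog x| * ‖x‖) ∂γ := by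
        refine norm_integral_le_of_norm_le (hmulint.const_mul _) ?_
        filter_upwards [hinner] with x hx
        rw [← mul_sub, show J x = _ from hx, add_sub_cancel_left, norm_mul, Real.norm_eq_abs, Real.norm_eq_abs]
        calc _ ≤ |centredLog x| * (2 * M * ‖ρ‖ * ‖x‖) := by gcongr; exact hpos x
          _ = _ := by ring
    _ = _ := by rw [integral_const_mul]; ring

/-! ### Series of independent Gaussians -/

section

variable {Ω : Type*} [MeasurableSpace Ω] {P : Measure Ω} {ξ : ℕ → Ω → ℂ}

lemma integral_norm_sq_of_hasLaw {X : Ω → ℂ} (h : HasLaw X standardComplexGaussian P) :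
    ∫ ω, ‖X ω‖ ^ 2 ∂P = 1 := by
  rw [← integral_norm_sq_standardComplexGaussian]
  exact h.integral_comp (f := fun x : ℂ => ‖x‖ ^ 2) (by fun_prop)

lemma memLp_two_of_hasLaw {X : Ω → ℂ} (h : HasLaw X standardComplexGaussian P) :
    MemLp X 2 P := by
  have := memLp_two_standardComplexGaussian
  rw [← h.map_eq] at this
  exact this.comp_of_map h.aemeasurable

lemma integral_norm_mul_norm_le [IsProbabilityMeasure P] {X Y : Ω → ℂ} (hX : HasLaw X standardComplexGaussian P)
    (hY : HasLaw Y standardComplexGaussian P) : ∫ ω, ‖X ω‖ * ‖Y ω‖ ∂P ≤ 1 := by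
  have h1 := (memLp_two_of_hasLaw hX).norm.integrable_sq
  have h2 := (memLp_two_of_hasLaw hY).norm.integrable_sq
  calc ∫ ω, ‖X ω‖ * ‖Y ω‖ ∂P ≤ ∫ ω, (1 / 2 * ‖X ω‖ ^ 2 + 1 / 2 * ‖Y ω‖ ^ 2) ∂P := by
        refine integral_mono ((memLp_two_of_hasLaw hX).norm.integrable_mul
          (memLp_two_of_hasLaw hY).norm) ((h1.const_mul _).add (h2.const_mul _)) fun ω => ?_
        nlinarith [sq_nonneg (‖X ω‖ - ‖Y ω‖)]
    _ = 1 := by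
        rw [integral_add (h1.const_mul _) (h2.const_mul _), integral_const_mul,
          integral_const_mul, integral_norm_sq_of_hasLaw hX, integral_norm_sq_of_hasLaw hY]
        norm_num

lemma ae_summable_norm_mul (hξ : ∀ n, HasLaw (ξ n) standardComplexGaussian P) {c : ℕ → ℝ}
    (hc : Summable c) (hc0 : ∀ n, 0 ≤ c n) : ∀ᵐ ω ∂P, Summable fun n => ‖ξ n ω‖ * c n := by
  set K := ∫⁻ x : ℂ, ‖x‖ₑ ∂standardComplexGaussian with hK
  have hKtop : K ≠ ⊤ := integrable_id_standardComplexGaussian.2.ne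
  have hE (n : ℕ) : ∫⁻ ω, ‖ξ n ω‖ₑ * ENNReal.ofReal (c n) ∂P = K * ENNReal.ofReal (c n) := by
    rw [lintegral_mul_const'' _ (hξ n).aemeasurable.enorm]
    congr 1
    exact (hξ n).lintegral_comp (f := fun x : ℂ => ‖x‖ₑ) (by fun_prop)
  have hsum : ∫⁻ ω, ∑' n, ‖ξ n ω‖ₑ * ENNReal.ofReal (c n) ∂P ≠ ⊤ := by
    rw [lintegral_tsum fun n => (hξ n).aemeasurable.enorm.mul_const _]
    simp_rw [hE]
    rw [ENNReal.tsum_mul_left]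
    refine ENNReal.mul_ne_top hKtop ?_
    rw [← ENNReal.ofReal_tsum_of_nonneg hc0 hc]
    exact ENNReal.ofReal_ne_top
  have hae := ae_lt_top' (AEMeasurable.tsum fun n =>
    (hξ n).aemeasurable.enorm.mul_const (ENNReal.ofReal (c n))) hsum
  filter_upwards [hae] with ω hω
  have := ENNReal.summable_toReal hω.ne
  refine this.congr fun n => ?_
  rw [ENNReal.toReal_mul, toReal_enorm, ENNReal.toReal_ofReal (hc0 n)]

/-- Independence gives the characteristic function of the partial sums as a product, and dominated
convergence passes to the limit. All the laws of Gaussian series below are derived from this. -/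
lemma integral_exp_of_hasSum_inner [IsProbabilityMeasure P] (hξ : ∀ n, HasLaw (ξ n) standardComplexGaussian P)
    (hind : iIndepFun ξ P) {u : ℕ → ℂ} {S : Ω → ℝ} {v : ℝ}
    (hS : ∀ ω, HasSum (fun n => inner ℝ (ξ n ω) (u n)) (S ω))
    (hv : HasSum (fun n => ‖u n‖ ^ 2) v) :
    ∫ ω, Complex.exp (S ω * Complex.I) ∂P = Complex.exp (-((v / 4 : ℝ) : ℂ)) := by
  have hpart (N : ℕ) : ∫ ω, Complex.exp ((∑ n ∈ Finset.range N, inner ℝ (ξ n ω) (u n) : ℝ) *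
      Complex.I) ∂P = Complex.exp (-(((∑ n ∈ Finset.range N, ‖u n‖ ^ 2) / 4 : ℝ) : ℂ)) := by
    have h1 (ω : Ω) : Complex.exp ((∑ n ∈ Finset.range N, inner ℝ (ξ n ω) (u n) : ℝ) *
        Complex.I) = ∏ n : Fin N, Complex.exp ((inner ℝ (ξ n ω) (u n) : ℝ) * Complex.I) := by
      rw [Finset.sum_range, Complex.ofReal_sum, Finset.sum_mul, Complex.exp_sum]
    simp_rw [h1]
    have hind' : iIndepFun (fun n : Fin N => ξ n) P :=
      hind.precomp (g := fun n : Fin N => (n : ℕ)) Fin.val_injective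
    rw [iIndepFun.integral_fun_prod_comp (X := fun n : Fin N => ξ n) hind'
      (f := fun (n : Fin N) x => Complex.exp ((inner ℝ x (u n) : ℝ) * Complex.I))
      (fun n => (hξ n).aemeasurable) (fun n => by fun_prop)]
    rw [Finset.sum_range, Finset.sum_div, Complex.ofReal_sum, ← Finset.sum_neg_distrib,
      Complex.exp_sum]
    refine Finset.prod_congr rfl fun n _ => ?_
    rw [← integral_exp_inner_standardComplexGaussian]
    exact (hξ n).integral_comp (f := fun x => Complex.exp ((inner ℝ x (u n) : ℝ) * Complex.I))
      (by fun_prop)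
  have hlim : Tendsto (fun N => ∫ ω, Complex.exp ((∑ n ∈ Finset.range N,
      inner ℝ (ξ n ω) (u n) : ℝ) * Complex.I) ∂P) atTop
      (𝓝 (∫ ω, Complex.exp (S ω * Complex.I) ∂P)) := by
    refine tendsto_integral_of_dominated_convergence (fun _ => 1) (fun N => ?_)
      (integrable_const _) (fun N => Eventually.of_forall fun ω => ?_)
      (Eventually.of_forall fun ω => ?_)
    · have hm : AEMeasurable (fun ω => ∑ n ∈ Finset.range N, inner ℝ (ξ n ω) (u n)) P :=
        Finset.aemeasurable_fun_sum _ fun n _ => (hξ n).aemeasurable.inner aemeasurable_const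
      exact (Complex.measurable_exp.comp_aemeasurable
        ((Complex.measurable_ofReal.comp_aemeasurable hm).mul_const _)).aestronglyMeasurable
    · rw [Complex.norm_exp_ofReal_mul_I]
    · have h2 := (hS ω).tendsto_sum_nat
      exact ((Complex.continuous_exp.comp ((Complex.continuous_ofReal).mul
        continuous_const)).tendsto _).comp h2
  refine tendsto_nhds_unique hlim ?_
  simp_rw [hpart]
  have h3 := hv.tendsto_sum_nat
  have hcont : Continuous fun x : ℝ => Complex.exp (-((x / 4 : ℝ) : ℂ)) := by fun_prop
  exact (hcont.tendsto v).comp h3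

lemma measurable_of_hasSum {X : Ω → ℂ} {F : ℕ → Ω → ℂ} (hF : ∀ n, Measurable (F n))
    (hX : ∀ ω, HasSum (fun n => F n ω) (X ω)) : Measurable X :=
  measurable_of_tendsto_metrizable (f := fun N ω => ∑ n ∈ Finset.range N, F n ω)
    (fun _ => Finset.measurable_fun_sum _ fun n _ => hF n)
    (tendsto_pi_nhds.2 fun ω => (hX ω).tendsto_sum_nat)

lemma hasSum_inner_of_hasSum_mul {x c : ℕ → ℂ} {X : ℂ} (h : HasSum (fun n => x n * c n) X)
    (s : ℂ) : HasSum (fun n => inner ℝ (x n) (starRingEnd ℂ (c n) * s)) (inner ℝ X s) := by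
  have h2 := (Complex.hasSum_re ((Complex.hasSum_conj.2 (by simpa using h) :
    HasSum (fun n => starRingEnd ℂ (x n * c n)) (starRingEnd ℂ X)).mul_right s))
  convert h2 using 2 with n
  · rw [Complex.inner, map_mul]
    congr 1
    ring
  · rw [Complex.inner]; congr 1; ring

lemma hasLaw_of_hasSum [IsProbabilityMeasure P] (hm : ∀ n, Measurable (ξ n))
    (hξ : ∀ n, HasLaw (ξ n) standardComplexGaussian P) (hind : iIndepFun ξ P) {c : ℕ → ℂ}
    {X : Ω → ℂ} (hX : ∀ ω, HasSum (fun n => ξ n ω * c n) (X ω))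
    (hc : HasSum (fun n => ‖c n‖ ^ 2) 1) : HasLaw X standardComplexGaussian P := by
  have hXm : Measurable X := measurable_of_hasSum (fun n => (hm n).mul_const _) hX
  refine ⟨hXm.aemeasurable, ?_⟩
  have := Measure.isProbabilityMeasure_map (μ := P) hXm.aemeasurable
  refine Measure.ext_of_charFun (funext fun t => ?_)
  rw [charFun_apply, integral_map hXm.aemeasurable (by fun_prop), charFun_standardComplexGaussian]
  refine integral_exp_of_hasSum_inner hξ hind (fun ω => hasSum_inner_of_hasSum_mul (hX ω) t) ?_
  simp_rw [norm_mul, RCLike.norm_conj, mul_pow]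
  simpa using hc.mul_right (‖t‖ ^ 2)

lemma hasLaw_prod_of_hasSum [IsProbabilityMeasure P] (hm : ∀ n, Measurable (ξ n))
    (hξ : ∀ n, HasLaw (ξ n) standardComplexGaussian P) (hind : iIndepFun ξ P) {c d : ℕ → ℂ}
    {X Y : Ω → ℂ} (hX : ∀ ω, HasSum (fun n => ξ n ω * c n) (X ω))
    (hY : ∀ ω, HasSum (fun n => ξ n ω * d n) (Y ω))
    (hc : HasSum (fun n => ‖c n‖ ^ 2) 1) (hd : HasSum (fun n => ‖d n‖ ^ 2) 1)
    (hcd : HasSum (fun n => starRingEnd ℂ (c n) * d n) 0) :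
    HasLaw (fun ω => (X ω, Y ω)) (standardComplexGaussian.prod standardComplexGaussian) P := by
  have hXm : Measurable X := measurable_of_hasSum (fun n => (hm n).mul_const _) hX
  have hYm : Measurable Y := measurable_of_hasSum (fun n => (hm n).mul_const _) hY
  have hXY : Measurable fun ω => (X ω, Y ω) := hXm.prodMk hYm
  refine ⟨hXY.aemeasurable, ?_⟩
  have := Measure.isProbabilityMeasure_map (μ := P) hXY.aemeasurable
  rw [← charFun_eq_prod_iff]
  intro t
  obtain ⟨s, t⟩ := t
  rw [charFun_apply, integral_map (by fun_prop) (by fun_prop), integral_map hXY.aemeasurable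
    (by fun_prop), charFun_standardComplexGaussian, charFun_standardComplexGaussian,
    ← Complex.exp_add]
  have hS (ω : Ω) : HasSum (fun n => inner ℝ (ξ n ω) (starRingEnd ℂ (c n) * s +
      starRingEnd ℂ (d n) * t)) (inner ℝ (X ω) s + inner ℝ (Y ω) t) := by
    simp_rw [inner_add_right]
    exact (hasSum_inner_of_hasSum_mul (hX ω) s).add (hasSum_inner_of_hasSum_mul (hY ω) t)
  -- The cross terms are the real part of Σ c̄_n d_n times a constant. Orthogonality kills them, so
  -- the joint characteristic function factorises.
  have hv : HasSum (fun n => ‖starRingEnd ℂ (c n) * s + starRingEnd ℂ (d n) * t‖ ^ 2)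
      (‖s‖ ^ 2 + ‖t‖ ^ 2) := by
    have h1 := (hc.mul_right (‖s‖ ^ 2)).add (hd.mul_right (‖t‖ ^ 2))
    have h2 := (Complex.hasSum_re (hcd.mul_right (s * starRingEnd ℂ t))).mul_left 2
    have h3 := h1.add h2
    simp only [one_mul, zero_mul, Complex.zero_re, mul_zero, add_zero] at h3
    refine (congrArg (fun f => HasSum f (‖s‖ ^ 2 + ‖t‖ ^ 2)) (funext fun n => ?_)).mpr h3
    rw [← Complex.normSq_eq_norm_sq, Complex.normSq_add, Complex.normSq_mul, Complex.normSq_mul,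
      Complex.normSq_conj, Complex.normSq_conj]
    simp only [Complex.normSq_eq_norm_sq]
    congr 3
    simp only [map_mul, Complex.conj_conj]
    ring
  have h := integral_exp_of_hasSum_inner hξ hind hS hv
  rw [← neg_add, ← Complex.ofReal_add, ← add_div, ← h]
  refine integral_congr_ae (Eventually.of_forall fun ω => ?_)
  simp only [WithLp.prod_inner_apply]

lemma integral_mul_conj_of_hasLaw [IsProbabilityMeasure P] (hξ : ∀ n, HasLaw (ξ n) standardComplexGaussian P)
    (hind : iIndepFun ξ P) (n m : ℕ) :
    ∫ ω, ξ n ω * starRingEnd ℂ (ξ m ω) ∂P = if n = m then 1 else 0 := by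
  split_ifs with h
  · subst h
    simp_rw [Complex.mul_conj, Complex.normSq_eq_norm_sq]
    rw [integral_complex_ofReal, integral_norm_sq_of_hasLaw (hξ n), Complex.ofReal_one]
  · have h1 : IndepFun (ξ n) (fun ω => starRingEnd ℂ (ξ m ω)) P :=
      (hind.indepFun h).comp measurable_id (by fun_prop : Measurable (starRingEnd ℂ))
    rw [h1.integral_fun_mul_eq_mul_integral (hξ n).aemeasurable.aestronglyMeasurable
      (by
        have : Measurable (starRingEnd ℂ) := by fun_prop
        exact (this.comp_aemeasurable (hξ m).aemeasurable).aestronglyMeasurable)]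
    have : ∫ ω, ξ n ω ∂P = 0 := by
      rw [← integral_id_standardComplexGaussian]
      exact (hξ n).integral_comp (f := fun x : ℂ => x) (by fun_prop)
    rw [this, zero_mul]

/-- The covariance of two series of independent standard complex Gaussians. -/
lemma integral_mul_conj_of_hasSum [IsProbabilityMeasure P] (hξ : ∀ n, HasLaw (ξ n) standardComplexGaussian P)
    (hind : iIndepFun ξ P) {c d : ℕ → ℂ} (hc : Summable fun n => ‖c n‖)
    (hd : Summable fun n => ‖d n‖) {X Y : Ω → ℂ}
    (hX : ∀ᵐ ω ∂P, HasSum (fun n => ξ n ω * c n) (X ω))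
    (hY : ∀ᵐ ω ∂P, HasSum (fun n => ξ n ω * d n) (Y ω)) :
    ∫ ω, X ω * starRingEnd ℂ (Y ω) ∂P = ∑' n, c n * starRingEnd ℂ (d n) := by
  let F : ℕ × ℕ → Ω → ℂ := fun p ω => (ξ p.1 ω * c p.1) * starRingEnd ℂ (ξ p.2 ω * d p.2)
  have hF (p : ℕ × ℕ) (ω : Ω) : F p ω =
      (c p.1 * starRingEnd ℂ (d p.2)) * (ξ p.1 ω * starRingEnd ℂ (ξ p.2 ω)) := by
    simp only [F, map_mul]; ring
  have hconj (n : ℕ) : MemLp (fun ω => starRingEnd ℂ (ξ n ω)) 2 P := (memLp_two_of_hasLaw (hξ n)).star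
  have hFint (p : ℕ × ℕ) : Integrable (F p) P := by
    have h := ((memLp_two_of_hasLaw (hξ p.1)).integrable_mul (hconj p.2)).const_mul
      (c p.1 * starRingEnd ℂ (d p.2))
    exact h.congr (Eventually.of_forall fun ω => (hF p ω).symm)
  have hnorm (p : ℕ × ℕ) : ∫ ω, ‖F p ω‖ ∂P ≤ ‖c p.1‖ * ‖d p.2‖ := by
    simp_rw [hF, norm_mul, RCLike.norm_conj]
    rw [integral_const_mul]
    exact mul_le_of_le_one_right (by positivity) (integral_norm_mul_norm_le (hξ _) (hξ _))
  have hcd : Summable fun p : ℕ × ℕ => ‖c p.1‖ * ‖d p.2‖ :=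
    hc.mul_of_nonneg hd (fun _ => norm_nonneg _) (fun _ => norm_nonneg _)
  have hsum := hasSum_integral_of_summable_integral_norm hFint
    (Summable.of_nonneg_of_le (fun p => integral_nonneg fun ω => norm_nonneg _) hnorm hcd)
  have hXY : ∀ᵐ ω ∂P, ∑' p, F p ω = X ω * starRingEnd ℂ (Y ω) := by
    filter_upwards [hX, hY, ae_summable_norm_mul hξ hc fun n => norm_nonneg _,
      ae_summable_norm_mul hξ hd fun n => norm_nonneg _] with ω h1 h2 h3 h4
    have h5 : HasSum (fun n => starRingEnd ℂ (ξ n ω * d n)) (starRingEnd ℂ (Y ω)) :=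
      Complex.hasSum_conj.2 (by simpa using h2)
    rw [← h1.tsum_eq, ← h5.tsum_eq, tsum_mul_tsum_of_summable_norm]
    · simpa using h3
    · simpa using h4
  rw [integral_congr_ae hXY] at hsum
  have hterm (p : ℕ × ℕ) : ∫ ω, F p ω ∂P =
      if p.1 = p.2 then c p.1 * starRingEnd ℂ (d p.2) else 0 := by
    simp_rw [hF]
    rw [integral_const_mul, integral_mul_conj_of_hasLaw hξ hind]
    split_ifs <;> simp
  simp_rw [hterm] at hsum
  have hfib := hsum.prod_fiberwise (g := fun n => c n * starRingEnd ℂ (d n)) fun n => by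
    have := hasSum_ite_eq n (c n * starRingEnd ℂ (d n))
    refine (congrArg (fun f => HasSum f _) (funext fun m => ?_)).mpr this
    by_cases hnm : n = m
    · subst hnm; simp
    · simp [hnm, Ne.symm hnm]
  exact hfib.tsum_eq.symm

end

/-! ### Random Taylor series with simple zeros -/

/-- The coefficient sequences `x` for which `∑ x_n a_n z^n` converges absolutely everywhere. -/
def coeffSpace (a : ℕ → ℝ) : Set (ℕ → ℂ) :=
  {x | ∀ m : ℕ, Summable fun n => ‖x n‖ * (a n * (m : ℝ) ^ n)}

/-- The sum of the series `∑ x_n a_n z^n`. -/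
noncomputable def taylorSum (a : ℕ → ℝ) (x : ℕ → ℂ) (z : ℂ) : ℂ :=
  ∑' n, x n * (a n : ℂ) * z ^ n

section

variable {a : ℕ → ℝ} {x : ℕ → ℂ}

lemma norm_mul_pow_le_of_norm_le (ha : ∀ n, 0 ≤ a n) {z : ℂ} {m : ℕ} (hz : ‖z‖ ≤ m) (n : ℕ) :
    ‖x n * (a n : ℂ) * z ^ n‖ ≤ ‖x n‖ * (a n * (m : ℝ) ^ n) := by
  rw [norm_mul, norm_mul, norm_pow, Complex.norm_real, Real.norm_of_nonneg (ha n), mul_assoc]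
  have := ha n
  gcongr

lemma summable_of_mem_coeffSpace (ha : ∀ n, 0 ≤ a n) (hx : x ∈ coeffSpace a) (z : ℂ) :
    Summable fun n => x n * (a n : ℂ) * z ^ n := by
  obtain ⟨m, hm⟩ := exists_nat_ge ‖z‖
  exact Summable.of_norm_bounded (hx m) (norm_mul_pow_le_of_norm_le ha hm)

lemma differentiable_taylorSum (ha : ∀ n, 0 ≤ a n) (hx : x ∈ coeffSpace a) :
    Differentiable ℂ (taylorSum a x) := by
  intro z
  obtain ⟨m, hm⟩ := exists_nat_gt ‖z‖
  have h : DifferentiableOn ℂ (taylorSum a x) (Metric.ball 0 m) :=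
    Complex.differentiableOn_tsum_of_summable_norm (hx m) (fun n => by fun_prop) Metric.isOpen_ball
      fun n w hw => norm_mul_pow_le_of_norm_le ha (mem_ball_zero_iff.1 hw).le n
  exact h.differentiableAt (Metric.isOpen_ball.mem_nhds (mem_ball_zero_iff.2 hm))

lemma measurableSet_coeffSpace (ha : ∀ n, 0 ≤ a n) : MeasurableSet (coeffSpace a) := by
  have : coeffSpace a = ⋂ m : ℕ, {x : ℕ → ℂ | ∑' n, ENNReal.ofReal (‖x n‖ * (a n * (m : ℝ) ^ n)) < ⊤} := by
    ext x
    simp only [coeffSpace, Set.mem_ofPred_eq, Set.mem_iInter]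
    refine forall_congr' fun m => ⟨fun h => h.tsum_ofReal_lt_top, fun h => ?_⟩
    refine (ENNReal.summable_toReal h.ne).congr fun n => ?_
    have := ha n
    rw [ENNReal.toReal_ofReal (by positivity)]
  rw [this]
  refine MeasurableSet.iInter fun m => measurableSet_lt ?_ measurable_const
  fun_prop

lemma zero_mem_coeffSpace : (0 : ℕ → ℂ) ∈ coeffSpace a := fun m => by simp [summable_zero]

lemma taylorSum_eq_add_update (ha : ∀ n, 0 ≤ a n) (hx : x ∈ coeffSpace a) (z : ℂ) :
    taylorSum a x z = x 0 * a 0 + taylorSum a (Function.update x 0 0) z := by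
  have h := (summable_of_mem_coeffSpace ha hx z).tsum_eq_add_tsum_ite 0
  rw [taylorSum, h, pow_zero, mul_one, taylorSum]
  congr 1
  refine tsum_congr fun n => ?_
  by_cases hn : n = 0
  · subst hn; simp
  · simp [hn]

lemma update_mem_coeffSpace (hx : x ∈ coeffSpace a) : Function.update x 0 0 ∈ coeffSpace a := by
  intro m
  refine (summable_congr_cofinite ?_).1 (hx m)
  refine (Set.finite_singleton 0).subset fun n hn => ?_
  by_contra h
  exact hn (by simp [Function.update_of_ne h])

end

lemma measurable_deriv_of_differentiable {α : Type*} [MeasurableSpace α] {F : α → ℂ → ℂ}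
    (hF : ∀ p, Differentiable ℂ (F p)) (hm : ∀ z, Measurable fun p => F p z) (z : ℂ) :
    Measurable fun p => deriv (F p) z := by
  refine measurable_of_tendsto_metrizable
    (f := fun (n : ℕ) p => (n : ℂ) * (F p (z + (n : ℂ)⁻¹) - F p z)) (fun n => ?_) ?_
  · exact ((hm _).sub (hm _)).const_mul _
  · refine tendsto_pi_nhds.2 fun p => ?_
    have h := (((hF p z).hasDerivAt.hasFDerivAt.restrictScalars ℝ).lim_real 1).comp
      tendsto_natCast_atTop_atTop
    refine (h.congr fun n => ?_).trans (le_of_eq ?_)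
    · simp
    · simp

lemma measurableSet_exists_double_zero {α : Type*} [MeasurableSpace α] {F : α → ℂ → ℂ}
    (hF : ∀ p, Differentiable ℂ (F p)) (hm : ∀ z, Measurable fun p => F p z) :
    MeasurableSet {p | ∃ z, F p z = 0 ∧ deriv (F p) z = 0} := by
  have : {p | ∃ z, F p z = 0 ∧ deriv (F p) z = 0} =
      ⋃ m : ℕ, {p | ∃ z ∈ Metric.closedBall (0 : ℂ) m, ‖F p z‖ + ‖deriv (F p) z‖ = 0} := by
    ext p
    simp only [Set.mem_ofPred_eq, Set.mem_iUnion]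
    constructor
    · rintro ⟨z, h1, h2⟩
      obtain ⟨m, hm⟩ := exists_nat_ge ‖z‖
      exact ⟨m, z, by simpa using hm, by simp [h1, h2]⟩
    · rintro ⟨m, z, -, h⟩
      have h1 := norm_nonneg (F p z)
      have h2 := norm_nonneg (deriv (F p) z)
      exact ⟨z, norm_eq_zero.1 (by linarith), norm_eq_zero.1 (by linarith)⟩
  rw [this]
  exact MeasurableSet.iUnion fun m => measurableSet_exists_mem_eq_zero
    (fun p => ((hF p).continuous.norm).add
      (((hF p).contDiff (n := 1)).continuous_deriv le_rfl).norm)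
    (fun z => (hm z).norm.add (measurable_deriv_of_differentiable hF hm z).norm)
    (fun p z => add_nonneg (norm_nonneg _) (norm_nonneg _)) (isCompact_closedBall _ _)

/-- A double zero at z forces g'(z) = 0 and c = -g(z)/b. Either the critical points of the entire
function g are countable, or g is constant and only one value of c occurs. -/
lemma countable_critical_shift {g : ℂ → ℂ} (hg : Differentiable ℂ g) {b : ℂ} (hb : b ≠ 0) :
    {c : ℂ | ∃ z, c * b + g z = 0 ∧ deriv (fun z => c * b + g z) z = 0}.Countable := by
  have hsub : {c : ℂ | ∃ z, c * b + g z = 0 ∧ deriv (fun z => c * b + g z) z = 0} ⊆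
      (fun z => -g z / b) '' {z | deriv g z = 0} := by
    rintro c ⟨z, h1, h2⟩
    refine ⟨z, by simpa using h2, ?_⟩
    rw [div_eq_iff hb]
    linear_combination -h1
  refine Set.Countable.mono hsub ?_
  by_cases h : ∃ x, deriv g x ≠ 0
  · obtain ⟨x, hx⟩ := h
    exact (countable_of_isLocallyFiniteSet (isLocallyFiniteSet_zeros
      ((hg.contDiff (n := 2)).differentiable_deriv_two) hx)).image _
  · push Not at h
    refine (Set.countable_singleton (-g 0 / b)).mono ?_
    rintro _ ⟨z, -, rfl⟩
    simp only [Set.mem_singleton_iff]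
    rw [is_const_of_deriv_eq_zero hg h z 0]

lemma measurable_taylorSum (a : ℕ → ℝ) {α : Type*} [MeasurableSpace α] {x : α → ℕ → ℂ}
    (hx : Measurable x) (ha : ∀ n, 0 ≤ a n) (hmem : ∀ p, x p ∈ coeffSpace a) (z : ℂ) :
    Measurable fun p => taylorSum a (x p) z :=
  measurable_of_hasSum (F := fun n p => x p n * (a n : ℂ) * z ^ n) (fun n => by fun_prop)
    fun p => (summable_of_mem_coeffSpace ha (hmem p) z).hasSum

section

variable {Ω : Type*} [MeasurableSpace Ω] {P : Measure Ω} {ξ : ℕ → Ω → ℂ}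
  {a : ℕ → ℝ}

lemma ae_mem_coeffSpace [IsProbabilityMeasure P] (ha : ∀ n, 0 ≤ a n) (hsum : ∀ r : ℝ, 0 ≤ r → Summable fun n => a n * r ^ n)
    (hξ : ∀ n, HasLaw (ξ n) standardComplexGaussian P) :
    ∀ᵐ ω ∂P, (fun n => ξ n ω) ∈ coeffSpace a := by
  refine ae_all_iff.2 fun m => ae_summable_norm_mul hξ (hsum m m.cast_nonneg) fun n => ?_
  have := ha n
  positivity

lemma indepFun_update_zero (hm : ∀ n, Measurable (ξ n)) (hind : iIndepFun ξ P) :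
    IndepFun (fun ω => Function.update (fun n => ξ n ω) 0 0) (ξ 0) P := by
  have h := indep_iSup_of_disjoint (fun n => (hm n).comap_le) hind
    (S := {0}ᶜ) (T := {0}) disjoint_compl_left
  refine indep_of_indep_of_le_left (indep_of_indep_of_le_right h ?_) ?_
  · simp
  · rw [← measurable_iff_comap_le]
    refine @measurable_pi_lambda _ _ _ (_) _ _ fun n => ?_
    by_cases hn : n = 0
    · subst hn; simp
    · simp only [Function.update_of_ne hn]
      exact (comap_measurable (ξ n)).mono (le_iSup₂_of_le n hn le_rfl) le_rfl

/-- Almost surely all the zeros of the Gaussian Taylor series are simple. -/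
lemma ae_simple_zeros [IsProbabilityMeasure P] (ha : ∀ n, 0 ≤ a n) (ha0 : 0 < a 0)
    (hsum : ∀ r : ℝ, 0 ≤ r → Summable fun n => a n * r ^ n) (hm : ∀ n, Measurable (ξ n))
    (hξ : ∀ n, HasLaw (ξ n) standardComplexGaussian P) (hind : iIndepFun ξ P) :
    ∀ᵐ ω ∂P, ∀ z, taylorSum a (fun n => ξ n ω) z = 0 →
      deriv (taylorSum a fun n => ξ n ω) z ≠ 0 := by
  classical
  -- Replacing bad sequences by 0 makes F entire for every parameter. By Fubini, with the other
  -- coefficients fixed, the values of ξ_0 that create a double zero form a countable set, which the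
  -- atomless Gaussian law does not charge.
  let τ : (ℕ → ℂ) → ℕ → ℂ := fun y => if y ∈ coeffSpace a then y else 0
  have hτ : Measurable τ :=
    Measurable.ite (measurableSet_coeffSpace ha) measurable_id measurable_const
  have hτmem (y : ℕ → ℂ) : τ y ∈ coeffSpace a := by
    simp only [τ]; split_ifs with h
    · exact h
    · exact zero_mem_coeffSpace
  let F : (ℕ → ℂ) × ℂ → ℂ → ℂ := fun p z => p.2 * (a 0 : ℂ) + taylorSum a (τ p.1) z
  have hFd (p) : Differentiable ℂ (F p) :=
    (differentiable_const _).add (differentiable_taylorSum ha (hτmem p.1))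
  have hFm (z) : Measurable fun p => F p z :=
    (measurable_snd.mul_const _).add
      (measurable_taylorSum a (hτ.comp measurable_fst) ha (fun p => hτmem p.1) z)
  have hB := measurableSet_exists_double_zero hFd hFm
  let Y : Ω → ℕ → ℂ := fun ω => Function.update (fun n => ξ n ω) 0 0
  have hY : Measurable Y := by
    refine measurable_pi_iff.2 fun n => ?_
    by_cases hn : n = 0
    · subst hn; simp [Y]
    · simp only [Y, Function.update_of_ne hn]; exact hm n
  have hlaw : P.map (fun ω => (Y ω, ξ 0 ω)) = (P.map Y).prod standardComplexGaussian := by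
    rw [← (hξ 0).map_eq]
    exact (indepFun_iff_map_prod_eq_prod_map_map hY.aemeasurable (hm 0).aemeasurable).1
      (indepFun_update_zero hm hind)
  have hnull : P.map (fun ω => (Y ω, ξ 0 ω)) {p | ∃ z, F p z = 0 ∧ deriv (F p) z = 0} = 0 := by
    rw [hlaw, Measure.measure_prod_null hB]
    refine Eventually.of_forall fun y => ?_
    exact (countable_critical_shift (differentiable_taylorSum ha (hτmem y))
      (Complex.ofReal_ne_zero.2 ha0.ne')).measure_zero _
  rw [Measure.map_apply (hY.prodMk (hm 0)) hB] at hnull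
  have hnull' : ∀ᵐ ω ∂P, ¬ ∃ z, F (Y ω, ξ 0 ω) z = 0 ∧ deriv (F (Y ω, ξ 0 ω)) z = 0 := by
    rw [ae_iff]
    simpa using hnull
  filter_upwards [hnull', ae_mem_coeffSpace ha hsum hξ] with ω h1 h2 z hz hz'
  have hτY : τ (Y ω) = Y ω := if_pos (update_mem_coeffSpace h2)
  have hfun : taylorSum a (fun n => ξ n ω) = F (Y ω, ξ 0 ω) := by
    funext z
    simp only [F, hτY]
    exact taylorSum_eq_add_update ha h2 z
  rw [hfun] at hz hz'
  exact h1 ⟨z, hz, hz'⟩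

/-- A modification of the coefficients on a null set for which everything holds surely. -/
lemma exists_modification [IsProbabilityMeasure P] (ha : ∀ n, 0 ≤ a n) (ha0 : 0 < a 0)
    (hsum : ∀ r : ℝ, 0 ≤ r → Summable fun n => a n * r ^ n)
    (hξ : ∀ n, HasLaw (ξ n) standardComplexGaussian P) (hind : iIndepFun ξ P) :
    ∃ η : ℕ → Ω → ℂ, (∀ n, Measurable (η n)) ∧
      (∀ n, HasLaw (η n) standardComplexGaussian P) ∧ iIndepFun η P ∧
      (∀ᵐ ω ∂P, ∀ n, η n ω = ξ n ω) ∧ (∀ ω, (fun n => η n ω) ∈ coeffSpace a) ∧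
      ∀ ω z, taylorSum a (fun n => η n ω) z = 0 → deriv (taylorSum a fun n => η n ω) z ≠ 0 := by
  classical
  let ξ' : ℕ → Ω → ℂ := fun n => (hξ n).aemeasurable.mk
  have hm (n) : Measurable (ξ' n) := (hξ n).aemeasurable.measurable_mk
  have hae (n) : ξ' n =ᵐ[P] ξ n := (hξ n).aemeasurable.ae_eq_mk.symm
  have hξ' (n) : HasLaw (ξ' n) standardComplexGaussian P := (hξ n).congr (hae n)
  have hind' : iIndepFun ξ' P := hind.congr fun n => (hae n).symm
  have hgood := (ae_mem_coeffSpace ha hsum hξ').and (ae_simple_zeros ha ha0 hsum hm hξ' hind')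
  set p : Ω → Prop := fun ω => (fun n => ξ' n ω) ∈ coeffSpace a ∧
    ∀ z, taylorSum a (fun n => ξ' n ω) z = 0 → deriv (taylorSum a fun n => ξ' n ω) z ≠ 0 with hp
  let N := toMeasurable P {ω | ¬ p ω}
  have hN : MeasurableSet N := measurableSet_toMeasurable _ _
  have hN0 : ∀ᵐ ω ∂P, ω ∉ N := by
    rw [← measure_eq_zero_iff_ae_notMem, measure_toMeasurable]
    exact hgood
  have hNp (ω) (h : ω ∉ N) : p ω := by
    by_contra h'
    exact h (subset_toMeasurable _ _ h')
  -- On the exceptional null set the series becomes the constant a_0 > 0, which has no zeros at all.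
  let e : ℕ → ℂ := fun n => if n = 0 then 1 else 0
  let η : ℕ → Ω → ℂ := fun n ω => if ω ∈ N then e n else ξ' n ω
  have hη (n) : η n =ᵐ[P] ξ' n := by
    filter_upwards [hN0] with ω h
    simp [η, h]
  have he (ω) (h : ω ∈ N) : (fun n => η n ω) = e := by
    funext n; simp [η, h]
  have he' (ω) (h : ω ∉ N) : (fun n => η n ω) = fun n => ξ' n ω := by
    funext n; simp [η, h]
  have het (z) : taylorSum a e z = a 0 := by
    rw [taylorSum, tsum_eq_single 0 fun n hn => by simp [e, hn]]
    simp [e]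
  refine ⟨η, fun n => Measurable.ite hN measurable_const (hm n), fun n => (hξ' n).congr (hη n),
    hind'.congr fun n => (hη n).symm, ?_, fun ω => ?_, fun ω z hz => ?_⟩
  · exact ae_all_iff.2 fun n => (hη n).trans (hae n)
  · by_cases h : ω ∈ N
    · rw [he ω h]
      exact fun m => summable_of_ne_finset_zero (s := {0}) fun n hn => by
        simp [e, Finset.mem_singleton.not.1 hn]
    · rw [he' ω h]; exact (hNp ω h).1
  · by_cases h : ω ∈ N
    · rw [he ω h, het] at hz
      exact absurd hz (Complex.ofReal_ne_zero.2 ha0.ne')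
    · rw [he' ω h] at hz ⊢; exact (hNp ω h).2 z hz

end

/-! ### Decorrelation of the logarithm -/

section

variable {Ω : Type*} [MeasurableSpace Ω] {P : Measure Ω} {ξ : ℕ → Ω → ℂ}

lemma memLp_centredLog_comp {X : Ω → ℂ} (hX : HasLaw X standardComplexGaussian P) :
    MemLp (fun ω => centredLog (X ω)) 2 P := by
  have := memLp_centredLog
  rw [← hX.map_eq] at this
  exact this.comp_of_map hX.aemeasurable

lemma integral_abs_centredLog_mul_le [IsProbabilityMeasure P] {X Y : Ω → ℂ} (hX : HasLaw X standardComplexGaussian P)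
    (hY : HasLaw Y standardComplexGaussian P) :
    ∫ ω, |centredLog (X ω) * centredLog (Y ω)| ∂P ≤
      ∫ x, centredLog x ^ 2 ∂standardComplexGaussian := by
  have h1 := (memLp_centredLog_comp hX).integrable_sq
  have h2 := (memLp_centredLog_comp hY).integrable_sq
  have e1 : ∫ ω, centredLog (X ω) ^ 2 ∂P = ∫ x, centredLog x ^ 2 ∂standardComplexGaussian :=
    hX.integral_comp (f := fun x => centredLog x ^ 2)
      (measurable_centredLog.pow_const 2).aestronglyMeasurable
  have e2 : ∫ ω, centredLog (Y ω) ^ 2 ∂P = ∫ x, centredLog x ^ 2 ∂standardComplexGaussian :=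
    hY.integral_comp (f := fun x => centredLog x ^ 2)
      (measurable_centredLog.pow_const 2).aestronglyMeasurable
  calc ∫ ω, |centredLog (X ω) * centredLog (Y ω)| ∂P
      ≤ ∫ ω, (1 / 2 * centredLog (X ω) ^ 2 + 1 / 2 * centredLog (Y ω) ^ 2) ∂P := by
        refine integral_mono ((memLp_centredLog_comp hX).integrable_mul
          (memLp_centredLog_comp hY)).abs ((h1.const_mul _).add (h2.const_mul _)) fun ω => ?_
        rw [abs_mul]
        nlinarith [sq_nonneg (|centredLog (X ω)| - |centredLog (Y ω)|),
          sq_abs (centredLog (X ω)), sq_abs (centredLog (Y ω))]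
    _ = _ := by
        rw [integral_add (h1.const_mul _) (h2.const_mul _), integral_const_mul,
          integral_const_mul, e1, e2]
        ring

/-- For |ρ| ≤ 1/2, Y = ρX + sE with s = √(1 - |ρ|²) ≥ 1/2 and E a standard Gaussian independent of
X, which is the model case. For |ρ| > 1/2 the trivial bound V ≤ 2V|ρ| suffices; hence the constant C
+ 2V. -/
lemma exists_abs_integral_centredLog_mul_le_of_hasSum : ∃ C : ℝ, 0 ≤ C ∧
    ∀ {Ω : Type*} [MeasurableSpace Ω] (P : Measure Ω) [IsProbabilityMeasure P] (ξ : ℕ → Ω → ℂ)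
      (_ : ∀ n, Measurable (ξ n)) (_ : ∀ n, HasLaw (ξ n) standardComplexGaussian P)
      (_ : iIndepFun ξ P) (c d : ℕ → ℂ) (X Y : Ω → ℂ) (ρ : ℂ)
      (_ : ∀ ω, HasSum (fun n => ξ n ω * c n) (X ω))
      (_ : ∀ ω, HasSum (fun n => ξ n ω * d n) (Y ω))
      (_ : HasSum (fun n => ‖c n‖ ^ 2) 1) (_ : HasSum (fun n => ‖d n‖ ^ 2) 1)
      (_ : HasSum (fun n => starRingEnd ℂ (c n) * d n) ρ),
      |∫ ω, centredLog (X ω) * centredLog (Y ω) ∂P| ≤ C * ‖ρ‖ := by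
  obtain ⟨C, hC0, hC⟩ := exists_abs_integral_centredLog_mul_le
  set V := ∫ x, centredLog x ^ 2 ∂standardComplexGaussian with hV
  have hV0 : 0 ≤ V := integral_nonneg fun x => sq_nonneg _
  refine ⟨C + 2 * V, by positivity, ?_⟩
  intro Ω _ P _ ξ hm hξ hind c d X Y ρ hX hY hc hd hcd
  have lawX := hasLaw_of_hasSum hm hξ hind hX hc
  have lawY := hasLaw_of_hasSum hm hξ hind hY hd
  rcases le_or_gt ‖ρ‖ (1 / 2) with hρ | hρ
  · set s : ℝ := √(1 - ‖ρ‖ ^ 2) with hs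
    have hs2 : s ^ 2 = 1 - ‖ρ‖ ^ 2 := Real.sq_sqrt (by nlinarith [norm_nonneg ρ])
    have hs1 : 1 / 2 ≤ s := Real.le_sqrt_of_sq_le (by nlinarith [norm_nonneg ρ])
    have hs0 : (s : ℂ) ≠ 0 := Complex.ofReal_ne_zero.2 (by linarith)
    let e : ℕ → ℂ := fun n => (d n - ρ * c n) / s
    let E : Ω → ℂ := fun ω => (Y ω - ρ * X ω) / s
    have hE (ω : Ω) : HasSum (fun n => ξ n ω * e n) (E ω) := by
      refine (congrArg (fun f => HasSum f _) (funext fun n => ?_)).mpr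
        (((hY ω).sub ((hX ω).mul_left ρ)).div_const (s : ℂ))
      simp only [e]; ring
    have he : HasSum (fun n => ‖e n‖ ^ 2) 1 := by
      have h := (((hd.add (hc.mul_left (‖ρ‖ ^ 2))).sub
        ((Complex.hasSum_re (hcd.mul_left (starRingEnd ℂ ρ))).mul_left 2))).div_const (s ^ 2)
      have hval : (1 + ‖ρ‖ ^ 2 * 1 - 2 * (starRingEnd ℂ ρ * ρ).re) / s ^ 2 = 1 := by
        rw [mul_comm (starRingEnd ℂ ρ), Complex.mul_conj, Complex.ofReal_re,
          Complex.normSq_eq_norm_sq, div_eq_one_iff_eq (by positivity), hs2]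
        ring
      rw [hval] at h
      refine (congrArg (fun f => HasSum f (1 : ℝ)) (funext fun n => ?_)).mpr h
      simp only [e]
      rw [norm_div, div_pow, Complex.norm_real, Real.norm_eq_abs, sq_abs,
        ← Complex.normSq_eq_norm_sq, Complex.normSq_sub, Complex.normSq_mul]
      simp only [Complex.normSq_eq_norm_sq]
      congr 4
      rw [map_mul]; ring
    have hce : HasSum (fun n => starRingEnd ℂ (c n) * e n) 0 := by
      have hc' : HasSum (fun n => starRingEnd ℂ (c n) * c n) 1 := by
        have := Complex.hasSum_ofReal.2 hc
        rw [Complex.ofReal_one] at this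
        refine (congrArg (fun f => HasSum f (1 : ℂ)) (funext fun n => ?_)).mpr this
        rw [Complex.conj_mul']; push_cast; rfl
      have h := (hcd.sub (hc'.mul_left ρ)).div_const (s : ℂ)
      rw [mul_one, sub_self, zero_div] at h
      refine (congrArg (fun f => HasSum f (0 : ℂ)) (funext fun n => ?_)).mpr h
      simp only [e]; ring
    have hlaw := hasLaw_prod_of_hasSum hm hξ hind hX hE hc he hce
    have hYE (ω : Ω) : Y ω = ρ * X ω + s * E ω := by
      simp only [E]; field_simp; ring
    have key := hlaw.integral_comp
      (f := fun p : ℂ × ℂ => centredLog p.1 * centredLog (ρ * p.1 + s * p.2))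
      (Measurable.aestronglyMeasurable ((measurable_centredLog.comp measurable_fst).mul
        (measurable_centredLog.comp (by fun_prop))))
    have : ∫ ω, centredLog (X ω) * centredLog (Y ω) ∂P = _ := (by
      simp_rw [hYE]; exact key)
    rw [this]
    refine (hC ρ s hs1 (by rw [hs2]; ring)).trans ?_
    nlinarith [norm_nonneg ρ, mul_nonneg hV0 (norm_nonneg ρ)]
  · calc |∫ ω, centredLog (X ω) * centredLog (Y ω) ∂P|
        ≤ ∫ ω, |centredLog (X ω) * centredLog (Y ω)| ∂P := abs_integral_le_integral_abs
      _ ≤ V := integral_abs_centredLog_mul_le lawX lawY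
      _ ≤ (C + 2 * V) * ‖ρ‖ := by nlinarith [mul_nonneg hC0 (norm_nonneg ρ)]

/-- The second moment of an integral of a random field is controlled by its correlations. -/
lemma integral_norm_sq_integral_le [IsProbabilityMeasure P] {β : Type*} [MeasurableSpace β] {ν : Measure β}
    [IsFiniteMeasure ν] {h : Ω → β → ℂ} (hm : Measurable (Function.uncurry h)) {V : ℝ}
    {K : β × β → ℝ} (hint : ∀ p q, Integrable (fun ω => h ω p * starRingEnd ℂ (h ω q)) P)
    (hV : ∀ p q, ∫ ω, ‖h ω p * starRingEnd ℂ (h ω q)‖ ∂P ≤ V)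
    (hK : ∀ p q, ‖∫ ω, h ω p * starRingEnd ℂ (h ω q) ∂P‖ ≤ K (p, q))
    (hKi : Integrable K (ν.prod ν)) :
    Integrable (fun ω => ‖∫ p, h ω p ∂ν‖ ^ 2) P ∧
      ∫ ω, ‖∫ p, h ω p ∂ν‖ ^ 2 ∂P ≤ ∫ x, K x ∂(ν.prod ν) := by
  let H : Ω → β × β → ℂ := fun ω x => h ω x.1 * starRingEnd ℂ (h ω x.2)
  have hHm : Measurable (Function.uncurry H) := by
    have h1 : Measurable fun y : Ω × β × β => h y.1 y.2.1 :=
      hm.comp (measurable_fst.prodMk measurable_snd.fst)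
    have h2 : Measurable fun y : Ω × β × β => h y.1 y.2.2 :=
      hm.comp (measurable_fst.prodMk measurable_snd.snd)
    have h3 : Measurable (starRingEnd ℂ) := by fun_prop
    exact h1.mul (h3.comp h2)
  -- The uniform bound V on the absolute moments, with ν finite, is what licenses Fubini; K is then
  -- used only for the signed correlations.
  have hH : Integrable (Function.uncurry H) (P.prod (ν.prod ν)) := by
    rw [integrable_prod_iff' hHm.aestronglyMeasurable]
    refine ⟨Eventually.of_forall fun x => hint x.1 x.2, ?_⟩
    refine Integrable.of_bound (C := V) ?_ (Eventually.of_forall fun x => ?_)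
    · exact (hHm.norm.stronglyMeasurable.comp_measurable measurable_swap).integral_prod_right'.aestronglyMeasurable
    · rw [Real.norm_of_nonneg (integral_nonneg fun ω => norm_nonneg _)]
      exact hV x.1 x.2
  have hsq (ω : Ω) : ((‖∫ p, h ω p ∂ν‖ ^ 2 : ℝ) : ℂ) = ∫ x, H ω x ∂(ν.prod ν) := by
    simp only [H]
    rw [integral_prod_mul (fun p => h ω p) (fun q => starRingEnd ℂ (h ω q)), integral_conj,
      Complex.mul_conj, Complex.normSq_eq_norm_sq]
  have hI := hH.integral_prod_left
  have hI' : Integrable (fun ω => ‖∫ p, h ω p ∂ν‖ ^ 2) P := by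
    refine hI.norm.congr (Eventually.of_forall fun ω => ?_)
    simp only [Function.uncurry]
    rw [← hsq, Complex.norm_real, Real.norm_of_nonneg (sq_nonneg _)]
  refine ⟨hI', ?_⟩
  have h1 : ((∫ ω, ‖∫ p, h ω p ∂ν‖ ^ 2 ∂P : ℝ) : ℂ) = ∫ x, ∫ ω, H ω x ∂P ∂(ν.prod ν) := by
    rw [← integral_complex_ofReal]
    simp_rw [hsq]
    exact integral_integral_swap hH
  calc ∫ ω, ‖∫ p, h ω p ∂ν‖ ^ 2 ∂P = ‖((∫ ω, ‖∫ p, h ω p ∂ν‖ ^ 2 ∂P : ℝ) : ℂ)‖ := by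
        rw [Complex.norm_real, Real.norm_of_nonneg (integral_nonneg fun ω => sq_nonneg _)]
    _ ≤ ∫ x, ‖∫ ω, H ω x ∂P‖ ∂(ν.prod ν) := by rw [h1]; exact norm_integral_le_integral_norm _
    _ ≤ ∫ x, K x ∂(ν.prod ν) :=
        integral_mono hH.integral_prod_right.norm hKi fun x => hK x.1 x.2

end

/-! ### Fluctuations of the logarithmic moments on circles -/

/-- Measurable coefficients `η_n`, independent standard complex Gaussians, for which the Taylor
series with covariance kernel `exp(exp(z w̄))` converges surely. -/
structure IsDoubleExpSeries {Ω : Type*} [MeasurableSpace Ω] (P : Measure Ω) (a : ℕ → ℝ)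
    (η : ℕ → Ω → ℂ) : Prop where
  kernel : IsKernelSequence a doubleExp
  measurable : ∀ n, Measurable (η n)
  hasLaw : ∀ n, HasLaw (η n) standardComplexGaussian P
  indep : iIndepFun η P
  mem : ∀ ω, (fun n => η n ω) ∈ coeffSpace a

/-- The standard deviation `exp(exp(r²)/2)` of the series on the circle of radius `r`. -/
noncomputable def seriesStd (r : ℝ) : ℝ := Real.exp (Real.exp (r ^ 2) / 2)

/-- The mean of `log |f|` on the circle of radius `r`. -/
noncomputable def seriesLogMean (r : ℝ) : ℝ := Real.exp (r ^ 2) / 2 + gaussianLogMean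

lemma seriesStd_pos (r : ℝ) : 0 < seriesStd r := Real.exp_pos _

lemma seriesStd_sq (r : ℝ) : seriesStd r ^ 2 = Real.exp (Real.exp (r ^ 2)) := by
  rw [seriesStd, ← Real.exp_nat_mul]
  congr 1
  push_cast
  ring

/-- The modulus of the correlation of the values at two points of the circle of radius `r`. -/
noncomputable def circleCorrelation (r t : ℝ) : ℝ :=
  ‖doubleExp (((r ^ 2 : ℝ) : ℂ) * Complex.exp (Complex.I * t))‖ / Real.exp (Real.exp (r ^ 2))

lemma circleCorrelation_nonneg (r t : ℝ) : 0 ≤ circleCorrelation r t := by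
  unfold circleCorrelation; positivity

lemma continuous_circleCorrelation (r : ℝ) : Continuous (circleCorrelation r) := by
  unfold circleCorrelation doubleExp
  fun_prop

lemma circleCorrelation_periodic (r : ℝ) : Function.Periodic (circleCorrelation r) (2 * Real.pi) := by
  intro t
  unfold circleCorrelation
  congr 4
  rw [Complex.ofReal_add, mul_add, Complex.exp_add]
  have : Complex.I * ((2 * Real.pi : ℝ) : ℂ) = 2 * Real.pi * Complex.I := by push_cast; ring
  rw [this, Complex.exp_two_pi_mul_I, mul_one]

lemma circleCorrelation_le_one (r t : ℝ) : circleCorrelation r t ≤ 1 := by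
  unfold circleCorrelation
  rw [div_le_one (Real.exp_pos _), doubleExp, Complex.norm_exp]
  refine Real.exp_le_exp.2 ((Complex.re_le_norm _).trans ?_)
  rw [Complex.norm_exp]
  refine Real.exp_le_exp.2 ((Complex.re_le_norm _).trans ?_)
  rw [norm_mul, Complex.norm_real, Real.norm_of_nonneg (sq_nonneg r), mul_comm Complex.I,
    Complex.norm_exp_ofReal_mul_I, mul_one]

/-- By periodicity the window is moved to [-π, π], where `norm_doubleExp_le` with R = r² bounds the
correlation by a Gaussian of width about e^{-r²/2}. -/
lemma integral_circleCorrelation_le {r : ℝ} (hr : 1 ≤ r) (x : ℝ) :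
    ∫ y in (0)..(2 * Real.pi), circleCorrelation r (y - x) ≤
      √(20 * Real.pi) * Real.exp (-(r ^ 2 / 2)) := by
  have hpi := Real.pi_pos
  have hb : 0 < Real.exp (r ^ 2) / 20 := by positivity
  have h1 : ∫ y in (0)..(2 * Real.pi), circleCorrelation r (y - x) =
      ∫ t in (-Real.pi)..Real.pi, circleCorrelation r t := by
    rw [intervalIntegral.integral_comp_sub_right]
    have := (circleCorrelation_periodic r).intervalIntegral_add_eq (0 - x) (-Real.pi)
    rw [show 0 - x + 2 * Real.pi = 2 * Real.pi - x by ring,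
      show -Real.pi + 2 * Real.pi = Real.pi by ring] at this
    exact this
  rw [h1]
  have hint : Integrable fun t : ℝ => Real.exp (-(Real.exp (r ^ 2) / 20) * t ^ 2) :=
    integrable_exp_neg_mul_sq hb
  calc ∫ t in (-Real.pi)..Real.pi, circleCorrelation r t
      ≤ ∫ t in (-Real.pi)..Real.pi, Real.exp (-(Real.exp (r ^ 2) / 20) * t ^ 2) := by
        refine intervalIntegral.integral_mono_on (by linarith)
          ((continuous_circleCorrelation r).intervalIntegrable _ _)
          hint.intervalIntegrable fun t ht => ?_
        unfold circleCorrelation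
        rw [div_le_iff₀ (Real.exp_pos _)]
        have hr2 : (1 : ℝ) ≤ r ^ 2 := by nlinarith
        refine (norm_doubleExp_le hr2 (abs_le.2 ⟨ht.1, ht.2⟩)).trans (le_of_eq ?_)
        rw [mul_comm]
        congr 2
        ring
    _ ≤ ∫ t : ℝ, Real.exp (-(Real.exp (r ^ 2) / 20) * t ^ 2) := by
        rw [intervalIntegral.integral_of_le (by linarith)]
        exact setIntegral_le_integral hint (Eventually.of_forall fun t => (Real.exp_pos _).le)
    _ = √(20 * Real.pi) * Real.exp (-(r ^ 2 / 2)) := by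
        rw [integral_gaussian]
        have : Real.exp (-(r ^ 2 / 2)) = √(Real.exp (-(r ^ 2))) := by
          rw [Real.exp_half (-(r ^ 2)) |>.symm]
          congr 1; ring
        rw [this, ← Real.sqrt_mul (by positivity), Real.exp_neg]
        congr 1
        field_simp

section

variable {Ω : Type*} [MeasurableSpace Ω] {P : Measure Ω} {η : ℕ → Ω → ℂ}
  {a : ℕ → ℝ}

lemma IsKernelSequence.hasSum_mul_conj (h : IsKernelSequence a doubleExp) (z w : ℂ) :
    HasSum (fun n => starRingEnd ℂ ((a n : ℂ) * z ^ n) * ((a n : ℂ) * w ^ n))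
      (doubleExp (starRingEnd ℂ z * w)) := by
  refine (congrArg (fun f => HasSum f _) (funext fun n => ?_)).mpr (h.2 (starRingEnd ℂ z * w))
  rw [map_mul, map_pow, Complex.conj_ofReal, mul_pow]
  ring

lemma IsDoubleExpSeries.hasSum (h : IsDoubleExpSeries P a η) (ω : Ω) (z : ℂ) :
    HasSum (fun n => η n ω * ((a n : ℂ) * z ^ n)) (taylorSum a (fun n => η n ω) z) := by
  refine (congrArg (fun f => HasSum f _) (funext fun n => ?_)).mpr
    (summable_of_mem_coeffSpace h.kernel.1 (h.mem ω) z).hasSum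
  ring

lemma IsDoubleExpSeries.hasSum_div [IsProbabilityMeasure P] (h : IsDoubleExpSeries P a η) (ω : Ω) (z : ℂ) (s : ℝ) :
    HasSum (fun n => η n ω * ((a n : ℂ) * z ^ n / s)) (taylorSum a (fun n => η n ω) z / s) := by
  refine (congrArg (fun f => HasSum f _) (funext fun n => ?_)).mpr ((h.hasSum ω z).div_const (s : ℂ))
  ring

lemma IsKernelSequence.hasSum_norm_sq (h : IsKernelSequence a doubleExp) {z : ℂ} {r : ℝ}
    (hz : ‖z‖ = r) : HasSum (fun n => ‖(a n : ℂ) * z ^ n / seriesStd r‖ ^ 2) 1 := by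
  have h1 := (h.hasSum_real (r ^ 2)).div_const (seriesStd r ^ 2)
  rw [seriesStd_sq, div_self (Real.exp_pos _).ne'] at h1
  refine (congrArg (fun f => HasSum f (1 : ℝ)) (funext fun n => ?_)).mpr h1
  rw [norm_div, norm_mul, norm_pow, hz, Complex.norm_real, Complex.norm_real, Real.norm_eq_abs,
    Real.norm_eq_abs, div_pow, mul_pow, sq_abs, sq_abs, seriesStd_sq, ← pow_mul, ← pow_mul,
    mul_comm n 2]

lemma IsDoubleExpSeries.hasLaw_div [IsProbabilityMeasure P] (h : IsDoubleExpSeries P a η) {z : ℂ} {r : ℝ} (hz : ‖z‖ = r) :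
    HasLaw (fun ω => taylorSum a (fun n => η n ω) z / (seriesStd r : ℂ))
      standardComplexGaussian P :=
  hasLaw_of_hasSum h.measurable h.hasLaw h.indep (fun ω => h.hasSum_div ω z _)
    (h.kernel.hasSum_norm_sq hz)

lemma IsDoubleExpSeries.log_norm_sub_ae_eq [IsProbabilityMeasure P] (h : IsDoubleExpSeries P a η) {z : ℂ} {r : ℝ}
    (hz : ‖z‖ = r) : ∀ᵐ ω ∂P, Real.log ‖taylorSum a (fun n => η n ω) z‖ - seriesLogMean r =
      centredLog (taylorSum a (fun n => η n ω) z / (seriesStd r : ℂ)) := by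
  have hlaw := h.hasLaw_div hz
  have h0 := ae_ne_zero_standardComplexGaussian
  rw [← hlaw.map_eq] at h0
  filter_upwards [ae_of_ae_map hlaw.aemeasurable h0] with ω hω
  have hf : taylorSum a (fun n => η n ω) z ≠ 0 := fun h => hω (by simp [h])
  rw [centredLog, norm_div, Real.log_div (norm_ne_zero_iff.2 hf)
    (norm_ne_zero_iff.2 (Complex.ofReal_ne_zero.2 (seriesStd_pos r).ne')), Complex.norm_real,
    Real.norm_of_nonneg (seriesStd_pos r).le, seriesStd, Real.log_exp, seriesLogMean]
  ring

lemma conj_circleMap_mul_circleMap (r s t : ℝ) :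
    starRingEnd ℂ (circleMap 0 r s) * circleMap 0 r t =
      ((r ^ 2 : ℝ) : ℂ) * Complex.exp (Complex.I * ((t - s : ℝ) : ℂ)) := by
  simp only [circleMap, zero_add, map_mul, Complex.conj_ofReal, ← Complex.exp_conj, Complex.conj_I]
  rw [show (r : ℂ) * Complex.exp (s * -Complex.I) * (r * Complex.exp (t * Complex.I)) =
    r ^ 2 * (Complex.exp (s * -Complex.I) * Complex.exp (t * Complex.I)) by ring,
    ← Complex.exp_add]
  push_cast
  congr 2
  ring

lemma IsDoubleExpSeries.measurable_uncurry (h : IsDoubleExpSeries P a η) :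
    Measurable fun p : Ω × ℂ => taylorSum a (fun n => η n p.1) p.2 := by
  have := measurable_uncurry_of_continuous_of_measurable
    (u := fun (z : ℂ) (ω : Ω) => taylorSum a (fun n => η n ω) z)
    (fun ω => (differentiable_taylorSum h.kernel.1 (h.mem ω)).continuous)
    (fun z => measurable_taylorSum a (measurable_pi_iff.2 h.measurable) h.kernel.1 h.mem z)
  exact this.comp measurable_swap

/-- The centred logarithmic moment of order `k` on the circle of radius `r`. -/
noncomputable def circleFluctuation (k : ℕ) (f : ℂ → ℂ) (r : ℝ) : ℂ :=
  Real.circleAverage (fun z => z ^ k * (Real.log ‖f z‖ : ℂ)) 0 r -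
    seriesLogMean r * Real.circleAverage (fun z => z ^ k) 0 r

lemma circleFluctuation_eq {f : ℂ → ℂ} (hf : Differentiable ℂ f) (k : ℕ) (r : ℝ) :
    circleFluctuation k f r = (2 * Real.pi)⁻¹ • ∫ θ in Set.Ioc 0 (2 * Real.pi),
      circleMap 0 r θ ^ k * ((Real.log ‖f (circleMap 0 r θ)‖ - seriesLogMean r : ℝ) : ℂ) := by
  have h1 := circleIntegrable_pow_mul_log_norm hf k r
  have h2 : IntervalIntegrable (fun θ => circleMap 0 r θ ^ k) volume 0 (2 * Real.pi) :=
    ((continuous_circleMap 0 r).pow k).intervalIntegrable _ _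
  rw [circleFluctuation, Real.circleAverage, Real.circleAverage,
    ← intervalIntegral.integral_of_le (by positivity), mul_smul_comm, ← smul_sub,
    ← intervalIntegral.integral_const_mul, ← intervalIntegral.integral_sub h1 (h2.const_mul _)]
  congr 1
  refine intervalIntegral.integral_congr fun θ _ => ?_
  simp only
  push_cast
  ring

/-- The second moment is a double integral over the circle of covariances of centred logarithms.
Each is at most a constant times the correlation, whose integral in one angle is O(e^{-r²/2}). -/
lemma IsDoubleExpSeries.exists_integral_norm_sq_circleFluctuation_le [IsProbabilityMeasure P]
    (h : IsDoubleExpSeries P a η) (k : ℕ) : ∃ C : ℝ, ∀ r : ℝ, 1 ≤ r →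
      Integrable (fun ω => ‖circleFluctuation k (taylorSum a fun n => η n ω) r‖ ^ 2) P ∧
      ∫ ω, ‖circleFluctuation k (taylorSum a fun n => η n ω) r‖ ^ 2 ∂P ≤
        C * (r ^ (2 * k) * Real.exp (-(r ^ 2 / 2))) := by
  obtain ⟨C, hC0, hC⟩ := exists_abs_integral_centredLog_mul_le_of_hasSum
  have hpi := Real.pi_pos
  refine ⟨(2 * Real.pi)⁻¹ ^ 2 * (C * (2 * Real.pi * √(20 * Real.pi))), fun r hr => ?_⟩
  set V := ∫ x, centredLog x ^ 2 ∂standardComplexGaussian with hV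
  set f : Ω → ℂ → ℂ := fun ω => taylorSum a fun n => η n ω with hf
  set ν : Measure ℝ := volume.restrict (Set.Ioc 0 (2 * Real.pi)) with hν
  let l : Ω → ℝ → ℝ := fun ω θ => Real.log ‖f ω (circleMap 0 r θ)‖ - seriesLogMean r
  let H : Ω → ℝ → ℂ := fun ω θ => circleMap 0 r θ ^ k * (l ω θ : ℂ)
  have hr0 : 0 ≤ r := by linarith
  have hz (θ : ℝ) : ‖circleMap 0 r θ‖ = r := by rw [norm_circleMap_zero, abs_of_nonneg hr0]
  have hl (θ : ℝ) := h.log_norm_sub_ae_eq (hz θ)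
  have hlaw (θ : ℝ) := h.hasLaw_div (hz θ)
  have hHH (p q : ℝ) (ω : Ω) : H ω p * starRingEnd ℂ (H ω q) =
      (circleMap 0 r p ^ k * starRingEnd ℂ (circleMap 0 r q ^ k)) * ((l ω p * l ω q : ℝ) : ℂ) := by
    simp only [H, map_mul, Complex.conj_ofReal]
    push_cast
    ring
  have hnorm (p q : ℝ) : ‖circleMap 0 r p ^ k * starRingEnd ℂ (circleMap 0 r q ^ k)‖ =
      r ^ (2 * k) := by
    rw [norm_mul, RCLike.norm_conj, norm_pow, norm_pow, hz, hz, ← pow_add]; congr 1; ring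
  have hll (p q : ℝ) : (fun ω => l ω p * l ω q) =ᵐ[P] fun ω =>
      centredLog (f ω (circleMap 0 r p) / (seriesStd r : ℂ)) *
        centredLog (f ω (circleMap 0 r q) / (seriesStd r : ℂ)) := by
    filter_upwards [hl p, hl q] with ω h1 h2
    simp only [l]
    rw [h1, h2]
  have hlli (p q : ℝ) : Integrable (fun ω => l ω p * l ω q) P :=
    ((memLp_centredLog_comp (hlaw p)).integrable_mul (memLp_centredLog_comp (hlaw q))).congr
      (hll p q).symm
  have hHm : Measurable (Function.uncurry H) := by
    have h1 : Measurable fun x : Ω × ℝ => f x.1 (circleMap 0 r x.2) :=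
      h.measurable_uncurry.comp (measurable_fst.prodMk
        ((continuous_circleMap 0 r).measurable.comp measurable_snd))
    have h2 : Measurable fun x : Ω × ℝ => l x.1 x.2 :=
      (Real.measurable_log.comp h1.norm).sub_const _
    have h3 : Measurable fun x : Ω × ℝ => circleMap 0 r x.2 ^ k :=
      ((continuous_circleMap 0 r).measurable.comp measurable_snd).pow_const k
    exact h3.mul (Complex.measurable_ofReal.comp h2)
  have key := integral_norm_sq_integral_le (P := P) (ν := ν) (h := H) hHm (V := r ^ (2 * k) * V)
    (K := fun x => r ^ (2 * k) * (C * circleCorrelation r (x.2 - x.1)))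
    (fun p q => by
      simp_rw [hHH]
      exact (hlli p q).ofReal.const_mul _)
    (fun p q => by
      simp_rw [hHH, norm_mul _ ((_ : ℝ) : ℂ), hnorm, Complex.norm_real]
      rw [integral_const_mul]
      refine mul_le_mul_of_nonneg_left ?_ (by positivity)
      refine le_trans (le_of_eq ?_) (integral_abs_centredLog_mul_le (hlaw p) (hlaw q))
      refine integral_congr_ae ?_
      filter_upwards [hll p q] with ω hω
      rw [Real.norm_eq_abs, hω])
    (fun p q => by
      simp_rw [hHH]
      rw [integral_const_mul, norm_mul, hnorm, integral_complex_ofReal, Complex.norm_real,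
        Real.norm_eq_abs, integral_congr_ae (hll p q)]
      refine mul_le_mul_of_nonneg_left ?_ (by positivity)
      -- After normalisation the correlation coefficient is G(z̄w)/G(r²), with modulus
      -- `circleCorrelation r (q - p)`.
      have h1 := (h.kernel.hasSum_mul_conj (circleMap 0 r p) (circleMap 0 r q)).div_const
        ((seriesStd r : ℂ) ^ 2)
      have h2 := hC P η h.measurable h.hasLaw h.indep
        (fun n => (a n : ℂ) * circleMap 0 r p ^ n / seriesStd r)
        (fun n => (a n : ℂ) * circleMap 0 r q ^ n / seriesStd r) _ _ _
        (fun ω => h.hasSum_div ω _ _) (fun ω => h.hasSum_div ω _ _)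
        (h.kernel.hasSum_norm_sq (hz p)) (h.kernel.hasSum_norm_sq (hz q))
        ((congrArg (fun f => HasSum f _) (funext fun n => by
          rw [map_div₀, Complex.conj_ofReal]; ring)).mpr h1)
      refine h2.trans (le_of_eq ?_)
      rw [conj_circleMap_mul_circleMap, norm_div, norm_pow, Complex.norm_real,
        Real.norm_of_nonneg (seriesStd_pos r).le, seriesStd_sq, circleCorrelation])
    (by
      refine Integrable.const_mul (Integrable.const_mul ?_ _) _
      refine Integrable.of_bound (C := 1) ?_ (Eventually.of_forall fun x => ?_)
      · exact ((continuous_circleCorrelation r).comp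
          (continuous_snd.sub continuous_fst)).aestronglyMeasurable
      · rw [Real.norm_of_nonneg (circleCorrelation_nonneg _ _)]
        exact circleCorrelation_le_one _ _)
  have heq (ω : Ω) : ‖circleFluctuation k (f ω) r‖ ^ 2 =
      (2 * Real.pi)⁻¹ ^ 2 * ‖∫ θ, H ω θ ∂ν‖ ^ 2 := by
    rw [circleFluctuation_eq (differentiable_taylorSum h.kernel.1 (h.mem ω)), norm_smul,
      Real.norm_of_nonneg (by positivity), mul_pow]
  have hci : Integrable (fun x : ℝ × ℝ => circleCorrelation r (x.2 - x.1)) (ν.prod ν) := by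
    refine Integrable.of_bound (C := 1) ?_ (Eventually.of_forall fun x => ?_)
    · exact ((continuous_circleCorrelation r).comp
        (continuous_snd.sub continuous_fst)).aestronglyMeasurable
    · rw [Real.norm_of_nonneg (circleCorrelation_nonneg _ _)]
      exact circleCorrelation_le_one _ _
  have hcor : ∫ x : ℝ × ℝ, circleCorrelation r (x.2 - x.1) ∂(ν.prod ν) ≤
      2 * Real.pi * (√(20 * Real.pi) * Real.exp (-(r ^ 2 / 2))) := by
    rw [integral_prod _ hci]
    calc ∫ x, ∫ y, circleCorrelation r (y - x) ∂ν ∂ν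
        ≤ ∫ x, √(20 * Real.pi) * Real.exp (-(r ^ 2 / 2)) ∂ν := by
          refine integral_mono hci.integral_prod_left (integrable_const _) fun x => ?_
          simp only [hν]
          rw [← intervalIntegral.integral_of_le (by positivity)]
          exact integral_circleCorrelation_le hr x
      _ = _ := by
          rw [integral_const, smul_eq_mul]
          simp only [hν, Measure.real, Measure.restrict_apply_univ, Real.volume_Ioc, sub_zero]
          rw [ENNReal.toReal_ofReal (by positivity)]
  change Integrable (fun ω => ‖circleFluctuation k (f ω) r‖ ^ 2) P ∧
    ∫ ω, ‖circleFluctuation k (f ω) r‖ ^ 2 ∂P ≤ _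
  simp_rw [heq]
  refine ⟨key.1.const_mul _, ?_⟩
  rw [integral_const_mul, mul_assoc]
  refine mul_le_mul_of_nonneg_left (key.2.trans ?_) (by positivity)
  rw [integral_const_mul, integral_const_mul]
  calc r ^ (2 * k) * (C * ∫ x : ℝ × ℝ, circleCorrelation r (x.2 - x.1) ∂(ν.prod ν))
      ≤ r ^ (2 * k) * (C * (2 * Real.pi * (√(20 * Real.pi) * Real.exp (-(r ^ 2 / 2))))) := by
        gcongr
    _ = _ := by ring

lemma ae_tendsto_zero_of_summable_integral {g : ℕ → Ω → ℝ} (h0 : ∀ n ω, 0 ≤ g n ω)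
    (hi : ∀ n, Integrable (g n) P) (hs : Summable fun n => ∫ ω, g n ω ∂P) :
    ∀ᵐ ω ∂P, Tendsto (fun n => g n ω) atTop (𝓝 0) := by
  have hsum : ∫⁻ ω, ∑' n, ENNReal.ofReal (g n ω) ∂P ≠ ⊤ := by
    rw [lintegral_tsum fun n => (hi n).aemeasurable.ennreal_ofReal]
    have (n : ℕ) : ∫⁻ ω, ENNReal.ofReal (g n ω) ∂P = ENNReal.ofReal (∫ ω, g n ω ∂P) :=
      (ofReal_integral_eq_lintegral_ofReal (hi n) (Eventually.of_forall (h0 n))).symm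
    simp_rw [this]
    exact hs.tsum_ofReal_ne_top
  filter_upwards [ae_lt_top' (AEMeasurable.tsum fun n => (hi n).aemeasurable.ennreal_ofReal)
    hsum] with ω hω
  have := (ENNReal.summable_toReal hω.ne).tendsto_atTop_zero
  exact this.congr fun n => ENNReal.toReal_ofReal (h0 n ω)

lemma IsDoubleExpSeries.ae_tendsto_circleFluctuation [IsProbabilityMeasure P] (h : IsDoubleExpSeries P a η) (k : ℕ) :
    ∀ᵐ ω ∂P, Tendsto (fun n : ℕ => circleFluctuation k (taylorSum a fun n => η n ω) n) atTop
      (𝓝 0) := by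
  obtain ⟨C, hC⟩ := h.exists_integral_norm_sq_circleFluctuation_le k
  have h1 (n : ℕ) : (1 : ℝ) ≤ ((n + 1 : ℕ) : ℝ) := by
    exact_mod_cast Nat.le_add_left 1 n
  -- Integer radii n ≥ 1 satisfy n² ≥ n, so e^{-n²/2} is replaced by e^{-n/2}, which beats n^{2k}
  -- for every k.
  have hb : Summable fun n : ℕ => |C| * ((n : ℝ) ^ (2 * k) * Real.exp (-(1 / 2) * n)) :=
    (Real.summable_pow_mul_exp_neg_nat_mul (2 * k) (by norm_num : (0 : ℝ) < 1 / 2)).mul_left _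
  have hs : Summable fun n : ℕ =>
      ∫ ω, ‖circleFluctuation k (taylorSum a fun n => η n ω) ((n + 1 : ℕ) : ℝ)‖ ^ 2 ∂P := by
    refine Summable.of_nonneg_of_le (fun n => integral_nonneg fun ω => sq_nonneg _) (fun n => ?_)
      ((summable_nat_add_iff 1).2 hb)
    refine (hC _ (h1 n)).2.trans ?_
    have h2 := h1 n
    refine mul_le_mul (le_abs_self C) (mul_le_mul_of_nonneg_left (Real.exp_le_exp.2 ?_)
      (by positivity)) (by positivity) (abs_nonneg C)
    nlinarith
  filter_upwards [ae_tendsto_zero_of_summable_integral (fun n ω => sq_nonneg _)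
    (fun n => (hC _ (h1 n)).1) hs] with ω hω
  have h3 := hω.sqrt
  simp only [Real.sqrt_zero, Real.sqrt_sq (norm_nonneg _)] at h3
  have h4 := tendsto_zero_iff_norm_tendsto_zero.2 h3
  exact (tendsto_add_atTop_iff_nat
    (f := fun n : ℕ => circleFluctuation k (taylorSum a fun n => η n ω) n) 1).1 h4

end

/-! ### Full rigidity -/

/-- The increment of the radial logarithm from `r` to `2 r`, multiplied by `r^(2k)`. -/
noncomputable def radialGap (k : ℕ) : ℝ :=
  if k = 0 then Real.log 2 else (1 - ((4 : ℝ) ^ k)⁻¹) / (2 * k)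

lemma radialGap_pos (k : ℕ) : 0 < radialGap k := by
  unfold radialGap
  split_ifs with hk
  · exact Real.log_pos one_lt_two
  · have h1 : (1 : ℝ) < 4 ^ k := one_lt_pow₀ (by norm_num) hk
    have h2 := inv_lt_one_of_one_lt₀ h1
    have h3 : (0 : ℝ) < k := by exact_mod_cast Nat.pos_of_ne_zero hk
    exact div_pos (by linarith) (by linarith)

lemma radialLog_two_mul_sub {r : ℝ} (hr : 0 < r) (k : ℕ) :
    (radialLog k (2 * r) - radialLog k r) * r ^ (2 * k) = radialGap k := by
  unfold radialLog radialGap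
  split_ifs with hk
  · subst hk
    rw [Real.log_mul two_ne_zero hr.ne']
    simp
  · have h3 : (k : ℝ) ≠ 0 := by exact_mod_cast hk
    have h4 : (2 : ℝ) ^ (2 * k) = 4 ^ k := by rw [pow_mul]; norm_num
    rw [mul_pow, h4]
    field_simp
    ring

/-- A compactly supported function that equals `z^k` on the disc of radius `r`. -/
noncomputable def momentCutoff (k : ℕ) (r : ℝ) (z : ℂ) : ℂ :=
  z ^ k * (((radialLog k (max (2 * r) ‖z‖) - radialLog k (max r ‖z‖)) * r ^ (2 * k) /
    radialGap k : ℝ) : ℂ)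

lemma momentCutoff_of_le {r : ℝ} (hr : 0 < r) (k : ℕ) {z : ℂ} (hz : ‖z‖ ≤ r) :
    momentCutoff k r z = z ^ k := by
  rw [momentCutoff, max_eq_left hz, max_eq_left (by linarith), radialLog_two_mul_sub hr,
    div_self (radialGap_pos k).ne', Complex.ofReal_one, mul_one]

lemma momentCutoff_of_ge {r : ℝ} (hr : 0 < r) (k : ℕ) {z : ℂ} (hz : 2 * r ≤ ‖z‖) :
    momentCutoff k r z = 0 := by
  rw [momentCutoff, max_eq_right hz, max_eq_right (by linarith)]
  simp

lemma measurable_radialLog (k : ℕ) : Measurable (radialLog k) := by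
  unfold radialLog
  split_ifs
  · exact Real.measurable_log
  · fun_prop

lemma measurable_momentCutoff (k : ℕ) (r : ℝ) : Measurable (momentCutoff k r) := by
  unfold momentCutoff
  have h1 (s : ℝ) : Measurable fun z : ℂ => radialLog k (max s ‖z‖) :=
    (measurable_radialLog k).comp (by fun_prop)
  exact (measurable_id.pow_const k).mul (Complex.measurable_ofReal.comp
    ((((h1 _).sub (h1 _)).mul_const _).div_const _))

/-- The deterministic approximation of the smoothed `k`-th moment of the zeros. -/
noncomputable def momentMean (k : ℕ) (r : ℝ) : ℂ :=
  ((r ^ (2 * k) / radialGap k : ℝ) : ℂ) *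
    ((((2 * r : ℝ) : ℂ) ^ (2 * k))⁻¹ *
      (seriesLogMean (2 * r) * Real.circleAverage (fun z => z ^ k) 0 (2 * r)) -
    ((r : ℂ) ^ (2 * k))⁻¹ * (seriesLogMean r * Real.circleAverage (fun z => z ^ k) 0 r))

/-- This is the weighted Jensen identity for the radii r and 2r, scaled by r^{2k} / `radialGap k`.
Subtracting `momentMean` turns the two circle averages into fluctuations; the factor 4^{-k} is
r^{2k}/(2r)^{2k}. -/
lemma finsum_momentCutoff_sub_momentMean {f : ℂ → ℂ} (hf : Differentiable ℂ f)
    (hsimple : ∀ z, f z = 0 → deriv f z ≠ 0) (hZ : IsLocallyFiniteSet {z | f z = 0}) {r : ℝ}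
    (hr : 0 < r) (k : ℕ) :
    ∑ᶠ z ∈ {z | f z = 0}, momentCutoff k r z - momentMean k r =
      ((radialGap k : ℝ) : ℂ)⁻¹ * (((4 : ℂ) ^ k)⁻¹ * circleFluctuation k f (2 * r) -
        circleFluctuation k f r) := by
  have hgap : ((radialGap k : ℝ) : ℂ) ≠ 0 := Complex.ofReal_ne_zero.2 (radialGap_pos k).ne'
  have hr0 : (r : ℂ) ≠ 0 := Complex.ofReal_ne_zero.2 hr.ne'
  rw [finsum_mem_eq_sum_ball hZ (R := 2 * r + 1)
    fun z hz => momentCutoff_of_ge hr k (by linarith)]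
  set s := (hZ.finite_inter_of_isBounded
    (Metric.isBounded_ball (x := (0 : ℂ)) (r := 2 * r + 1))).toFinset with hs
  have key := sum_pow_mul_radialLog_sub hf hsimple (s := s) (R := 2 * r + 1) hr
    (by linarith : 0 < 2 * r) (by linarith) (by linarith) (fun z => by simp [hs]) k
  have h1 : ∑ z ∈ s, momentCutoff k r z = ((r ^ (2 * k) / radialGap k : ℝ) : ℂ) *
      ∑ z ∈ s, z ^ k * ((radialLog k (max (2 * r) ‖z‖) : ℂ) - radialLog k (max r ‖z‖)) := by
    rw [Finset.mul_sum]
    refine Finset.sum_congr rfl fun z _ => ?_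
    rw [momentCutoff]
    push_cast
    ring
  rw [h1, key, momentMean, circleFluctuation, circleFluctuation]
  have h4 : (2 : ℂ) ^ (2 * k) = 4 ^ k := by rw [pow_mul]; norm_num
  push_cast
  rw [mul_pow, h4]
  field_simp
  ring

lemma finsum_mem_pow_eq {Z D : Set ℂ} (hZ : IsLocallyFiniteSet Z) {r : ℝ} (hr : 0 < r)
    (hD : D ⊆ Metric.ball 0 r) (k : ℕ) :
    ∑ᶠ z ∈ D ∩ Z, z ^ k =
      ∑ᶠ z ∈ Z, momentCutoff k r z - ∑ᶠ z ∈ Z ∩ Dᶜ, momentCutoff k r z := by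
  have hfin : (Z ∩ Function.support (momentCutoff k r)).Finite := by
    refine (hZ.finite_inter_of_isBounded
      (Metric.isBounded_ball (x := (0 : ℂ)) (r := 2 * r))).subset fun z hz => ⟨hz.1, ?_⟩
    rw [mem_ball_zero_iff]
    exact not_le.1 fun h => hz.2 (momentCutoff_of_ge hr k h)
  have h1 := finsum_mem_inter_add_sdiff' D hfin
  rw [← h1, Set.inter_comm Z D, Set.sdiff_eq, add_sub_cancel_right]
  refine finsum_mem_congr rfl fun z hz => (momentCutoff_of_le hr k ?_).symm
  exact (mem_ball_zero_iff.1 (hD hz.1)).le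

/-- The measurable functional that recovers the `k`-th moment of the zeros in `D`. -/
noncomputable def momentFunctional (D : Set ℂ) (k : ℕ) (W : PointConfig Dᶜ) : ℂ :=
  limUnder atTop fun n : ℕ => momentMean k n - ∑ᶠ z ∈ W.1, momentCutoff k n z

lemma measurable_momentFunctional (D : Set ℂ) (k : ℕ) : Measurable (momentFunctional D k) := by
  refine (StronglyMeasurable.limUnder fun n : ℕ => ?_).measurable
  refine Measurable.stronglyMeasurable (measurable_const.sub ?_)
  rcases Nat.eq_zero_or_pos n with rfl | hn
  -- At n = 0 the two radii 0 and 2·0 coincide, so the cutoff vanishes identically although the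
  -- support lemma does not apply.
  · have (z : ℂ) : momentCutoff k ((0 : ℕ) : ℝ) z = 0 := by
      have := norm_nonneg z
      simp [momentCutoff]
    simp only [this, finsum_zero, measurable_const]
  · have hn' : (0 : ℝ) < n := by exact_mod_cast hn
    exact measurable_finsum_pointConfig _ (measurable_momentCutoff k n)
      fun z hz => momentCutoff_of_ge hn' k hz

/-- Once the disc of radius n contains D, the n-th approximant differs from the true moment exactly
by a combination of the fluctuations at radii n and 2n, which tend to 0. -/
lemma momentFunctional_eq {f : ℂ → ℂ} (hf : Differentiable ℂ f)
    (hsimple : ∀ z, f z = 0 → deriv f z ≠ 0) (hZ : IsLocallyFiniteSet {z | f z = 0}) {k : ℕ}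
    (hfl : Tendsto (fun n : ℕ => circleFluctuation k f n) atTop (𝓝 0)) {D : Set ℂ}
    (hD : Bornology.IsBounded D) (W : PointConfig Dᶜ) (hW : W.1 = {z | f z = 0} ∩ Dᶜ) :
    ∑ᶠ z ∈ D ∩ {z | f z = 0}, z ^ k = momentFunctional D k W := by
  refine (Tendsto.limUnder_eq ?_).symm
  have h2 : Tendsto (fun n : ℕ => circleFluctuation k f (2 * (n : ℝ))) atTop (𝓝 0) := by
    have := hfl.comp (tendsto_id.const_mul_atTop' (by norm_num : 0 < 2))
    refine this.congr fun n => ?_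
    simp
  have h3 : Tendsto (fun n : ℕ => ∑ᶠ z ∈ D ∩ {z | f z = 0}, z ^ k -
      ((radialGap k : ℝ) : ℂ)⁻¹ * (((4 : ℂ) ^ k)⁻¹ * circleFluctuation k f (2 * (n : ℝ)) -
        circleFluctuation k f n)) atTop (𝓝 (∑ᶠ z ∈ D ∩ {z | f z = 0}, z ^ k)) := by
    have := (((h2.const_mul (((4 : ℂ) ^ k)⁻¹)).sub hfl).const_mul
      (((radialGap k : ℝ) : ℂ)⁻¹)).const_sub (∑ᶠ z ∈ D ∩ {z | f z = 0}, z ^ k)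
    simpa using this
  refine h3.congr' ?_
  obtain ⟨R, hR⟩ := hD.subset_ball 0
  obtain ⟨N, hN⟩ := exists_nat_ge R
  filter_upwards [eventually_ge_atTop (N + 1)] with n hn
  have hn' : R ≤ n := hN.trans (by exact_mod_cast (Nat.le_succ N).trans hn)
  have hn0 : (0 : ℝ) < n := by exact_mod_cast (Nat.succ_pos N).trans_le hn
  rw [← finsum_momentCutoff_sub_momentMean hf hsimple hZ hn0 k,
    finsum_mem_pow_eq hZ hn0 (hR.trans (Metric.ball_subset_ball hn')) k, hW]
  ring

section

variable {Ω : Type*} [MeasurableSpace Ω] {P : Measure Ω} {η : ℕ → Ω → ℂ}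
  {a : ℕ → ℝ}

theorem IsDoubleExpSeries.isFullyRigid [IsProbabilityMeasure P] (h : IsDoubleExpSeries P a η)
    (hsimple : ∀ ω z, taylorSum a (fun n => η n ω) z = 0 →
      deriv (taylorSum a fun n => η n ω) z ≠ 0)
    {Z : Ω → Set ℂ} (hZ : ∀ᵐ ω ∂P, Z ω = {z | taylorSum a (fun n => η n ω) z = 0}) :
    IsFullyRigid P Z := by
  have hd (ω : Ω) : Differentiable ℂ (taylorSum a fun n => η n ω) :=
    differentiable_taylorSum h.kernel.1 (h.mem ω)
  have hlf (ω : Ω) : IsLocallyFiniteSet {z | taylorSum a (fun n => η n ω) z = 0} := by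
    by_cases h0 : taylorSum a (fun n => η n ω) 0 = 0
    -- Local finiteness fails only for f identically zero, which simplicity of the zero at 0
    -- excludes.
    · by_contra hcon
      have hzero : ∀ x, taylorSum a (fun n => η n ω) x = 0 := fun x => by
        by_contra hx
        exact hcon (isLocallyFiniteSet_zeros (hd ω) hx)
      refine hsimple ω 0 h0 ?_
      rw [show taylorSum a (fun n => η n ω) = fun _ => 0 from funext hzero, deriv_const]
    · exact isLocallyFiniteSet_zeros (hd ω) h0
  refine ⟨⟨fun ω => PointConfig.ofSet _ (hlf ω), measurable_zeros_pointConfig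
    (fun ω => (hd ω).continuous) (fun z => measurable_taylorSum a (measurable_pi_iff.2 h.measurable)
      h.kernel.1 h.mem z) hlf, hZ.mono fun ω hω => hω.symm⟩, fun D _ hD k _ =>
    ⟨momentFunctional D k, measurable_momentFunctional D k, ?_⟩⟩
  filter_upwards [hZ, h.ae_tendsto_circleFluctuation k] with ω hω hfl
  rw [hω]
  refine ⟨⟨Set.inter_subset_right, (hlf ω).mono Set.inter_subset_left⟩, ?_, ?_⟩
  · rw [Set.inter_comm]
    exact (hlf ω).finite_inter_of_isBounded hD
  · exact momentFunctional_eq (hd ω) (hsimple ω) (hlf ω) hfl hD _ rfl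

lemma IsDoubleExpSeries.memLp_taylorSum [IsProbabilityMeasure P] (h : IsDoubleExpSeries P a η) (z : ℂ) :
    MemLp (fun ω => taylorSum a (fun n => η n ω) z) 2 P := by
  have h1 := (memLp_two_of_hasLaw (h.hasLaw_div (z := z) rfl)).const_mul (seriesStd ‖z‖ : ℂ)
  refine h1.congr_norm ?_ (Eventually.of_forall fun ω => ?_)
  · exact (measurable_taylorSum a (measurable_pi_iff.2 h.measurable)
      h.kernel.1 h.mem z).aestronglyMeasurable
  · rw [mul_div_cancel₀ _ (Complex.ofReal_ne_zero.2 (seriesStd_pos _).ne')]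

lemma IsDoubleExpSeries.integrable_mul_conj [IsProbabilityMeasure P] (h : IsDoubleExpSeries P a η) (z w : ℂ) :
    Integrable (fun ω => taylorSum a (fun n => η n ω) z *
      starRingEnd ℂ (taylorSum a (fun n => η n ω) w)) P :=
  (h.memLp_taylorSum z).integrable_mul (h.memLp_taylorSum w).star

lemma IsDoubleExpSeries.integral_mul_conj [IsProbabilityMeasure P] (h : IsDoubleExpSeries P a η) (z w : ℂ) :
    ∫ ω, taylorSum a (fun n => η n ω) z * starRingEnd ℂ (taylorSum a (fun n => η n ω) w) ∂P =
      doubleExp (z * starRingEnd ℂ w) := by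
  have hs (z : ℂ) : Summable fun n => ‖(a n : ℂ) * z ^ n‖ := by
    refine (h.kernel.summable (norm_nonneg z)).congr fun n => ?_
    rw [norm_mul, norm_pow, Complex.norm_real, Real.norm_of_nonneg (h.kernel.1 n)]
  rw [integral_mul_conj_of_hasSum h.hasLaw h.indep (hs z) (hs w)
    (Eventually.of_forall fun ω => h.hasSum ω z) (Eventually.of_forall fun ω => h.hasSum ω w),
    ← (h.kernel.2 _).tsum_eq]
  refine tsum_congr fun n => ?_
  rw [map_mul, map_pow, Complex.conj_ofReal, mul_pow]
  ring

end

theorem mainTheorem2 :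
    IsAdmissible doubleExp ∧
    (∀ r : ℝ, 0 ≤ r → haymanA doubleExp r = r * Real.exp r) ∧
    (∀ r : ℝ, 0 ≤ r → haymanB doubleExp r = r * (r + 1) * Real.exp r) ∧
    HasInfiniteOrder doubleExp ∧
    Tendsto (fun r : ℝ => Real.log (haymanB doubleExp r) / Real.log r) atTop atTop ∧
    (∃! a : ℕ → ℝ, IsKernelSequence a doubleExp) ∧
    ∀ (a : ℕ → ℝ), IsKernelSequence a doubleExp →
      ∀ (Ω : Type*) [MeasurableSpace Ω] (P : Measure Ω) [IsProbabilityMeasure P]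
        (ξ : ℕ → Ω → ℂ), (∀ n, HasLaw (ξ n) standardComplexGaussian P) → iIndepFun ξ P →
        (∀ᵐ ω ∂P, (∀ z : ℂ, Summable (fun n => ξ n ω * (a n : ℂ) * z ^ n)) ∧
          Differentiable ℂ (gaussianTaylorSeries a ξ ω)) ∧
        (∀ z w : ℂ,
          Integrable (fun ω => gaussianTaylorSeries a ξ ω z *
            (starRingEnd ℂ) (gaussianTaylorSeries a ξ ω w)) P ∧
          ∫ ω, gaussianTaylorSeries a ξ ω z *
            (starRingEnd ℂ) (gaussianTaylorSeries a ξ ω w) ∂P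
              = doubleExp (z * (starRingEnd ℂ) w)) ∧
        IsFullyRigid P (zeroSet (gaussianTaylorSeries a ξ)) := by
  refine ⟨isAdmissible_doubleExp, fun r _ => haymanA_doubleExp r, fun r _ => haymanB_doubleExp r,
    hasInfiniteOrder_doubleExp, tendsto_log_haymanB_doubleExp_div_log,
    existsUnique_isKernelSequence_doubleExp, fun a ha Ω _ P _ ξ hξ hind => ?_⟩
  -- Convergence, measurability and simple zeros hold surely for η, and every conclusion about ξ is
  -- insensitive to null sets.
  obtain ⟨η, hm, hη, hindη, hae, hmem, hsimple⟩ :=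
    exists_modification ha.1 ha.zero_pos (fun r hr => ha.summable hr) hξ hind
  have h : IsDoubleExpSeries P a η := ⟨ha, hm, hη, hindη, hmem⟩
  have hf : ∀ᵐ ω ∂P, gaussianTaylorSeries a ξ ω = taylorSum a fun n => η n ω := by
    filter_upwards [hae] with ω hω
    simp only [hω]
    rfl
  have hcov (z w : ℂ) : (fun ω => taylorSum a (fun n => η n ω) z *
      starRingEnd ℂ (taylorSum a (fun n => η n ω) w)) =ᵐ[P]
      fun ω => gaussianTaylorSeries a ξ ω z *
        starRingEnd ℂ (gaussianTaylorSeries a ξ ω w) := by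
    filter_upwards [hf] with ω hω
    rw [hω]
  refine ⟨?_, fun z w => ⟨(h.integrable_mul_conj z w).congr (hcov z w), ?_⟩, ?_⟩
  · filter_upwards [ae_mem_coeffSpace ha.1 (fun r hr => ha.summable hr) hξ] with ω hω
    exact ⟨summable_of_mem_coeffSpace ha.1 hω, differentiable_taylorSum ha.1 hω⟩
  · rw [← integral_congr_ae (hcov z w), h.integral_mul_conj]
  · refine h.isFullyRigid hsimple ?_
    filter_upwards [hf] with ω hω
    rw [zeroSet, hω]
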